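/- Let $S^2\subset\mathbb R^3$ be the unit sphere, $e=(1,0,0)$, and let $\lambda=\mathrm{Uni}(S^2)\times\mathrm{Leb}(\mathbb R^+)\times\mathrm{Uni}(S^2)$ on $D=S^2\times\mathbb R^+\times S^2$, where $\mathrm{Uni}(S^2)$ is the normalised surface measure. For $(u,h,v)\in D$ (with $u\ne e$ and $u\neq v$, which holds $\lambda$-almost everywhere) consider a point particle which moves with velocity $e$ before time $0$, is at the origin at time $0$, has velocity $u$ during the time interval $(0,h)$, and at time $h$, at the point $hu$, changes its velocity to $v$. These two changes of velocity are regarded as its first two collisions, with the unit balls centred at $$a=\frac{e-u}{|e-u|},\qquad b=hu+\frac{u-v}{|u-v|},$$ which may overlap; the second ball is ignored before time $0$. After time $h$ the particle moves freely outside the two balls and is reflected elastically whenever it would enter one of them. Let $N\in\mathbb N\cup\{\infty\}$ be the total number of collisions (including the first two), let $\tilde\beta$ be the time of the last collision (the supremum of the collision times if $N=\infty$), and let $\tilde w$ be the outgoing velocity, i.e. the velocity after the last collision (defined for $N<\infty$; the events below that involve $\tilde w$ are understood to require $N<\infty$). Let $\tilde A$ be the set of recollision events, $$\tilde A=\Bigl\{(u,h,v)\in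 D:\ \inf\bigl\{t>0:\ \bigl|hu+\tfrac{u-e}{|u-e|}+tv\bigr|<1\bigr\}<\infty\Bigr\},$$ i.e. those for which the particle hits the first ball again after the second collision. Let $\angle(x,y)\in[0,\pi]$ denote the angle between two vectors. There is a constant $C<\infty$ such that for all $s>0$ $$\lambda\bigl((u,h,v)\in\tilde A:\ \angle(-e,\tilde w)<s^{-1},\ h\le 10\bigr)\le\frac{C}{1+s},$$ $$\lambda\bigl((u,h,v)\in\tilde A:\ \angle(-e,\tilde w)<s^{-1},\ h\ge 10,\ N=3\bigr)\le\frac{C}{1+s},$$ $$\lambda\bigl((u,h,v)\in\tilde A:\ \angle(-e,\tilde w)<s^{-1},\ h\ge 10,\ N\ge 4\bigr)\le\frac{C}{(1+s)^2},$$ $$\lambda\bigl((u,h,v)\in\tilde A:\ \tilde\beta>s,\ N=3\bigr)\le\frac{C}{1+s},$$ $$\lambda\bigl((u,h,v)\in\tilde A:\ \tilde\beta>s,\ N\ge 4\bigr)\le\frac{C}{1+s^2}.$$ -/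

import Mathlib

open MeasureTheory Set
open scoped ENNReal

namespace Recollision

/-- Euclidean three-space. -/
abbrev E3 : Type := EuclideanSpace ℝ (Fin 3)

/-- The unit sphere of velocities. -/
abbrev S2 : Type := Metric.sphere (0 : E3) 1

/-- The incoming velocity: the first coordinate vector. -/
noncomputable def e : E3 := EuclideanSpace.single 0 1

/-- Centre of the first obstacle (hit at the origin, velocity `e` before and `u` after). -/
noncomputable def centreA (r : ℝ) (u : E3) : E3 := (r / ‖e - u‖) • (e - u)

/-- Centre of the second obstacle (hit at the point `ξ u`, velocity `u` before and `v` after). -/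
noncomputable def centreB (r : ℝ) (u : E3) (ξ : ℝ) (v : E3) : E3 :=
  ξ • u + (r / ‖u - v‖) • (u - v)

/-- The infimum of the times `t > 0` at which the free flight `q + t w` is in the open ball of
radius `r` about `c`; it is `∞` if the flight never enters this ball. -/
noncomputable def entryTime (r : ℝ) (c q w : E3) : ℝ≥0∞ :=
  sInf (ENNReal.ofReal '' {t : ℝ | 0 < t ∧ ‖q + t • w - c‖ < r})

/-- State immediately after a collision. -/
structure Collision where
  time : ℝ
  position : E3
  velocity : E3

/-- Free flight for a time `t`, followed by an elastic reflection in the sphere of radius `r`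
about `c`, whose outer unit normal at the point of impact is `ν`. -/
noncomputable def collide (r : ℝ) (c : E3) (t : ℝ) (s : Collision) : Collision :=
  let q : E3 := s.position + t • s.velocity
  let ν : E3 := r⁻¹ • (q - c)
  { time := s.time + t
    position := q
    velocity := s.velocity - (2 * inner ℝ s.velocity ν) • ν }

open Classical in
/-- The next collision with the two obstacles of radius `r` and centres `a`, `b`: the one whose
ball is entered first. It is `none` if neither ball is entered. (Simultaneous entry into two
overlapping balls is resolved by reflecting in the first, then, if still necessary, in the
other one without any flight in between.) -/
noncomputable def nextCollision (r : ℝ) (a b : E3) (s : Collision) : Option Collision :=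
  let tA := entryTime r a s.position s.velocity
  let tB := entryTime r b s.position s.velocity
  if tA < ∞ ∧ tA ≤ tB then some (collide r a tA.toReal s)
  else if tB < ∞ then some (collide r b tB.toReal s)
  else none

/-- The state immediately after the `k`-th collision, `none` if there are fewer than `k`
collisions. For `k = 0` it is the state immediately before the first collision. -/
noncomputable def collision (r : ℝ) (u : E3) (ξ : ℝ) (v : E3) : ℕ → Option Collision
  | 0 => some ⟨0, 0, e⟩
  | 1 => some ⟨0, 0, u⟩
  | 2 => some ⟨ξ, ξ • u, v⟩
  | k + 3 => (collision r u ξ v (k + 2)).bind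
      (nextCollision r (centreA r u) (centreB r u ξ v))

/-- The total number `N` of collisions. -/
noncomputable def numCollisions (r : ℝ) (u : E3) (ξ : ℝ) (v : E3) : ℕ∞ :=
  Set.encard {k : ℕ | 1 ≤ k ∧ (collision r u ξ v k).isSome}

open Classical in
/-- The outgoing velocity, i.e. the velocity after the `N`-th collision (there is none if
`N = ∞`). -/
noncomputable def exitVelocity (r : ℝ) (u : E3) (ξ : ℝ) (v : E3) : Option E3 :=
  if numCollisions r u ξ v = ⊤ then none
  else (collision r u ξ v (numCollisions r u ξ v).toNat).map Collision.velocity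

/-- The trapping time. The collision times are nondecreasing, so that for finite `N` this is the
time of the last collision; for `N = ∞` it is the limit of the collision times. -/
noncomputable def trappingTime (r : ℝ) (u : E3) (ξ : ℝ) (v : E3) : ℝ≥0∞ :=
  ⨆ (k : ℕ) (c : Collision) (_ : collision r u ξ v k = some c), ENNReal.ofReal c.time

/-- The recollision events: after the second collision, at `ξ u` with outgoing velocity `v`, the
particle scatters back to the first obstacle. -/
def recollisionSet (r : ℝ) : Set (S2 × ℝ × S2) :=
  {p | 0 < p.2.1 ∧ entryTime r (centreA r p.1) (p.2.1 • (p.1 : E3)) p.2.2 < ∞}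

/-- The event that the angle between `-e` and the outgoing velocity is less than `x`. -/
def exitAngleLT (r x : ℝ) : Set (S2 × ℝ × S2) :=
  {p | ∃ w : E3, exitVelocity r p.1 p.2.1 p.2.2 = some w ∧ InnerProductGeometry.angle (-e) w < x}

/-- The event that the trapping time is greater than `s`. -/
def trappedLongerThan (r s : ℝ) : Set (S2 × ℝ × S2) :=
  {p | ENNReal.ofReal s < trappingTime r p.1 p.2.1 p.2.2}

/-- The uniform probability measure on the unit sphere: normalised surface measure. -/
noncomputable def uniformSphere : Measure S2 :=
  ((volume : Measure E3).toSphere univ)⁻¹ • (volume : Measure E3).toSphere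

instance : IsProbabilityMeasure uniformSphere := by
  constructor
  have h0 : (volume : Measure E3).toSphere univ ≠ 0 := by
    rw [Ne, Measure.measure_univ_eq_zero]
    exact Measure.toSphere_ne_zero _
  simpa [uniformSphere] using ENNReal.inv_mul_cancel h0 (measure_ne_top _ _)

/-- The measure `Uni(S²) × Leb(ℝ⁺) × Uni(S²)`. -/
noncomputable def lam : Measure (S2 × ℝ × S2) :=
  uniformSphere.prod ((volume.restrict (Ioi (0 : ℝ))).prod uniformSphere)

end Recollision

/-! The proof trades the variables `(u, h, v)` for `(u, z)`, where `z` is the vector from the first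
to the second centre, with `D = ‖z‖`. For fixed `u` the second centre has a bounded Lebesgue density
(`volume_centreB_le`): a uniform outgoing direction at a hard sphere has an impact parameter of
bounded density, and `h` supplies the third coordinate. By `lam_relPos_le` an event is then bounded
by the integral over `z` of the uniform measure of the velocities `u` that lead to it. For fixed `z`
one compares two trajectories, starting with `u` and `u'`, between the same two balls.

The tool is dispersion. With normals `ν j` and velocities `w j`, the divergence `R j = ⟪w j - w' j,
ν j - ν' j⟫` starts nonnegative and does not decrease at any flight or collision
(`IsPath.divergence`). If both final velocities are `δ`-close to `-e`, the last `R` is at most `4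
δ`; and a set of `u` with mutual initial divergence at most `ε` has measure `O(ε)`
(`uniformSphere_le_of_divergence`).

Near obstacles (`D ≤ 12`) need decay in the number `k` of collisions, uniformly up to tangency at `D
= 2`. For `D < 2` the direction of the velocity turns about the axis at each collision, so that `k ^
2 * (2 - D)` is bounded (`card_le_of_overlap`). For `D > 2` the divergence grows by a factor `1 +
√((D - 2) / 2)` at a fixed proportion of the flights (`growth_gap`). In both cases the velocities
have measure `O(δ min(1, k⁻⁴ (D - 2)⁻²))`, whose integral over `z` is `O(δ / k²)`, which is summable
(`lam_near_le`).

Distant obstacles (`D ≥ 8`) magnify velocity differences by `D - 2` at each flight and collision. So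
the admissible `u` form a set of diameter `O((D - 2)^(-(k - 1)))`, and also `O(δ (D - 2)^(-(k -
2)))`; its measure is of the order of the squared diameter, to be integrated against `D² dD`
(`lam_far_le`).

The angle estimates take `δ` of order `1 / (1 + s)`. The trapping estimates use that the `k`-th
collision happens no later than time `(k - 1) (D + 2)`, so a long trapping time forces many
collisions or a large distance. -/

open scoped Pointwise

namespace Recollision

/-! ### The image of the uniform measure in the impact plane -/

/-- The last two coordinates. -/
def impact (x : E3) : ℝ × ℝ := (x 1, x 2)

/-- Spherical cone over the impact disc: `y 0` is the radius, `(y 1, y 2)` the impact parameter. -/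
noncomputable def scatterCone (y : Fin 3 → ℝ) : Fin 3 → ℝ :=
  ![y 0 * (2 * (y 1 ^ 2 + y 2 ^ 2) - 1), -2 * y 0 * √(1 - (y 1 ^ 2 + y 2 ^ 2)) * y 1,
    -2 * y 0 * √(1 - (y 1 ^ 2 + y 2 ^ 2)) * y 2]

noncomputable def scatterConeMatrix (y : Fin 3 → ℝ) : Matrix (Fin 3) (Fin 3) ℝ :=
  let q := √(1 - (y 1 ^ 2 + y 2 ^ 2))
  !![2 * (y 1 ^ 2 + y 2 ^ 2) - 1, 4 * y 0 * y 1, 4 * y 0 * y 2;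
    -2 * q * y 1, -2 * y 0 * (q - y 1 ^ 2 / q), 2 * y 0 * y 1 * y 2 / q;
    -2 * q * y 2, 2 * y 0 * y 1 * y 2 / q, -2 * y 0 * (q - y 2 ^ 2 / q)]

noncomputable def scatterConeDeriv (y : Fin 3 → ℝ) : (Fin 3 → ℝ) →L[ℝ] (Fin 3 → ℝ) :=
  LinearMap.toContinuousLinearMap (Matrix.toLin' (scatterConeMatrix y))

/-- The independence of the impact parameter is the isotropy of hard-sphere scattering in three
dimensions. On the cone over the disc, where the radius is below `1`, it bounds the Jacobian by `4`.
-/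
lemma det_scatterConeDeriv {y : Fin 3 → ℝ} (hy : y 1 ^ 2 + y 2 ^ 2 < 1) :
    (scatterConeDeriv y).det = -4 * y 0 ^ 2 := by
  have hq : 0 < √(1 - (y 1 ^ 2 + y 2 ^ 2)) := Real.sqrt_pos.2 (by linarith)
  have hq2 : √(1 - (y 1 ^ 2 + y 2 ^ 2)) ^ 2 = 1 - (y 1 ^ 2 + y 2 ^ 2) :=
    Real.sq_sqrt (by linarith)
  have : (scatterConeDeriv y).det = (scatterConeMatrix y).det := by
    rw [scatterConeDeriv, LinearMap.det_toContinuousLinearMap, LinearMap.det_toLin']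
  rw [this, Matrix.det_fin_three]
  simp only [scatterConeMatrix, Matrix.of_apply, Matrix.cons_val', Matrix.cons_val_zero,
    Matrix.cons_val_one, Matrix.cons_val, Matrix.cons_val_fin_one]
  set q := √(1 - (y 1 ^ 2 + y 2 ^ 2))
  have h1 : y 1 ^ 2 = 1 - q ^ 2 - y 2 ^ 2 := by linarith
  field_simp
  have h2 : y 1 ^ 4 = (1 - q ^ 2 - y 2 ^ 2) ^ 2 := by rw [← h1]; ring
  ring_nf
  simp only [h1, h2]
  ring

lemma hasFDerivAt_scatterCone {y : Fin 3 → ℝ} (hy : y 1 ^ 2 + y 2 ^ 2 < 1) :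
    HasFDerivAt scatterCone (scatterConeDeriv y) y := by
  have hne : 1 - (y 1 ^ 2 + y 2 ^ 2) ≠ 0 := by linarith
  have hq : 0 < √(1 - (y 1 ^ 2 + y 2 ^ 2)) := Real.sqrt_pos.2 (by linarith)
  have a (i : Fin 3) : HasFDerivAt (fun z : Fin 3 → ℝ ↦ z i)
      (ContinuousLinearMap.proj (R := ℝ) (φ := fun _ : Fin 3 ↦ ℝ) i) y := hasFDerivAt_apply i y
  have hP := ((a 1).pow 2).add ((a 2).pow 2)
  have hQ := (hP.const_sub 1).sqrt hne
  refine hasFDerivAt_pi'' fun i ↦ ?_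
  fin_cases i
  · refine ((a 0).mul ((hP.const_mul 2).sub_const 1)).congr_fderiv ?_
    ext v
    simp [scatterConeDeriv, scatterConeMatrix, dotProduct, Fin.sum_univ_three]
    ring
  · refine ((((a 0).const_mul (-2)).mul hQ).mul (a 1)).congr_fderiv ?_
    ext v
    simp [scatterConeDeriv, scatterConeMatrix, dotProduct, Fin.sum_univ_three]
    field_simp
    ring
  · refine ((((a 0).const_mul (-2)).mul hQ).mul (a 2)).congr_fderiv ?_
    ext v
    simp [scatterConeDeriv, scatterConeMatrix, dotProduct, Fin.sum_univ_three]
    field_simp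
    ring

/-- The region parametrising the cone over velocities with impact parameter in `T`. -/
def impactCylinder (T : Set (ℝ × ℝ)) : Set (Fin 3 → ℝ) :=
  {y | y 0 ∈ Ioo 0 1 ∧ (y 1, y 2) ∈ T ∧ y 1 ^ 2 + y 2 ^ 2 < 1}

lemma measurableSet_impactCylinder {T : Set (ℝ × ℝ)} (hT : MeasurableSet T) :
    MeasurableSet (impactCylinder T) := by
  have h1 : MeasurableSet {y : Fin 3 → ℝ | y 0 ∈ Ioo (0 : ℝ) 1} :=
    measurable_pi_apply 0 measurableSet_Ioo
  have h2 : MeasurableSet {y : Fin 3 → ℝ | (y 1, y 2) ∈ T} := by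
    have : Measurable fun y : Fin 3 → ℝ ↦ (y 1, y 2) := by fun_prop
    exact this hT
  have h3 : MeasurableSet {y : Fin 3 → ℝ | y 1 ^ 2 + y 2 ^ 2 < 1} :=
    measurableSet_lt (by fun_prop) measurable_const
  exact h1.inter (h2.inter h3)

lemma volume_fin_three_eq (A : Set ℝ) (T : Set (ℝ × ℝ)) :
    volume {y : Fin 3 → ℝ | y 0 ∈ A ∧ (y 1, y 2) ∈ T} = volume A * volume T := by
  have h1 := (volume_preserving_piFinSuccAbove (fun _ : Fin 3 ↦ ℝ) 0).measure_preimage_equiv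
    (A ×ˢ (MeasurableEquiv.finTwoArrow ⁻¹' T))
  have h2 := (volume_preserving_finTwoArrow ℝ).measure_preimage_equiv T
  rw [Measure.volume_eq_prod, Measure.prod_prod, h2] at h1
  rw [← h1]
  rfl

lemma volume_scatterCone_image_le {T : Set (ℝ × ℝ)} (hT : MeasurableSet T) :
    volume (scatterCone '' impactCylinder T) ≤ 4 * volume T := by
  have hm := measurableSet_impactCylinder hT
  refine (addHaar_image_le_lintegral_abs_det_fderiv volume hm
    fun y hy ↦ (hasFDerivAt_scatterCone hy.2.2).hasFDerivWithinAt).trans ?_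
  calc ∫⁻ y in impactCylinder T, ENNReal.ofReal |(scatterConeDeriv y).det|
      ≤ ∫⁻ y in impactCylinder T, 4 := by
        refine setLIntegral_mono' hm fun y hy ↦ ?_
        rw [det_scatterConeDeriv hy.2.2, show (4 : ℝ≥0∞) = ENNReal.ofReal 4 by simp]
        refine ENNReal.ofReal_le_ofReal ?_
        have h1 := hy.1.1
        have h2 := hy.1.2
        rw [abs_le]
        constructor <;> nlinarith
    _ = 4 * volume (impactCylinder T) := by simp
    _ ≤ 4 * volume T := by
        gcongr
        refine (measure_mono (t := {y | y 0 ∈ Ioo (0 : ℝ) 1 ∧ (y 1, y 2) ∈ T})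
          fun y hy ↦ ⟨hy.1, hy.2.1⟩).trans ?_
        rw [volume_fin_three_eq]
        simp

lemma norm_e : ‖e‖ = 1 := by simp [e]

lemma inner_e (x : E3) : inner ℝ e x = x 0 := by simp [e, EuclideanSpace.inner_single_left]

lemma norm_S2 (u : S2) : ‖(u : E3)‖ = 1 := by simp

lemma normSq_coord (x : E3) : ‖x‖ ^ 2 = x 0 ^ 2 + x 1 ^ 2 + x 2 ^ 2 := by
  rw [EuclideanSpace.norm_sq_eq, Fin.sum_univ_three]
  simp

/-! ### Elastic reflection in the first obstacle -/

section centreA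

variable {u : E3}

lemma norm_centreA_one (h : u ≠ e) : ‖centreA 1 u‖ = 1 := by
  have : ‖e - u‖ ≠ 0 := norm_ne_zero_iff.2 (sub_ne_zero.2 h.symm)
  rw [centreA, norm_smul, norm_div, norm_norm]
  simp [this]

lemma smul_centreA_one (h : u ≠ e) : ‖e - u‖ • centreA 1 u = e - u := by
  have : ‖e - u‖ ≠ 0 := norm_ne_zero_iff.2 (sub_ne_zero.2 h.symm)
  rw [centreA, smul_smul]
  simp [this]

lemma inner_e_centreA (hu : ‖u‖ = 1) (h : u ≠ e) : inner ℝ e (centreA 1 u) = ‖e - u‖ / 2 := by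
  have hn : ‖e - u‖ ≠ 0 := norm_ne_zero_iff.2 (sub_ne_zero.2 h.symm)
  have h2 : ‖e - u‖ ^ 2 = 2 * inner ℝ e (e - u) := by
    rw [@norm_sub_sq ℝ, inner_sub_right, norm_e, hu, real_inner_self_eq_norm_sq, norm_e]
    norm_num
    ring
  rw [centreA, inner_smul_right]
  field_simp
  linarith

lemma eq_reflect_centreA (hu : ‖u‖ = 1) (h : u ≠ e) :
    u = e - (2 * inner ℝ e (centreA 1 u)) • centreA 1 u := by
  rw [inner_e_centreA hu h, mul_div_cancel₀ _ two_ne_zero, smul_centreA_one h]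
  abel

lemma centreA_zero_pos (hu : ‖u‖ = 1) (h : u ≠ e) : 0 < centreA 1 u 0 := by
  rw [← inner_e, inner_e_centreA hu h]
  have : 0 < ‖e - u‖ := norm_pos_iff.2 (sub_ne_zero.2 h.symm)
  positivity

lemma normSq_impact_lt (hu : ‖u‖ = 1) (h : u ≠ e) :
    centreA 1 u 1 ^ 2 + centreA 1 u 2 ^ 2 < 1 := by
  have h1 := normSq_coord (centreA 1 u)
  have h2 := centreA_zero_pos hu h
  rw [norm_centreA_one h] at h1
  nlinarith

lemma centreA_zero_eq (hu : ‖u‖ = 1) (h : u ≠ e) :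
    centreA 1 u 0 = √(1 - (centreA 1 u 1 ^ 2 + centreA 1 u 2 ^ 2)) := by
  have h1 := normSq_coord (centreA 1 u)
  rw [norm_centreA_one h] at h1
  rw [show 1 - (centreA 1 u 1 ^ 2 + centreA 1 u 2 ^ 2) = centreA 1 u 0 ^ 2 by linarith]
  exact (Real.sqrt_sq (centreA_zero_pos hu h).le).symm

end centreA

lemma measurable_centreA : Measurable (centreA 1) := by
  unfold centreA
  fun_prop

lemma measurable_impact : Measurable impact := by
  unfold impact
  fun_prop

lemma scatterCone_impact {u : E3} (hu : ‖u‖ = 1) (h : u ≠ e) (r : ℝ) :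
    scatterCone ![r, centreA 1 u 1, centreA 1 u 2] = WithLp.ofLp (r • u) := by
  have h1 := eq_reflect_centreA hu h
  rw [inner_e] at h1
  have hz := centreA_zero_eq hu h
  have h3 := normSq_coord (centreA 1 u)
  rw [norm_centreA_one h] at h3
  set a := centreA 1 u
  ext i
  have hi : u i = (e - (2 * a 0) • a) i := by rw [← h1]
  fin_cases i <;> simp [scatterCone, e] at hi ⊢ <;> rw [hi]
  · left; linear_combination (-2) * h3
  · rw [← hz]; ring
  · rw [← hz]; ring

/-- Surface measure is the dimension `3` times the volume of the cone; this turns estimates on the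
sphere into estimates of volumes. -/
lemma uniformSphere_le_toSphere : ∃ C : ℝ≥0∞, C ≠ ∞ ∧
    ∀ S : Set S2, MeasurableSet S → uniformSphere S ≤
      C * volume (Ioo (0 : ℝ) 1 • ((↑) '' S : Set E3)) := by
  refine ⟨((volume : Measure E3).toSphere univ)⁻¹ * 3, ?_, fun S hS ↦ ?_⟩
  · refine ENNReal.mul_ne_top (ENNReal.inv_ne_top.2 ?_) (by simp)
    rw [Ne, Measure.measure_univ_eq_zero]
    exact Measure.toSphere_ne_zero _
  · rw [uniformSphere, Measure.smul_apply, Measure.toSphere_apply' _ hS, smul_eq_mul, mul_assoc]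
    have : Module.finrank ℝ E3 = 3 := by simp
    rw [this]
    rfl

/-- The impact parameter of a uniform outgoing velocity has a bounded density. -/
lemma uniformSphere_impact_le : ∃ C : ℝ≥0∞, C ≠ ∞ ∧ ∀ T : Set (ℝ × ℝ), MeasurableSet T →
    uniformSphere {u : S2 | (u : E3) ≠ e ∧ impact (centreA 1 u) ∈ T} ≤ C * volume T := by
  obtain ⟨C, hC, h⟩ := uniformSphere_le_toSphere
  refine ⟨C * 4, ENNReal.mul_ne_top hC (by simp), fun T hT ↦ ?_⟩
  have hm : MeasurableSet {u : S2 | (u : E3) ≠ e ∧ impact (centreA 1 u) ∈ T} := by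
    refine MeasurableSet.inter ?_ ?_
    · exact (measurableSet_eq_fun (f := fun u : S2 ↦ (u : E3)) measurable_subtype_coe
        measurable_const).compl
    · exact (measurable_impact.comp (measurable_centreA.comp measurable_subtype_coe)) hT
  refine (h _ hm).trans ?_
  rw [mul_assoc]
  gcongr
  rw [← (PiLp.volume_preserving_toLp (Fin 3)).measure_preimage_emb
    (MeasurableEquiv.toLp 2 (Fin 3 → ℝ)).measurableEmbedding]
  refine (measure_mono ?_).trans (volume_scatterCone_image_le hT)
  rintro y ⟨r, hr, _, ⟨u, hu, rfl⟩, hy⟩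
  refine ⟨![r, centreA 1 u 1, centreA 1 u 2],
    ⟨by simpa using hr, by simpa [impact] using hu.2,
      by simpa using normSq_impact_lt (norm_S2 u) hu.1⟩, ?_⟩
  rw [scatterCone_impact (norm_S2 u) hu.1]
  exact congrArg WithLp.ofLp hy

/-! ### Small caps -/

lemma uniformSphere_le_one (S : Set S2) : uniformSphere S ≤ 1 := prob_le_one

/-- The cone over a cap of radius `ε` is a tube about the segment from `0` to `u`, covered by about
`1 / ε` balls of radius `2 ε` centred at the points `j ε u`. The constant is `8 * 3`, since `ε (n +
1) ≤ 1 + 2 ε ≤ 3`. -/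
lemma volume_cone_le (u : S2) {ε : ℝ} (h0 : 0 < ε) (h1 : ε ≤ 1) :
    volume (Ioo (0 : ℝ) 1 • ((↑) '' {v : S2 | ‖(v : E3) - u‖ ≤ ε} : Set E3)) ≤
      ENNReal.ofReal (24 * ε ^ 2) * volume (Metric.ball (0 : E3) 1) := by
  set n := ⌈ε⁻¹⌉₊
  have hn : (n : ℝ) < ε⁻¹ + 1 := Nat.ceil_lt_add_one (by positivity)
  have hsub : Ioo (0 : ℝ) 1 • ((↑) '' {v : S2 | ‖(v : E3) - u‖ ≤ ε} : Set E3) ⊆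
      ⋃ j ∈ Finset.range (n + 1), Metric.closedBall ((j * ε) • (u : E3)) (2 * ε) := by
    rintro _ ⟨r, hr, _, ⟨v, hv, rfl⟩, rfl⟩
    have hj : (⌊r / ε⌋₊ : ℝ) ≤ r / ε := Nat.floor_le (by have := hr.1; positivity)
    have hj' : r / ε < ⌊r / ε⌋₊ + 1 := Nat.lt_floor_add_one _
    simp only [mem_iUnion, Finset.mem_range]
    refine ⟨⌊r / ε⌋₊, ?_, ?_⟩
    · rw [Nat.lt_succ_iff]
      refine Nat.floor_le_of_le ?_
      refine le_trans ?_ (Nat.le_ceil _)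
      rw [div_eq_mul_inv]
      exact mul_le_of_le_one_left (by positivity) hr.2.le
    · rw [mem_closedBall_iff_norm]
      have h2 : r • (v : E3) - (⌊r / ε⌋₊ * ε) • (u : E3) =
          r • ((v : E3) - u) + (r - ⌊r / ε⌋₊ * ε) • (u : E3) := by module
      simp only [h2]
      refine (norm_add_le _ _).trans ?_
      rw [norm_smul, norm_smul, norm_S2, Real.norm_eq_abs, abs_of_pos hr.1, Real.norm_eq_abs]
      rw [le_div_iff₀ h0] at hj
      rw [div_lt_iff₀ h0] at hj'
      have h3 : |r - ⌊r / ε⌋₊ * ε| ≤ ε := by rw [abs_le]; constructor <;> linarith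
      have h4 : ‖(v : E3) - u‖ ≤ ε := hv
      have := mul_le_mul hr.2.le h4 (norm_nonneg _) zero_le_one
      linarith
  refine (measure_mono hsub).trans ((measure_biUnion_finset_le _ _).trans ?_)
  simp only [Measure.addHaar_closedBall (volume : Measure E3) _ (by positivity : 0 ≤ 2 * ε),
    Finset.sum_const, Finset.card_range, nsmul_eq_mul]
  have : Module.finrank ℝ E3 = 3 := by simp
  rw [this, ← mul_assoc]
  gcongr
  rw [← ENNReal.ofReal_natCast, ← ENNReal.ofReal_mul (by positivity)]
  refine ENNReal.ofReal_le_ofReal ?_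
  push_cast
  have h5 : ε * ε⁻¹ = 1 := mul_inv_cancel₀ h0.ne'
  have h6 : ε * (n + 1) ≤ 3 := by nlinarith
  nlinarith [mul_le_mul_of_nonneg_left h6 (by positivity : 0 ≤ 8 * ε ^ 2)]

/-- A set of velocities of diameter `ε` has uniform measure `O(ε ^ 2)`. -/
lemma uniformSphere_le_of_diam : ∃ C : ℝ≥0∞, C ≠ ∞ ∧ ∀ (S : Set S2) (ε : ℝ), 0 < ε →
    (∀ u ∈ S, ∀ v ∈ S, ‖(v : E3) - u‖ ≤ ε) → uniformSphere S ≤ C * ENNReal.ofReal (ε ^ 2) := by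
  obtain ⟨C, hC, h⟩ := uniformSphere_le_toSphere
  set V := volume (Metric.ball (0 : E3) 1)
  have hV : V ≠ ∞ := measure_ball_lt_top.ne
  -- The summand `1` serves `ε > 1`, where the total mass is enough.
  refine ⟨C * (ENNReal.ofReal 24 * V) + 1, ?_, fun S ε hε hS ↦ ?_⟩
  · simp [ENNReal.add_eq_top, ENNReal.mul_ne_top, hC, hV]
  rcases S.eq_empty_or_nonempty with rfl | ⟨u, hu⟩
  · simp
  rcases le_or_gt ε 1 with h1 | h1
  · have hm : MeasurableSet {v : S2 | ‖(v : E3) - u‖ ≤ ε} :=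
      measurableSet_le (by fun_prop) measurable_const
    refine (measure_mono fun v hv ↦ hS u hu v hv).trans ((h _ hm).trans ?_)
    grw [volume_cone_le u hε h1]
    rw [ENNReal.ofReal_mul (by norm_num), add_mul]
    refine le_trans (le_of_eq ?_) le_self_add
    ring
  · refine (uniformSphere_le_one S).trans ?_
    have : (1 : ℝ≥0∞) ≤ ENNReal.ofReal (ε ^ 2) := by
      rw [ENNReal.one_le_ofReal]; nlinarith
    calc (1 : ℝ≥0∞) = 1 * 1 := by simp
      _ ≤ _ := mul_le_mul' le_add_self this

/-! ### Velocities with small mutual divergence -/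

lemma volume_prod_le_of_slices {T : Set (ℝ × ℝ)} (hT : MeasurableSet T) {I : Set ℝ}
    (hI : MeasurableSet I) {d : ℝ≥0∞} (h0 : ∀ p ∈ T, p.2 ∈ I)
    (h : ∀ y, ∀ x x', (x, y) ∈ T → (x', y) ∈ T → edist x x' ≤ d) :
    volume T ≤ d * volume I := by
  rw [Measure.volume_eq_prod, Measure.prod_apply_symm hT]
  calc ∫⁻ y, volume ((fun x ↦ (x, y)) ⁻¹' T) ≤ ∫⁻ y, I.indicator (fun _ ↦ d) y := by
        refine lintegral_mono fun y ↦ ?_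
        by_cases hy : y ∈ I
        · rw [indicator_of_mem hy]
          exact (Real.volume_le_diam _).trans (Metric.ediam_le fun x hx x' hx' ↦ h y x x' hx hx')
        · rw [indicator_of_notMem hy]
          have : (fun x ↦ (x, y)) ⁻¹' T = ∅ := by
            ext x; simp only [mem_preimage, mem_empty_iff_false, iff_false]
            exact fun hx ↦ hy (h0 _ hx)
          simp [this]
    _ = d * volume I := by rw [lintegral_indicator_const hI]

/-- Part of a thin annulus that is a graph over an interval. -/
def annulusPiece (s y₀ R K k : ℝ) : Set (ℝ × ℝ) :=
  {p | |p.2 - y₀| ≤ R ∧ 1 / 2 ≤ s * p.1 ∧ |p.1 ^ 2 + p.2 ^ 2 - K| ≤ k}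

lemma measurableSet_annulusPiece (s y₀ R K k : ℝ) : MeasurableSet (annulusPiece s y₀ R K k) := by
  refine MeasurableSet.inter ?_ (MeasurableSet.inter ?_ ?_)
  · exact measurableSet_le (f := fun p : ℝ × ℝ ↦ |p.2 - y₀|) (by fun_prop) measurable_const
  · exact measurableSet_le (g := fun p : ℝ × ℝ ↦ s * p.1) measurable_const (by fun_prop)
  · exact measurableSet_le (f := fun p : ℝ × ℝ ↦ |p.1 ^ 2 + p.2 ^ 2 - K|) (by fun_prop)
      measurable_const

/-- On a horizontal slice the squares of two points `x`, `x'` differ by at most `2 k`, while `|x +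
x'| ≥ 1`; hence the slice has length at most `2 k`. -/
lemma volume_annulusPiece_le {s : ℝ} (hs : s = 1 ∨ s = -1) (y₀ R K : ℝ) {k : ℝ} (hk : 0 ≤ k) :
    volume (annulusPiece s y₀ R K k) ≤ ENNReal.ofReal (4 * (R * k)) := by
  have h := volume_prod_le_of_slices (measurableSet_annulusPiece s y₀ R K k)
    (measurableSet_Icc (a := y₀ - R) (b := y₀ + R)) (d := ENNReal.ofReal (2 * k))
    (fun p hp ↦ by have := abs_le.1 hp.1; constructor <;> linarith)
    (fun y x x' hx hx' ↦ ?_)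
  · refine h.trans (le_of_eq ?_)
    rw [Real.volume_Icc, ← ENNReal.ofReal_mul (by positivity)]
    congr 1
    ring
  · rw [edist_dist, Real.dist_eq]
    refine ENNReal.ofReal_le_ofReal ?_
    have h1 : |x - x'| * |x + x'| ≤ 2 * k := by
      rw [← abs_mul, show (x - x') * (x + x') = (x ^ 2 + y ^ 2 - K) - (x' ^ 2 + y ^ 2 - K) by ring]
      refine (abs_sub _ _).trans ?_
      linarith [hx.2.2, hx'.2.2]
    have h2 : 1 ≤ |x + x'| := by
      have h3 := hx.2.1
      have h4 := hx'.2.1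
      simp only at h3 h4
      rcases hs with rfl | rfl
      · exact le_abs.2 (Or.inl (by linarith))
      · exact le_abs.2 (Or.inr (by linarith))
    nlinarith [abs_nonneg (x - x')]

lemma volume_swap (T : Set (ℝ × ℝ)) : volume (Prod.swap ⁻¹' T) = volume T :=
  (Measure.measurePreserving_swap (μ := (volume : Measure ℝ))
    (ν := (volume : Measure ℝ))).measure_preimage_equiv (f := MeasurableEquiv.prodComm) T

/-- The height of the unit hemisphere above the impact parameter `b`. -/
noncomputable def capHeight (b : ℝ × ℝ) : ℝ := √(1 - (b.1 ^ 2 + b.2 ^ 2))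

/-- The hypothesis degenerates at the rim of the disc, where the heights vanish: for height `q` it
only confines `B` to distance `R = √(ε / q)`. There the height term helps, since it confines `|b|²`
to an interval of radius `k = √(3 ε q)`. The area is of order `R k`, from which `q` cancels. -/
lemma exists_measurable_superset_of_divergence_le {B : Set (ℝ × ℝ)} {ε : ℝ} (hε : 0 < ε)
    (hB : ∀ b ∈ B, b.1 ^ 2 + b.2 ^ 2 < 1)
    (h : ∀ b ∈ B, ∀ b' ∈ B, (capHeight b + capHeight b') *
      ((b.1 - b'.1) ^ 2 + (b.2 - b'.2) ^ 2 + (capHeight b - capHeight b') ^ 2) ≤ ε) :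
    ∃ T, MeasurableSet T ∧ B ⊆ T ∧ volume T ≤ ENNReal.ofReal (32 * ε) := by
  rcases B.eq_empty_or_nonempty with rfl | hne
  · exact ⟨∅, .empty, subset_rfl, by simp⟩
  have hpos : ∀ b ∈ B, 0 < capHeight b := fun b hb ↦ Real.sqrt_pos.2 (by linarith [hB b hb])
  have hsq : ∀ b ∈ B, capHeight b ^ 2 = 1 - (b.1 ^ 2 + b.2 ^ 2) := fun b hb ↦
    Real.sq_sqrt (by linarith [hB b hb])
  have hle1 : ∀ b ∈ B, capHeight b ≤ 1 := fun b hb ↦ by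
    nlinarith [hpos b hb, hsq b hb, sq_nonneg b.1, sq_nonneg b.2]
  -- The maximal height need not be attained, so a point reaching half of the supremum is taken as
  -- reference.
  obtain ⟨b₀, hb₀, hmax⟩ : ∃ b₀ ∈ B, ∀ b ∈ B, capHeight b ≤ 2 * capHeight b₀ := by
    have hbdd : BddAbove (capHeight '' B) := ⟨1, by rintro _ ⟨b, hb, rfl⟩; exact hle1 b hb⟩
    obtain ⟨b₁, hb₁⟩ := hne
    have hs : 0 < sSup (capHeight '' B) :=
      (hpos b₁ hb₁).trans_le (le_csSup hbdd ⟨b₁, hb₁, rfl⟩)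
    obtain ⟨_, ⟨b₀, hb₀, rfl⟩, hlt⟩ :=
      exists_lt_of_lt_csSup ((show B.Nonempty from ⟨b₁, hb₁⟩).image capHeight) (half_lt_self hs)
    exact ⟨b₀, hb₀, fun b hb ↦ by linarith [le_csSup hbdd ⟨b, hb, rfl⟩]⟩
  set q := capHeight b₀ with hq
  have hq0 : 0 < q := hpos b₀ hb₀
  set R := √(ε / q)
  set k := √(3 * ε * q)
  have hR : 0 ≤ R := Real.sqrt_nonneg _
  have hR2 : R ^ 2 = ε / q := Real.sq_sqrt (by positivity)
  have hk : 0 ≤ k := Real.sqrt_nonneg _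
  have hk2 : k ^ 2 = 3 * ε * q := Real.sq_sqrt (by positivity)
  have hRk : R * k ≤ 2 * ε := by
    refine le_of_sq_le_sq ?_ (by positivity)
    rw [mul_pow, hR2, hk2, show ε / q * (3 * ε * q) = 3 * ε ^ 2 by field_simp]
    nlinarith [sq_nonneg ε]
  have hdist : ∀ b ∈ B, (b.1 - b₀.1) ^ 2 + (b.2 - b₀.2) ^ 2 ≤ R ^ 2 := fun b hb ↦ by
    rw [hR2, le_div_iff₀ hq0]
    have h1 := h b hb b₀ hb₀
    have h2 := hpos b hb
    have h3 : 0 ≤ (b.1 - b₀.1) ^ 2 + (b.2 - b₀.2) ^ 2 := by positivity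
    have h4 : 0 ≤ (capHeight b - q) ^ 2 := by positivity
    nlinarith [mul_nonneg h2.le h3, mul_nonneg (add_nonneg h2.le hq0.le) h4]
  have hx : ∀ b ∈ B, |b.1 - b₀.1| ≤ R := fun b hb ↦ by
    refine abs_le_of_sq_le_sq ?_ hR
    nlinarith [hdist b hb, sq_nonneg (b.2 - b₀.2)]
  have hy : ∀ b ∈ B, |b.2 - b₀.2| ≤ R := fun b hb ↦ by
    refine abs_le_of_sq_le_sq ?_ hR
    nlinarith [hdist b hb, sq_nonneg (b.1 - b₀.1)]
  have hrad : ∀ b ∈ B, |b.1 ^ 2 + b.2 ^ 2 - (b₀.1 ^ 2 + b₀.2 ^ 2)| ≤ k := fun b hb ↦ by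
    refine abs_le_of_sq_le_sq ?_ hk
    have h1 := h b hb b₀ hb₀
    have h2 := hpos b hb
    have h3 : 0 ≤ (b.1 - b₀.1) ^ 2 + (b.2 - b₀.2) ^ 2 := by positivity
    have h5 : b.1 ^ 2 + b.2 ^ 2 - (b₀.1 ^ 2 + b₀.2 ^ 2) =
        (q - capHeight b) * (capHeight b + q) := by
      linarith [hsq b hb, hsq b₀ hb₀]
    have h6 : (capHeight b + q) * (capHeight b - q) ^ 2 ≤ ε := by
      nlinarith [mul_nonneg (add_nonneg h2.le hq0.le) h3]
    rw [h5, hk2]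
    have h7 := hmax b hb
    calc ((q - capHeight b) * (capHeight b + q)) ^ 2
        = (capHeight b + q) * ((capHeight b + q) * (capHeight b - q) ^ 2) := by ring
      _ ≤ (3 * q) * ε := by gcongr; linarith
      _ = 3 * ε * q := by ring
  rcases le_or_gt (1 / 4) q with h4 | h4
  · refine ⟨Icc (b₀.1 - R) (b₀.1 + R) ×ˢ Icc (b₀.2 - R) (b₀.2 + R),
      measurableSet_Icc.prod measurableSet_Icc, fun b hb ↦ ?_, ?_⟩
    · have h1 := abs_le.1 (hx b hb)
      have h2 := abs_le.1 (hy b hb)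
      exact ⟨⟨by linarith, by linarith⟩, ⟨by linarith, by linarith⟩⟩
    · rw [Measure.volume_eq_prod, Measure.prod_prod, Real.volume_Icc, Real.volume_Icc,
        ← ENNReal.ofReal_mul (by linarith)]
      refine ENNReal.ofReal_le_ofReal ?_
      have : ε / q ≤ 4 * ε := by rw [div_le_iff₀ hq0]; nlinarith
      nlinarith
  -- All heights are now below `1 / 2`, so `|b|² > 3 / 4` and some coordinate has modulus at least
  -- `1 / 2`: four graph pieces of the annulus cover `B`.
  · set K := b₀.1 ^ 2 + b₀.2 ^ 2
    refine ⟨annulusPiece 1 b₀.2 R K k ∪ annulusPiece (-1) b₀.2 R K k ∪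
      (Prod.swap ⁻¹' annulusPiece 1 b₀.1 R K k ∪ Prod.swap ⁻¹' annulusPiece (-1) b₀.1 R K k),
      ?_, fun b hb ↦ ?_, ?_⟩
    · have := measurableSet_annulusPiece
      exact ((this _ _ _ _ _).union (this _ _ _ _ _)).union
        ((measurable_swap (this _ _ _ _ _)).union (measurable_swap (this _ _ _ _ _)))
    · have h1 := hsq b hb
      have h2 := hmax b hb
      have h3 := hpos b hb
      have hr := hrad b hb
      have hr' : |b.2 ^ 2 + b.1 ^ 2 - K| ≤ k := by rwa [add_comm]
      by_cases h5 : 1 / 2 ≤ b.1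
      · exact .inl (.inl ⟨hy b hb, by linarith, hr⟩)
      by_cases h6 : b.1 ≤ -(1 / 2)
      · exact .inl (.inr ⟨hy b hb, by linarith, hr⟩)
      by_cases h7 : 1 / 2 ≤ b.2
      · exact .inr (.inl ⟨hx b hb, by simp only [Prod.fst_swap]; linarith, hr'⟩)
      by_cases h8 : b.2 ≤ -(1 / 2)
      · exact .inr (.inr ⟨hx b hb, by simp only [Prod.fst_swap]; linarith, hr'⟩)
      exfalso
      push Not at h5 h6 h7 h8
      nlinarith
    · refine (measure_union_le _ _).trans ((add_le_add (measure_union_le _ _)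
        (measure_union_le _ _)).trans ?_)
      rw [volume_swap, volume_swap]
      grw [volume_annulusPiece_le (.inl rfl) _ _ _ hk, volume_annulusPiece_le (.inr rfl) _ _ _ hk,
        volume_annulusPiece_le (.inl rfl) _ _ _ hk, volume_annulusPiece_le (.inr rfl) _ _ _ hk]
      rw [← ENNReal.ofReal_add (by positivity) (by positivity),
        ← ENNReal.ofReal_add (by positivity) (by positivity)]
      refine ENNReal.ofReal_le_ofReal ?_
      linarith

/-- This expresses the initial divergence by the impact parameters: the coordinate `centreA 1 u 0`
is the height of the hemisphere above the impact parameter. -/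
lemma inner_sub_centreA_sub {u v : E3} (hu : ‖u‖ = 1) (hv : ‖v‖ = 1) (hue : u ≠ e) (hve : v ≠ e) :
    inner ℝ (u - v) (centreA 1 v - centreA 1 u) = (centreA 1 u 0 + centreA 1 v 0) *
      ‖centreA 1 u - centreA 1 v‖ ^ 2 := by
  have h1 := eq_reflect_centreA hu hue
  have h2 := eq_reflect_centreA hv hve
  have h3 : inner ℝ (centreA 1 u) (centreA 1 u) = (1 : ℝ) := by
    rw [real_inner_self_eq_norm_sq, norm_centreA_one hue, one_pow]
  have h4 : inner ℝ (centreA 1 v) (centreA 1 v) = (1 : ℝ) := by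
    rw [real_inner_self_eq_norm_sq, norm_centreA_one hve, one_pow]
  rw [inner_e] at h1 h2
  set a := centreA 1 u
  set b := centreA 1 v
  rw [h1, h2, ← real_inner_self_eq_norm_sq]
  simp only [inner_sub_left, inner_sub_right, inner_smul_left, RCLike.conj_to_real,
    real_inner_comm a b, h3, h4]
  ring

/-- A set of velocities after a collision with the first obstacle, whose mutual divergence is at
most `ε`, has uniform measure `O(ε)`. -/
lemma uniformSphere_le_of_divergence : ∃ C : ℝ≥0∞, C ≠ ∞ ∧ ∀ (U : Set S2) (ε : ℝ), 0 < ε →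
    (∀ u ∈ U, (u : E3) ≠ e) →
    (∀ u ∈ U, ∀ v ∈ U, inner ℝ ((u : E3) - v) (centreA 1 v - centreA 1 u) ≤ ε) →
    uniformSphere U ≤ C * ENNReal.ofReal ε := by
  obtain ⟨C, hC, h⟩ := uniformSphere_impact_le
  refine ⟨C * 32, ENNReal.mul_ne_top hC (by simp), fun U ε hε hU hdiv ↦ ?_⟩
  have hcap : ∀ u ∈ U, capHeight (impact (centreA 1 u)) = centreA 1 u 0 := fun u hu ↦
    (centreA_zero_eq (norm_S2 u) (hU u hu)).symm
  obtain ⟨T, hT, hsub, hvol⟩ := exists_measurable_superset_of_divergence_le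
    (B := (fun u : S2 ↦ impact (centreA 1 u)) '' U) hε
    (by rintro _ ⟨u, hu, rfl⟩; exact normSq_impact_lt (norm_S2 u) (hU u hu))
    (by
      rintro _ ⟨u, hu, rfl⟩ _ ⟨v, hv, rfl⟩
      have h1 := hdiv u hu v hv
      rw [inner_sub_centreA_sub (norm_S2 u) (norm_S2 v) (hU u hu) (hU v hv), normSq_coord] at h1
      rw [hcap u hu, hcap v hv]
      refine le_trans (le_of_eq ?_) h1
      simp only [impact, PiLp.sub_apply]
      ring)
  calc uniformSphere U ≤ uniformSphere {u : S2 | (u : E3) ≠ e ∧ impact (centreA 1 u) ∈ T} :=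
        measure_mono fun u hu ↦ ⟨hU u hu, hsub ⟨u, hu, rfl⟩⟩
    _ ≤ C * volume T := h T hT
    _ ≤ C * ENNReal.ofReal (32 * ε) := by gcongr
    _ = _ := by rw [ENNReal.ofReal_mul (by norm_num), mul_assoc]; simp

/-! ### The position of the second obstacle -/

/-- A linear isometry acting on the unit sphere. -/
noncomputable def isometryS2 (L : E3 ≃ₗᵢ[ℝ] E3) (v : S2) : S2 := ⟨L v, by simp⟩

lemma measurable_isometryS2 (L : E3 ≃ₗᵢ[ℝ] E3) : Measurable (isometryS2 L) :=
  (L.continuous.measurable.comp measurable_subtype_coe).subtype_mk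

lemma uniformSphere_isometry_preimage (L : E3 ≃ₗᵢ[ℝ] E3) {S : Set S2} (hS : MeasurableSet S) :
    uniformSphere (isometryS2 L ⁻¹' S) = uniformSphere S := by
  have hcone : L ⁻¹' (Ioo (0 : ℝ) 1 • ((↑) '' S : Set E3)) =
      Ioo (0 : ℝ) 1 • ((↑) '' (isometryS2 L ⁻¹' S) : Set E3) := by
    ext x
    constructor
    · rintro ⟨r, hr, _, ⟨v, hv, rfl⟩, hx⟩
      refine ⟨r, hr, L.symm v, ⟨isometryS2 L.symm v, ?_, rfl⟩, ?_⟩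
      · have : isometryS2 L (isometryS2 L.symm v) = v := Subtype.ext (by simp [isometryS2])
        rw [mem_preimage, this]
        exact hv
      · have : r • (v : E3) = L x := hx
        apply L.injective
        simp [this]
    · rintro ⟨r, hr, _, ⟨v, hv, rfl⟩, rfl⟩
      exact ⟨r, hr, L v, ⟨isometryS2 L v, hv, rfl⟩, by simp⟩
  rw [uniformSphere, Measure.smul_apply, Measure.smul_apply,
    Measure.toSphere_apply' _ (measurable_isometryS2 L hS), Measure.toSphere_apply' _ hS, ← hcone,
    L.measurePreserving.measure_preimage_emb L.toHomeomorph.measurableEmbedding]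

lemma measurePreserving_uniformSphere_isometry (L : E3 ≃ₗᵢ[ℝ] E3) :
    MeasurePreserving (isometryS2 L) uniformSphere uniformSphere :=
  ⟨measurable_isometryS2 L, Measure.ext fun S hS ↦ by
    rw [Measure.map_apply (measurable_isometryS2 L) hS, uniformSphere_isometry_preimage L hS]⟩

/-- Splitting off the first coordinate. -/
noncomputable def splitFirst : E3 ≃ᵐ ℝ × ℝ × ℝ :=
  (MeasurableEquiv.toLp 2 (Fin 3 → ℝ)).symm.trans
    ((MeasurableEquiv.piFinSuccAbove (fun _ : Fin 3 ↦ ℝ) 0).trans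
      (MeasurableEquiv.prodCongr (.refl ℝ) MeasurableEquiv.finTwoArrow))

lemma splitFirst_apply (x : E3) : splitFirst x = (x 0, impact x) := rfl

lemma measurePreserving_splitFirst : MeasurePreserving splitFirst :=
  ((MeasurePreserving.id volume).prod (volume_preserving_finTwoArrow ℝ)).comp
    ((volume_preserving_piFinSuccAbove (fun _ : Fin 3 ↦ ℝ) 0).comp
      (EuclideanSpace.volume_preserving_symm_measurableEquiv_toLp (Fin 3)))

lemma measurableSet_ne_e : MeasurableSet {v : S2 | (v : E3) ≠ e} :=
  (measurableSet_eq_fun measurable_subtype_coe measurable_const).compl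

/-- Translation in `h` is Lebesgue along the direction `e`, and the two transversal coordinates are
the impact parameter, whose law is bounded by a multiple of Lebesgue measure. Fubini combines the
two. -/
lemma volume_tube_le : ∃ C : ℝ≥0∞, C ≠ ∞ ∧ ∀ T : Set E3, MeasurableSet T →
    ((volume.restrict (Ioi (0 : ℝ))).prod uniformSphere)
      {p | (p.2 : E3) ≠ e ∧ p.1 • e + centreA 1 p.2 ∈ T} ≤ C * volume T := by
  obtain ⟨C, hC, hle⟩ := uniformSphere_impact_le
  refine ⟨C, hC, fun T hT ↦ ?_⟩
  have hT' : MeasurableSet (splitFirst.symm ⁻¹' T) := splitFirst.symm.measurable hT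
  have hvol : volume (splitFirst.symm ⁻¹' T) = volume T := by
    have := (measurePreserving_splitFirst.symm splitFirst).measure_preimage_equiv
      (f := splitFirst.symm) T
    exact this
  set T' := splitFirst.symm ⁻¹' T
  set F : ℝ × ℝ → ℝ≥0∞ := fun b ↦ volume ((fun x ↦ (x, b)) ⁻¹' T')
  have hF : Measurable F := measurable_measure_prodMk_right hT'
  have hg : Measurable fun v : S2 ↦ impact (centreA 1 v) :=
    measurable_impact.comp (measurable_centreA.comp measurable_subtype_coe)
  have hm : MeasurableSet {p : ℝ × S2 | (p.2 : E3) ≠ e ∧ p.1 • e + centreA 1 p.2 ∈ T} := by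
    refine (measurable_snd measurableSet_ne_e).inter ?_
    have : Measurable fun p : ℝ × S2 ↦ p.1 • e + centreA 1 p.2 := by
      have := measurable_centreA.comp (measurable_subtype_coe.comp
        (measurable_snd : Measurable (Prod.snd : ℝ × S2 → S2)))
      exact (by fun_prop : Measurable fun p : ℝ × S2 ↦ p.1 • e).add this
    exact this hT
  have hmap : (uniformSphere.restrict {v : S2 | (v : E3) ≠ e}).map
      (fun v : S2 ↦ impact (centreA 1 v)) ≤ C • volume := by
    refine Measure.le_iff.2 fun S hS ↦ ?_
    rw [Measure.map_apply hg hS, Measure.restrict_apply (hg hS)]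
    refine le_trans (measure_mono ?_) (hle S hS)
    exact fun v hv ↦ ⟨hv.2, hv.1⟩
  rw [Measure.prod_apply_symm hm]
  calc ∫⁻ v, (volume.restrict (Ioi (0 : ℝ)))
        ((fun h ↦ (h, v)) ⁻¹' {p : ℝ × S2 | (p.2 : E3) ≠ e ∧ p.1 • e + centreA 1 p.2 ∈ T})
        ∂uniformSphere
      ≤ ∫⁻ v, {v : S2 | (v : E3) ≠ e}.indicator (fun v ↦ F (impact (centreA 1 v))) v
        ∂uniformSphere := by
        refine lintegral_mono fun v ↦ ?_
        by_cases hv : (v : E3) ≠ e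
        · rw [indicator_of_mem (show v ∈ {v : S2 | (v : E3) ≠ e} from hv)]
          refine (Measure.restrict_apply_le _ _).trans ?_
          have hF' : F (impact (centreA 1 v)) =
              volume ((fun h ↦ h + centreA 1 v 0) ⁻¹'
                ((fun x ↦ (x, impact (centreA 1 v))) ⁻¹' T')) :=
            (measure_preimage_add_right volume _ _).symm
          rw [hF']
          refine measure_mono fun h hh ↦ ?_
          have h1 : h • e + centreA 1 v ∈ T := hh.2
          have h2 : splitFirst (h • e + centreA 1 v) =
              (h + centreA 1 v 0, impact (centreA 1 v)) := by
            simp [splitFirst_apply, impact, e]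
          simp only [mem_preimage, T', ← h2, MeasurableEquiv.symm_apply_apply]
          exact h1
        · have : (fun h : ℝ ↦ (h, v)) ⁻¹'
              {p : ℝ × S2 | (p.2 : E3) ≠ e ∧ p.1 • e + centreA 1 p.2 ∈ T} = ∅ := by
            ext h
            simp only [mem_preimage, mem_ofPred_eq, mem_empty_iff_false, iff_false]
            exact fun hh ↦ hv hh.1
          rw [this]
          simp
    _ = ∫⁻ b, F b ∂((uniformSphere.restrict {v : S2 | (v : E3) ≠ e}).map
          (fun v : S2 ↦ impact (centreA 1 v))) := by
        rw [lintegral_map hF hg, lintegral_indicator measurableSet_ne_e]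
    _ ≤ ∫⁻ b, F b ∂(C • volume) := lintegral_mono' hmap le_rfl
    _ = C * volume T := by
        rw [lintegral_smul_measure, ← hvol, Measure.volume_eq_prod ℝ (ℝ × ℝ),
          Measure.prod_apply_symm hT', smul_eq_mul]

lemma centreB_isometry (L : E3 ≃ₗᵢ[ℝ] E3) (h : ℝ) (v : E3) :
    centreB 1 (L e) h (L v) = L (h • e + centreA 1 v) := by
  simp only [centreB, centreA, map_add, map_smul, ← map_sub, L.norm_map]

/-- The centre of the second obstacle has a bounded density. -/
lemma volume_centreB_le : ∃ C : ℝ≥0∞, C ≠ ∞ ∧ ∀ (u : S2) (T : Set E3), MeasurableSet T →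
    ((volume.restrict (Ioi (0 : ℝ))).prod uniformSphere)
      {p | (p.2 : E3) ≠ u ∧ centreB 1 u p.1 p.2 ∈ T} ≤ C * volume T := by
  obtain ⟨C, hC, hle⟩ := volume_tube_le
  refine ⟨C, hC, fun u T hT ↦ ?_⟩
  -- The reflection exchanging `e` and `u` reduces to the direction `e`, because the uniform measure
  -- is invariant under isometries.
  obtain ⟨L, hL⟩ : ∃ L : E3 ≃ₗᵢ[ℝ] E3, L e = u :=
    ⟨_, Submodule.reflection_sub (by rw [norm_e, norm_S2])⟩
  have hmp := (MeasurePreserving.id (volume.restrict (Ioi (0 : ℝ)))).prod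
    (measurePreserving_uniformSphere_isometry L)
  have hm : MeasurableSet {p : ℝ × S2 | (p.2 : E3) ≠ u ∧ centreB 1 u p.1 p.2 ∈ T} := by
    refine MeasurableSet.inter ?_ ?_
    · exact (measurableSet_eq_fun (f := fun p : ℝ × S2 ↦ (p.2 : E3)) (by fun_prop)
        measurable_const).compl
    · have : Measurable fun p : ℝ × S2 ↦ centreB 1 u p.1 p.2 := by
        unfold centreB
        fun_prop
      exact this hT
  rw [← hmp.measure_preimage hm.nullMeasurableSet]
  refine (measure_mono ?_).trans ((hle _ (L.continuous.measurable hT)).trans (le_of_eq ?_))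
  · rintro ⟨h, v⟩ ⟨h1, h2⟩
    refine ⟨fun hv ↦ h1 ?_, ?_⟩
    · simp only [Prod.map, isometryS2, ← hL]
      exact congrArg L hv
    · have h3 : centreB 1 u h (L v) ∈ T := h2
      rw [← hL, centreB_isometry] at h3
      exact h3
  · rw [L.measurePreserving.measure_preimage_emb L.toHomeomorph.measurableEmbedding]

/-! ### The change of variables to the relative position of the obstacles -/

/-- Velocity after the first collision and relative position of the obstacles. -/
noncomputable def relPos (p : S2 × ℝ × S2) : S2 × E3 :=
  (p.1, centreB 1 p.1 p.2.1 p.2.2 - centreA 1 p.1)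

lemma measurable_relPos : Measurable relPos := by
  unfold relPos centreA centreB
  fun_prop

/-- The generic events: the two collisions are proper. -/
def properSet : Set (S2 × ℝ × S2) :=
  {p | (p.1 : E3) ≠ e ∧ (p.2.2 : E3) ≠ p.1 ∧ 0 < p.2.1}

/-- With `u` fixed, the density bound for the second centre applies and the translation by `centreA
1 u` preserves volume. Exchanging the integrals then leaves `z` fixed and `u` variable, the setting
in which trajectories between the same obstacles can be compared. -/
lemma lam_relPos_le : ∃ C : ℝ≥0∞, C ≠ ∞ ∧ ∀ T : Set (S2 × E3), MeasurableSet T →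
    lam (properSet ∩ relPos ⁻¹' T) ≤
      C * ∫⁻ z, uniformSphere {u | (u : E3) ≠ e ∧ (u, z) ∈ T} := by
  obtain ⟨C, hC, hle⟩ := volume_centreB_le
  refine ⟨C, hC, fun T hT ↦ ?_⟩
  have hT2 : MeasurableSet {p : S2 × E3 | (p.1 : E3) ≠ e ∧ p ∈ T} :=
    (measurable_fst measurableSet_ne_e).inter hT
  set T' := {p : S2 × E3 | (p.1 : E3) ≠ e ∧ p ∈ T}
  have hm : MeasurableSet {p : S2 × ℝ × S2 | (p.2.2 : E3) ≠ p.1 ∧ relPos p ∈ T'} :=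
    MeasurableSet.inter (measurableSet_eq_fun (f := fun p : S2 × ℝ × S2 ↦ (p.2.2 : E3))
      (g := fun p ↦ (p.1 : E3)) (by fun_prop) (by fun_prop)).compl (measurable_relPos hT2)
  calc lam (properSet ∩ relPos ⁻¹' T)
      ≤ lam {p : S2 × ℝ × S2 | (p.2.2 : E3) ≠ p.1 ∧ relPos p ∈ T'} :=
        measure_mono fun p hp ↦ ⟨hp.1.2.1, hp.1.1, hp.2⟩
    _ ≤ ∫⁻ u, C * volume (Prod.mk u ⁻¹' T') ∂uniformSphere := by
        rw [lam, Measure.prod_apply hm]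
        refine lintegral_mono fun u ↦ ?_
        have hsec : MeasurableSet (Prod.mk u ⁻¹' T') := measurable_prodMk_left hT2
        have := hle u ((fun x ↦ x - centreA 1 u) ⁻¹' (Prod.mk u ⁻¹' T'))
          ((measurable_id.sub_const (centreA 1 (u : E3))) hsec)
        have htr : volume ((fun x : E3 ↦ x - centreA 1 u) ⁻¹' (Prod.mk u ⁻¹' T')) =
            volume (Prod.mk u ⁻¹' T') := by
          simp_rw [sub_eq_add_neg]
          exact measure_preimage_add_right _ _ _
        rw [htr] at this
        exact this
    _ = C * ∫⁻ z, uniformSphere {u | (u : E3) ≠ e ∧ (u, z) ∈ T} := by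
        rw [lintegral_const_mul _ (measurable_measure_prodMk_left hT2)]
        congr 1
        rw [← Measure.prod_apply hT2, Measure.prod_apply_symm hT2]
        rfl

lemma uniformSphere_singleton (u : S2) : uniformSphere {u} = 0 := by
  obtain ⟨C, hC, h⟩ := uniformSphere_le_of_diam
  refine le_antisymm (le_of_forall_pos_le_add fun ε hε ↦ ?_) zero_le
  by_cases hε' : ε = ∞
  · simp [hε']
  have ht : Filter.Tendsto (fun x : ℝ ↦ C * ENNReal.ofReal (x ^ 2)) (nhdsWithin 0 (Ioi 0))
      (nhds (C * ENNReal.ofReal ((0 : ℝ) ^ 2))) := by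
    refine Filter.Tendsto.mono_left ?_ nhdsWithin_le_nhds
    refine ENNReal.Tendsto.const_mul ?_ (.inr hC)
    exact (ENNReal.continuous_ofReal.comp (continuous_pow 2)).tendsto 0
  have h0 : C * ENNReal.ofReal ((0 : ℝ) ^ 2) < ε := by simpa using hε
  obtain ⟨x, hx1, hx2⟩ := ((ht.eventually_lt_const h0).and self_mem_nhdsWithin).exists
  rw [zero_add]
  refine (h {u} x hx2 ?_).trans hx1.le
  rintro _ rfl _ rfl
  simpa using le_of_lt hx2

lemma lam_compl_properSet : lam properSetᶜ = 0 := by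
  have h1 : ∀ᵐ p ∂lam, (p.1 : E3) ≠ e := by
    have : ∀ᵐ u : S2 ∂uniformSphere, (u : E3) ≠ e := by
      have he : e ∈ Metric.sphere (0 : E3) 1 := by simp [norm_e]
      refine measure_mono_null (fun u hu ↦ ?_) (uniformSphere_singleton ⟨e, he⟩)
      simp only [mem_compl_iff, mem_ofPred_eq, not_not] at hu
      exact Subtype.ext hu
    exact Measure.quasiMeasurePreserving_fst.ae this
  have h2 : ∀ᵐ p ∂lam, 0 < p.2.1 := by
    have : ∀ᵐ h ∂(volume.restrict (Ioi (0 : ℝ))), 0 < h := ae_restrict_mem measurableSet_Ioi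
    exact Measure.quasiMeasurePreserving_snd.ae (Measure.quasiMeasurePreserving_fst.ae this)
  have h3 : ∀ᵐ p ∂lam, (p.2.2 : E3) ≠ p.1 := by
    have hm : MeasurableSet {p : S2 × ℝ × S2 | (p.2.2 : E3) ≠ p.1} :=
      (measurableSet_eq_fun (f := fun p : S2 × ℝ × S2 ↦ (p.2.2 : E3))
      (g := fun p ↦ (p.1 : E3)) (by fun_prop) (by fun_prop)).compl
    rw [lam, Measure.ae_prod_iff_ae_ae hm]
    refine Filter.Eventually.of_forall fun u ↦ ?_
    have : ∀ᵐ v : S2 ∂uniformSphere, (v : E3) ≠ u := by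
      refine measure_mono_null (fun v hv ↦ ?_) (uniformSphere_singleton u)
      simp only [mem_compl_iff, mem_ofPred_eq, not_not] at hv
      exact Subtype.ext hv
    exact Measure.quasiMeasurePreserving_snd.ae this
  filter_upwards [h1, h2, h3] with p hp1 hp2 hp3 using ⟨hp1, hp3, hp2⟩

/-- Integration of a radial function. -/
lemma lintegral_radial_le : ∃ C : ℝ≥0∞, C ≠ ∞ ∧ ∀ f : ℝ → ℝ≥0∞, Measurable f →
    ∫⁻ z : E3, f ‖z‖ ≤ C * ∫⁻ y in Ioi (0 : ℝ), ENNReal.ofReal (y ^ 2) * f y := by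
  refine ⟨(volume : Measure E3).toSphere univ, measure_ne_top _ _, fun f hf ↦ ?_⟩
  have h3 : Module.finrank ℝ E3 - 1 = 2 := by simp
  have hmp := (volume : Measure E3).measurePreserving_homeomorphUnitSphereProd
  have hcoe : Measurable fun a : Ioi (0 : ℝ) ↦ f a := hf.comp measurable_subtype_coe
  calc ∫⁻ z : E3, f ‖z‖ = ∫⁻ z in ({0}ᶜ : Set E3), f ‖z‖ := by
        rw [restrict_compl_singleton]
    _ = ∫⁻ z : ({0}ᶜ : Set E3), f ‖(z : E3)‖ ∂((volume : Measure E3).comap (↑)) :=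
        (lintegral_subtype_comap (measurableSet_singleton _).compl fun x ↦ f ‖x‖).symm
    _ = ∫⁻ x : S2 × Ioi (0 : ℝ), f x.2
          ∂((volume : Measure E3).toSphere.prod (.volumeIoiPow 2)) := by
        have := hmp.lintegral_comp (hcoe.comp measurable_snd)
        rw [h3] at this
        simpa using this
    _ = (volume : Measure E3).toSphere univ *
          ∫⁻ x : Ioi (0 : ℝ), f x ∂(Measure.volumeIoiPow 2) := by
        have hae : AEMeasurable (fun x : S2 × Ioi (0 : ℝ) ↦ f x.2)
            ((volume : Measure E3).toSphere.prod (.volumeIoiPow 2)) :=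
          (hcoe.comp measurable_snd).aemeasurable
        rw [lintegral_prod _ hae]
        dsimp only
        exact (lintegral_const _).trans (mul_comm _ _)
    _ ≤ _ := by
        gcongr
        rw [Measure.volumeIoiPow, lintegral_withDensity_eq_lintegral_mul _ _ hcoe]
        · simp only [Pi.mul_apply]
          rw [lintegral_subtype_comap measurableSet_Ioi fun y ↦ ENNReal.ofReal (y ^ 2) * f y]
        · fun_prop

/-! ### Paths -/

/-- The vector from the obstacle of the `j`-th collision (counted from `0`) to the other one, where
`z` is the vector from the first to the second obstacle. -/
noncomputable def side (z : E3) (j : ℕ) : E3 := (-1 : ℝ) ^ j • z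

lemma side_succ (z : E3) (j : ℕ) : side z (j + 1) = -side z j := by
  simp [side, pow_succ]

lemma norm_side (z : E3) (j : ℕ) : ‖side z j‖ = ‖z‖ := by
  simp [side, norm_smul]

/-- A path with `k` collisions: `ν j` is the outer unit normal and `w j` the outgoing velocity at
the `j`-th collision, all scalar products of which are at least `m` (or positive). -/
structure IsPath (P : ℝ → Prop) (k : ℕ) (u z : E3) (ν w : ℕ → E3) : Prop where
  -- These bounds at all indices, also beyond `k`, keep the sequences in a compact product;
  -- `measurableSet_pathSet` relies on this.
  normal_le : ∀ j, ‖ν j‖ ≤ 1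
  vel_le : ∀ j, ‖w j‖ ≤ 1
  normal : ∀ j < k, ‖ν j‖ = 1
  vel : ∀ j < k, ‖w j‖ = 1
  out : ∀ j < k, P (inner ℝ (w j) (ν j))
  vel_zero : w 0 = u
  init : u = e + (2 * inner ℝ u (ν 0)) • ν 0
  reflect : ∀ j, j + 1 < k →
    w (j + 1) = w j + (2 * inner ℝ (w (j + 1)) (ν (j + 1))) • ν (j + 1)
  flight : ∀ j, j + 1 < k →
    side z j + ν (j + 1) - ν j = ‖side z j + ν (j + 1) - ν j‖ • w j
  avoid : ∀ j < k, 1 ≤ ‖ν j - side z j‖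

/-- The parameters of the paths with `k` collisions whose final velocity is `δ`-close to `-e`. -/
def pathSet (k : ℕ) (δ : ℝ) : Set (S2 × E3) :=
  {p | ∃ ν w, IsPath (0 < ·) k p.1 p.2 ν w ∧ ‖w (k - 1) + e‖ ≤ δ}

lemma IsPath.mono {P Q : ℝ → Prop} {k : ℕ} {u z : E3} {ν w : ℕ → E3} (h : IsPath P k u z ν w)
    (hPQ : ∀ j < k, P (inner ℝ (w j) (ν j)) → Q (inner ℝ (w j) (ν j))) : IsPath Q k u z ν w :=
  ⟨h.1, h.2, h.3, h.4, fun j hj ↦ hPQ j hj (h.5 j hj), h.6, h.7, h.8, h.9, h.10⟩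

lemma IsPath.take {P : ℝ → Prop} {k l : ℕ} {u z : E3} {ν w : ℕ → E3} (h : IsPath P k u z ν w)
    (hl : l ≤ k) : IsPath P l u z ν w :=
  ⟨h.1, h.2, fun j hj ↦ h.3 j (by lia), fun j hj ↦ h.4 j (by lia), fun j hj ↦ h.5 j (by lia),
    h.6, h.7, fun j hj ↦ h.8 j (by lia), fun j hj ↦ h.9 j (by lia), fun j hj ↦ h.10 j (by lia)⟩

lemma isClosed_isPath (m : ℝ) (k : ℕ) : IsClosed {x : (S2 × E3) × (ℕ → E3) × (ℕ → E3) |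
    IsPath (m ≤ ·) k x.1.1 x.1.2 x.2.1 x.2.2} := by
  have hs (j : ℕ) : Continuous fun z : E3 ↦ side z j := by unfold side; fun_prop
  have : {x : (S2 × E3) × (ℕ → E3) × (ℕ → E3) |
      IsPath (m ≤ ·) k x.1.1 x.1.2 x.2.1 x.2.2} = {x |
      (∀ j, ‖x.2.1 j‖ ≤ 1) ∧ (∀ j, ‖x.2.2 j‖ ≤ 1) ∧ (∀ j < k, ‖x.2.1 j‖ = 1) ∧
      (∀ j < k, ‖x.2.2 j‖ = 1) ∧ (∀ j < k, m ≤ inner ℝ (x.2.2 j) (x.2.1 j)) ∧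
      x.2.2 0 = x.1.1 ∧ (x.1.1 : E3) = e + (2 * inner ℝ (x.1.1 : E3) (x.2.1 0)) • x.2.1 0 ∧
      (∀ j, j + 1 < k → x.2.2 (j + 1) = x.2.2 j +
        (2 * inner ℝ (x.2.2 (j + 1)) (x.2.1 (j + 1))) • x.2.1 (j + 1)) ∧
      (∀ j, j + 1 < k → side x.1.2 j + x.2.1 (j + 1) - x.2.1 j =
        ‖side x.1.2 j + x.2.1 (j + 1) - x.2.1 j‖ • x.2.2 j) ∧
      (∀ j < k, 1 ≤ ‖x.2.1 j - side x.1.2 j‖)} := by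
    ext x
    exact ⟨fun h ↦ ⟨h.1, h.2, h.3, h.4, h.5, h.6, h.7, h.8, h.9, h.10⟩,
      fun ⟨h1, h2, h3, h4, h5, h6, h7, h8, h9, h10⟩ ↦ ⟨h1, h2, h3, h4, h5, h6, h7, h8, h9, h10⟩⟩
  rw [this]
  simp only [ofPred_and, ofPred_forall]
  have hs' (j : ℕ) : Continuous fun x : (S2 × E3) × (ℕ → E3) × (ℕ → E3) ↦ side x.1.2 j :=
    (hs j).comp (by fun_prop)
  refine IsClosed.inter ?_ <| IsClosed.inter ?_ <| IsClosed.inter ?_ <| IsClosed.inter ?_ <|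
    IsClosed.inter ?_ <| IsClosed.inter ?_ <| IsClosed.inter ?_ <| IsClosed.inter ?_ <|
    IsClosed.inter ?_ ?_
  · exact isClosed_iInter fun j ↦ isClosed_le (by fun_prop) (by fun_prop)
  · exact isClosed_iInter fun j ↦ isClosed_le (by fun_prop) (by fun_prop)
  · exact isClosed_iInter fun j ↦ isClosed_iInter fun _ ↦ isClosed_eq (by fun_prop) (by fun_prop)
  · exact isClosed_iInter fun j ↦ isClosed_iInter fun _ ↦ isClosed_eq (by fun_prop) (by fun_prop)
  · exact isClosed_iInter fun j ↦ isClosed_iInter fun _ ↦ isClosed_le (by fun_prop) (by fun_prop)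
  · exact isClosed_eq (by fun_prop) (by fun_prop)
  · exact isClosed_eq (by fun_prop) (by fun_prop)
  · exact isClosed_iInter fun j ↦ isClosed_iInter fun _ ↦ isClosed_eq (by fun_prop) (by fun_prop)
  · exact isClosed_iInter fun j ↦ isClosed_iInter fun _ ↦ isClosed_eq (by fun_prop) (by fun_prop)
  · exact isClosed_iInter fun j ↦ isClosed_iInter fun _ ↦ isClosed_le (by fun_prop) (by fun_prop)

/-- The existential quantifier over paths is a projection. Replacing positivity of the `k` scalar
products by the bound `1 / (m + 1)` and bounding `z` by `n` makes the conditions compact, so the set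
is a countable union of compact projections. -/
lemma measurableSet_pathSet (k : ℕ) (δ : ℝ) : MeasurableSet (pathSet k δ) := by
  let K (m n : ℕ) : Set ((S2 × E3) × (ℕ → E3) × (ℕ → E3)) :=
    ((univ ×ˢ Metric.closedBall 0 n) ×ˢ (univ.pi (fun _ ↦ Metric.closedBall 0 1) ×ˢ
      univ.pi (fun _ ↦ Metric.closedBall 0 1))) ∩
    ({x | IsPath (1 / ((m : ℝ) + 1) ≤ ·) k x.1.1 x.1.2 x.2.1 x.2.2} ∩ {x | ‖x.2.2 (k - 1) + e‖ ≤ δ})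
  have hK (m n : ℕ) : IsCompact (K m n) := by
    refine IsCompact.inter_right ?_ ((isClosed_isPath _ k).inter
      (isClosed_le (by fun_prop) (by fun_prop)))
    exact (isCompact_univ.prod (isCompact_closedBall _ _)).prod
      ((isCompact_univ_pi fun _ ↦ isCompact_closedBall _ _).prod
        (isCompact_univ_pi fun _ ↦ isCompact_closedBall _ _))
  have : pathSet k δ = ⋃ (m : ℕ) (n : ℕ), Prod.fst '' K m n := by
    ext ⟨u, z⟩
    simp only [mem_iUnion]
    constructor
    · rintro ⟨ν, w, h, hδ⟩
      obtain ⟨m, hm⟩ : ∃ m : ℕ, ∀ j < k, 1 / ((m : ℝ) + 1) ≤ inner ℝ (w j) (ν j) := by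
        have : ∀ᶠ m : ℕ in Filter.atTop, ∀ j ∈ Finset.range k,
            1 / ((m : ℝ) + 1) ≤ inner ℝ (w j) (ν j) := by
          rw [Filter.eventually_all_finset]
          intro j hj
          exact (tendsto_one_div_add_atTop_nhds_zero_nat.eventually_lt_const
            (h.out j (by simpa using hj))).mono fun _ ↦ le_of_lt
        obtain ⟨m, hm⟩ := this.exists
        exact ⟨m, fun j hj ↦ hm j (by simpa using hj)⟩
      obtain ⟨n, hn⟩ := exists_nat_ge ‖z‖
      refine ⟨m, n, ((u, z), ν, w), ⟨⟨⟨mem_univ _, by simpa using hn⟩, fun j _ ↦ ?_, fun j _ ↦ ?_⟩,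
        h.mono fun j hj _ ↦ hm j hj, hδ⟩, rfl⟩
      · simpa using h.normal_le j
      · simpa using h.vel_le j
    · rintro ⟨m, n, ⟨⟨u', z'⟩, ν, w⟩, ⟨-, h, hδ⟩, hx⟩
      obtain ⟨rfl, rfl⟩ := Prod.mk.inj hx
      refine ⟨ν, w, IsPath.mono (P := (1 / ((m : ℝ) + 1) ≤ ·)) h fun j hj hj' ↦ ?_, hδ⟩
      exact lt_of_lt_of_le (by positivity) hj'
  rw [this]
  exact MeasurableSet.iUnion fun m ↦ MeasurableSet.iUnion fun n ↦
    ((hK m n).image continuous_fst).isClosed.measurableSet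

/-! ### The dynamics follow paths -/

lemma normSq_flight (d w : E3) (hw : ‖w‖ = 1) (t : ℝ) :
    ‖d + t • w‖ ^ 2 = ‖d‖ ^ 2 + 2 * t * inner ℝ w d + t ^ 2 := by
  rw [@norm_add_sq ℝ, inner_smul_right, norm_smul, hw, real_inner_comm]
  simp
  ring

/-- A particle leaving a ball never returns to it in free flight. Hence collisions with the two
balls alternate. -/
lemma entryTime_eq_top {c q w : E3} (hq : ‖q - c‖ = 1) (hw : ‖w‖ = 1)
    (h : 0 < inner ℝ w (q - c)) : entryTime 1 c q w = ∞ := by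
  have : {t : ℝ | 0 < t ∧ ‖q + t • w - c‖ < 1} = ∅ := by
    refine eq_empty_of_forall_notMem fun t ht ↦ ?_
    have h1 := normSq_flight (q - c) w hw t
    rw [show q - c + t • w = q + t • w - c by abel, hq] at h1
    nlinarith [ht.1, ht.2, norm_nonneg (q + t • w - c), mul_pos ht.1 h]
  rw [entryTime, this]
  simp

/-- The entry time is the smaller root `-β - r` of a quadratic. Entering the open ball makes the
discriminant positive, which excludes grazing and gives the strict inequality for the incoming
velocity. -/
lemma entryTime_spec {c q w : E3} (hq : 1 ≤ ‖q - c‖) (hw : ‖w‖ = 1)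
    (h : entryTime 1 c q w < ∞) : ‖q + (entryTime 1 c q w).toReal • w - c‖ = 1 ∧
      inner ℝ w (q + (entryTime 1 c q w).toReal • w - c) < 0 := by
  set d := q - c with hd
  set β : ℝ := inner ℝ w d
  have hn (t : ℝ) : ‖q + t • w - c‖ ^ 2 = ‖d‖ ^ 2 + 2 * t * β + t ^ 2 := by
    rw [← normSq_flight d w hw, hd]
    congr 2
    abel
  have hlt (t : ℝ) : ‖q + t • w - c‖ < 1 ↔ ‖d‖ ^ 2 + 2 * t * β + t ^ 2 < 1 := by
    rw [← hn, sq_lt_one_iff₀ (norm_nonneg _)]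
  obtain ⟨t₀, ht₀, ht₀'⟩ : {t : ℝ | 0 < t ∧ ‖q + t • w - c‖ < 1}.Nonempty := by
    rw [nonempty_iff_ne_empty]
    intro h0
    rw [entryTime, h0] at h
    simp at h
  rw [hlt] at ht₀'
  have hβ : β < 0 := by nlinarith
  set Δ := β ^ 2 - (‖d‖ ^ 2 - 1)
  have hΔ : 0 < Δ := by nlinarith [sq_nonneg (t₀ + β)]
  have hr := Real.sqrt_pos.2 hΔ
  have hr2 := Real.sq_sqrt hΔ.le
  set r := √Δ
  have hrβ : r ≤ -β := by
    refine le_of_sq_le_sq ?_ (by linarith)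
    rw [hr2]
    nlinarith
  have hent : entryTime 1 c q w = ENNReal.ofReal (-β - r) := by
    refine le_antisymm ?_ ?_
    · have hx (x : ℝ) (hx1 : -β - r < x) (hx2 : x < -β + r) :
          entryTime 1 c q w ≤ ENNReal.ofReal x := by
        refine sInf_le ⟨x, ⟨by linarith, ?_⟩, rfl⟩
        rw [hlt]
        nlinarith [mul_pos (sub_pos.2 hx1) (sub_pos.2 hx2)]
      have ht : Filter.Tendsto ENNReal.ofReal (nhdsWithin (-β - r) (Ioi (-β - r)))
          (nhds (ENNReal.ofReal (-β - r))) :=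
        (ENNReal.continuous_ofReal.tendsto _).mono_left nhdsWithin_le_nhds
      refine ge_of_tendsto ht ?_
      filter_upwards [Ioo_mem_nhdsGT (show -β - r < -β + r by linarith)] with x hx'
      exact hx x hx'.1 hx'.2
    · refine le_sInf ?_
      rintro _ ⟨x, ⟨-, hx⟩, rfl⟩
      refine ENNReal.ofReal_le_ofReal ?_
      rw [hlt] at hx
      by_contra! hc
      nlinarith [mul_nonneg (by linarith : 0 ≤ -β - r - x) (by linarith : 0 ≤ -β + r - x)]
  rw [hent, ENNReal.toReal_ofReal (by linarith)]
  constructor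
  · rw [← sq_eq_sq₀ (norm_nonneg _) zero_le_one, hn]
    linear_combination hr2
  · rw [show q + (-β - r) • w - c = d + (-β - r) • w by rw [hd]; abel, inner_add_right,
      inner_smul_right, real_inner_self_eq_norm_sq, hw]
    change β + _ < 0
    linarith

/-- The particle leaves the unit ball about `a` and is outside of the unit ball about `b`. -/
structure Outgoing (a b : E3) (s : Collision) : Prop where
  vel : ‖s.velocity‖ = 1
  normal : ‖s.position - a‖ = 1
  out : 0 < inner ℝ s.velocity (s.position - a)
  avoid : 1 ≤ ‖s.position - b‖

/-- A flight of duration `t` between two collisions, the second one with the ball about `b`. -/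
structure FliesTo (b : E3) (s s' : Collision) (t : ℝ) : Prop where
  nonneg : 0 ≤ t
  position : s'.position = s.position + t • s.velocity
  time : s'.time = s.time + t
  reflect : s'.velocity = s.velocity +
    (2 * inner ℝ s'.velocity (s'.position - b)) • (s'.position - b)

lemma Outgoing.collide {a b : E3} {s : Collision} (h : Outgoing a b s)
    (ht : entryTime 1 b s.position s.velocity < ∞) :
    Outgoing b a (collide 1 b (entryTime 1 b s.position s.velocity).toReal s) ∧
      FliesTo b s (Recollision.collide 1 b (entryTime 1 b s.position s.velocity).toReal s)
        (entryTime 1 b s.position s.velocity).toReal := by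
  obtain ⟨h1, h2⟩ := entryTime_spec h.avoid h.vel ht
  have ht0 : 0 ≤ (entryTime 1 b s.position s.velocity).toReal := ENNReal.toReal_nonneg
  set t := (entryTime 1 b s.position s.velocity).toReal
  have h3 : ‖s.position + t • s.velocity - a‖ ^ 2 =
      ‖s.position - a‖ ^ 2 + 2 * t * inner ℝ s.velocity (s.position - a) + t ^ 2 := by
    rw [← normSq_flight _ _ h.vel]
    congr 2
    abel
  have h4 := h.out
  have h5 : inner ℝ (s.position + t • s.velocity - b) (s.position + t • s.velocity - b)
      = (1 : ℝ) := by
    rw [real_inner_self_eq_norm_sq, h1, one_pow]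
  set ν := s.position + t • s.velocity - b with hν
  have h6 : (Recollision.collide 1 b t s).velocity =
      s.velocity - (2 * inner ℝ s.velocity ν) • ν := by
    simp [Recollision.collide, hν]
  have h7 : (Recollision.collide 1 b t s).position = s.position + t • s.velocity := rfl
  have h8 : inner ℝ (Recollision.collide 1 b t s).velocity ν = -inner ℝ s.velocity ν := by
    rw [h6, inner_sub_left, inner_smul_left, h5]
    simp
    ring
  refine ⟨⟨?_, ?_, ?_, ?_⟩, ⟨ht0, h7, rfl, ?_⟩⟩
  · rw [h6, ← sq_eq_sq₀ (norm_nonneg _) zero_le_one, @norm_sub_sq ℝ, norm_smul, inner_smul_right,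
      h.vel, h1, mul_one, Real.norm_eq_abs, sq_abs]
    norm_num
    ring
  · rw [h7, h1]
  · rw [h7, ← hν, h8]
    linarith
  · rw [h7, ← one_le_sq_iff₀ (norm_nonneg _), h3, h.normal]
    nlinarith [mul_nonneg ht0 h4.le]
  · rw [h7, ← hν, h8, h6]
    module

lemma Outgoing.nextCollision_left {a b : E3} {s s' : Collision} (h : Outgoing a b s)
    (hs : nextCollision 1 a b s = some s') :
    Outgoing b a s' ∧ ∃ t, FliesTo b s s' t := by
  have htop := entryTime_eq_top h.normal h.vel h.out
  simp only [nextCollision, htop, lt_self_iff_false, false_and, if_false] at hs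
  split_ifs at hs with hb
  obtain rfl := Option.some.inj hs
  exact ⟨(h.collide hb).1, _, (h.collide hb).2⟩

lemma Outgoing.nextCollision_right {a b : E3} {s s' : Collision} (h : Outgoing b a s)
    (hs : nextCollision 1 a b s = some s') :
    Outgoing a b s' ∧ ∃ t, FliesTo a s s' t := by
  have htop := entryTime_eq_top h.normal h.vel h.out
  simp only [nextCollision, htop, le_top, and_true, lt_self_iff_false, if_false] at hs
  split_ifs at hs with hb
  obtain rfl := Option.some.inj hs
  exact ⟨(h.collide hb).1, _, (h.collide hb).2⟩

/-- Centre of the obstacle of the `j`-th collision, counted from `0`. -/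
noncomputable def centre (u : E3) (h : ℝ) (v : E3) (j : ℕ) : E3 :=
  if Even j then centreA 1 u else centreB 1 u h v

lemma centre_succ_succ (u : E3) (h : ℝ) (v : E3) (j : ℕ) :
    centre u h v (j + 2) = centre u h v j := by
  simp [centre, Nat.even_add]

lemma centre_succ (u : E3) (h : ℝ) (v : E3) (j : ℕ) :
    centre u h v (j + 1) = centre u h v j + side (centreB 1 u h v - centreA 1 u) j := by
  rcases Nat.even_or_odd j with hj | hj
  · have : ¬Even (j + 1) := by simpa [Nat.even_add_one] using hj
    simp [centre, side, hj, this, hj.neg_one_pow]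
  · have h1 : ¬Even j := by simpa using hj
    have : Even (j + 1) := by simpa [Nat.even_add_one] using hj
    simp [centre, side, h1, this, hj.neg_one_pow]

section collision

variable {u : E3} {h : ℝ} {v : E3}

lemma norm_sub_div {x y : E3} (hxy : x ≠ y) : ‖(1 / ‖x - y‖) • (x - y)‖ = 1 := by
  have : ‖x - y‖ ≠ 0 := norm_ne_zero_iff.2 (sub_ne_zero.2 hxy)
  rw [norm_smul]
  simp [this]

lemma inner_left_sub_div {x y : E3} (hx : ‖x‖ = 1) (hy : ‖y‖ = 1) (hxy : x ≠ y) :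
    inner ℝ x ((1 / ‖x - y‖) • (x - y)) = ‖x - y‖ / 2 := by
  have hn : ‖x - y‖ ≠ 0 := norm_ne_zero_iff.2 (sub_ne_zero.2 hxy)
  have h2 : ‖x - y‖ ^ 2 = 2 * inner ℝ x (x - y) := by
    rw [@norm_sub_sq ℝ, inner_sub_right, hx, hy, real_inner_self_eq_norm_sq, hx]
    norm_num
    ring
  rw [inner_smul_right]
  field_simp
  linarith

lemma inner_right_sub_div {x y : E3} (hx : ‖x‖ = 1) (hy : ‖y‖ = 1) (hxy : x ≠ y) :
    inner ℝ y ((1 / ‖x - y‖) • (x - y)) = -(‖x - y‖ / 2) := by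
  have h1 := inner_left_sub_div hy hx hxy.symm
  rw [norm_sub_rev, ← neg_sub x y, smul_neg, inner_neg_right] at h1
  linarith

lemma first_flight (hu : ‖u‖ = 1) (hv : ‖v‖ = 1) (hue : u ≠ e) (hvu : v ≠ u) (hh : 0 < h) :
    Outgoing (centreA 1 u) (centreB 1 u h v) ⟨0, 0, u⟩ ∧
    Outgoing (centreB 1 u h v) (centreA 1 u) ⟨h, h • u, v⟩ ∧
    FliesTo (centreB 1 u h v) ⟨0, 0, u⟩ ⟨h, h • u, v⟩ h := by
  have ha := norm_sub_div hue.symm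
  have ha2 := inner_right_sub_div norm_e hu hue.symm
  have hb := norm_sub_div hvu.symm
  have hb1 := inner_left_sub_div hu hv hvu.symm
  have hb2 := inner_right_sub_div hu hv hvu.symm
  have hpa : 0 < ‖e - u‖ := norm_pos_iff.2 (sub_ne_zero.2 hue.symm)
  have hpb : 0 < ‖u - v‖ := norm_pos_iff.2 (sub_ne_zero.2 hvu.symm)
  have hpb' : ‖u - v‖ * (1 / ‖u - v‖) = 1 := by field_simp
  set a := (1 / ‖e - u‖) • (e - u)
  set b := (1 / ‖u - v‖) • (u - v) with hb_def
  have hA : centreA 1 u = a := rfl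
  have hB : centreB 1 u h v = h • u + b := rfl
  rw [hA, hB]
  refine ⟨⟨hu, by simpa using ha, by simpa [ha2] using hpa, ?_⟩, ⟨hv, by simpa using hb, ?_, ?_⟩,
    ⟨hh.le, by simp, by simp, ?_⟩⟩
  · simp only [zero_sub, norm_neg]
    have := normSq_flight b u hu h
    rw [add_comm, hb1, hb] at this
    rw [← one_le_sq_iff₀ (norm_nonneg _), this]
    nlinarith [mul_pos hh hpb]
  · simpa [hb2] using hpb
  · have := normSq_flight (-a) u hu h
    rw [inner_neg_right, ha2, norm_neg, ha, show -a + h • u = h • u - a by abel] at this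
    rw [← one_le_sq_iff₀ (norm_nonneg _)]
    simp only [this]
    nlinarith [mul_pos hh hpa]
  · simp only [sub_add_cancel_left, inner_neg_right, hb2]
    rw [hb_def, neg_neg, mul_div_cancel₀ _ two_ne_zero, smul_neg, smul_smul, hpb']
    simp

lemma collision_step (hu : ‖u‖ = 1) (hv : ‖v‖ = 1) (hue : u ≠ e) (hvu : v ≠ u) (hh : 0 < h)
    (j : ℕ) {s' : Collision} (hs' : collision 1 u h v (j + 2) = some s') :
    ∃ s, collision 1 u h v (j + 1) = some s ∧
      Outgoing (centre u h v j) (centre u h v (j + 1)) s ∧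
      Outgoing (centre u h v (j + 1)) (centre u h v j) s' ∧
      ∃ t, FliesTo (centre u h v (j + 1)) s s' t := by
  induction j generalizing s' with
  | zero =>
    obtain ⟨h1, h2, h3⟩ := first_flight hu hv hue hvu hh
    refine ⟨⟨0, 0, u⟩, rfl, ?_⟩
    obtain rfl : ⟨h, h • u, v⟩ = s' := Option.some.inj hs'
    exact ⟨by simpa [centre] using h1, by simpa [centre] using h2, h, by simpa [centre] using h3⟩
  | succ j ih =>
    have hs : (collision 1 u h v (j + 2)).bind
      (nextCollision 1 (centreA 1 u) (centreB 1 u h v)) = some s' := hs'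
    obtain ⟨s, hs1, hs2⟩ := Option.bind_eq_some_iff.1 hs
    obtain ⟨-, -, -, h3, -⟩ := ih hs1
    refine ⟨s, hs1, ?_⟩
    rw [centre_succ_succ]
    rcases Nat.even_or_odd j with hj | hj
    · have hj' : ¬Even (j + 1) := by simpa [Nat.even_add_one] using hj
      simp only [centre, hj, hj', if_true, if_false] at h3 ⊢
      obtain ⟨h4, h5⟩ := h3.nextCollision_right hs2
      exact ⟨h3, h4, h5⟩
    · have hj' : Even (j + 1) := by simpa [Nat.even_add_one] using hj
      have hj : ¬Even j := by simpa using hj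
      simp only [centre, hj, hj', if_true, if_false] at h3 ⊢
      obtain ⟨h4, h5⟩ := h3.nextCollision_left hs2
      exact ⟨h3, h4, h5⟩

lemma collision_isSome_of_le (k : ℕ) (hk : (collision 1 u h v k).isSome) :
    ∀ j ≤ k, (collision 1 u h v j).isSome := by
  have step : ∀ j, (collision 1 u h v (j + 1)).isSome → (collision 1 u h v j).isSome := by
    intro j hj
    match j with
    | 0 => rfl
    | 1 => rfl
    | j + 2 =>
      have hj : ((collision 1 u h v (j + 2)).bind
        (nextCollision 1 (centreA 1 u) (centreB 1 u h v))).isSome := hj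
      cases hc : collision 1 u h v (j + 2) with
      | none => rw [hc] at hj; simp at hj
      | some => rfl
  intro j hj
  induction k with
  | zero => obtain rfl : j = 0 := by lia
            exact hk
  | succ k ih =>
    rcases Nat.lt_or_ge j (k + 1) with h1 | h1
    · exact ih (step k hk) (by lia)
    · obtain rfl : j = k + 1 := by lia
      exact hk

/-- The trajectory up to the `k`-th collision is a path. -/
lemma exists_isPath (hu : ‖u‖ = 1) (hv : ‖v‖ = 1) (hue : u ≠ e) (hvu : v ≠ u) (hh : 0 < h)
    {k : ℕ} (hk : 2 ≤ k) {s : Collision} (hs : collision 1 u h v k = some s) :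
    ∃ ν w, IsPath (0 < ·) k u (centreB 1 u h v - centreA 1 u) ν w ∧ w (k - 1) = s.velocity ∧
      s.time ≤ (k - 1 : ℕ) * (‖centreB 1 u h v - centreA 1 u‖ + 2) := by
  set z := centreB 1 u h v - centreA 1 u
  -- The path counts collisions from `0`, `collision` from `1`. The default value never occurs for
  -- `j < k`.
  let st (j : ℕ) : Collision := (collision 1 u h v (j + 1)).getD ⟨0, 0, 0⟩
  have hst (j : ℕ) (hj : j < k) : collision 1 u h v (j + 1) = some (st j) := by
    have := collision_isSome_of_le k (by rw [hs]; rfl) (j + 1) hj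
    obtain ⟨c, hc⟩ := Option.isSome_iff_exists.1 this
    simp [st, hc]
  have hstep (j : ℕ) (hj : j + 1 < k) :
      Outgoing (centre u h v j) (centre u h v (j + 1)) (st j) ∧
      Outgoing (centre u h v (j + 1)) (centre u h v j) (st (j + 1)) ∧
      ∃ t, FliesTo (centre u h v (j + 1)) (st j) (st (j + 1)) t := by
    obtain ⟨s, h1, h2⟩ := collision_step hu hv hue hvu hh j (hst (j + 1) hj)
    rw [hst j (by lia)] at h1
    obtain rfl := Option.some.inj h1
    exact h2
  have hout (j : ℕ) (hj : j < k) : Outgoing (centre u h v j) (centre u h v (j + 1)) (st j) := by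
    rcases Nat.lt_or_ge (j + 1) k with h1 | h1
    · exact (hstep j h1).1
    · obtain ⟨i, rfl⟩ : ∃ i, j = i + 1 := ⟨j - 1, by lia⟩
      rw [centre_succ_succ]
      exact (hstep i hj).2.1
  have hflight (j : ℕ) (hj : j + 1 < k) (t : ℝ)
      (ht : FliesTo (centre u h v (j + 1)) (st j) (st (j + 1)) t) :
      side z j + ((st (j + 1)).position - centre u h v (j + 1)) -
        ((st j).position - centre u h v j) = t • (st j).velocity ∧
      ‖side z j + ((st (j + 1)).position - centre u h v (j + 1)) -
        ((st j).position - centre u h v j)‖ = t := by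
    have h1 : side z j + ((st (j + 1)).position - centre u h v (j + 1)) -
        ((st j).position - centre u h v j) = t • (st j).velocity := by
      rw [ht.position, centre_succ]
      abel
    refine ⟨h1, ?_⟩
    rw [h1, norm_smul, (hout j (by lia)).vel, mul_one, Real.norm_of_nonneg ht.nonneg]
  have hst0 : st 0 = ⟨0, 0, u⟩ := rfl
  refine ⟨fun j ↦ if j < k then (st j).position - centre u h v j else 0,
    fun j ↦ if j < k then (st j).velocity else 0,
    ⟨fun j ↦ ?_, fun j ↦ ?_, fun j hj ↦ ?_, fun j hj ↦ ?_, fun j hj ↦ ?_, ?_, ?_,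
      fun j hj ↦ ?_, fun j hj ↦ ?_, fun j hj ↦ ?_⟩, ?_, ?_⟩
  · split_ifs with hj
    · exact (hout j hj).normal.le
    · simp
  · split_ifs with hj
    · exact (hout j hj).vel.le
    · simp
  · simpa [hj] using (hout j hj).normal
  · simpa [hj] using (hout j hj).vel
  · simpa [hj] using (hout j hj).out
  · simp [hst0, show 0 < k by lia]
  · have h1 := inner_right_sub_div norm_e hu hue.symm
    have h2 := smul_centreA_one hue
    have h3 : inner ℝ u (centreA 1 u) = -(‖e - u‖ / 2) := h1
    simp only [hst0, show 0 < k by lia, if_true, zero_sub, centre, Even.zero, inner_neg_right, h3,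
      neg_neg, mul_div_cancel₀ _ (two_ne_zero (α := ℝ)), smul_neg, h2]
    abel
  · obtain ⟨t, ht⟩ := (hstep j hj).2.2
    simpa only [hj, show j < k by lia, if_true] using ht.reflect
  · obtain ⟨t, ht⟩ := (hstep j hj).2.2
    obtain ⟨h1, h2⟩ := hflight j hj t ht
    simp only [hj, show j < k by lia, if_true]
    rw [h2, h1]
  · have := (hout j hj).avoid
    simp only [hj, if_true]
    rwa [centre_succ, ← sub_sub] at this
  · have h1 := hst (k - 1) (by lia)
    rw [show k - 1 + 1 = k by lia, hs] at h1
    simp [show k - 1 < k by lia, Option.some.inj h1]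
  · have htime (j : ℕ) (hj : j < k) : (st j).time ≤ j * (‖z‖ + 2) := by
      induction j with
      | zero => simp [hst0]
      | succ j ih =>
        obtain ⟨t, ht⟩ := (hstep j hj).2.2
        have h1 := (hflight j hj t ht).2
        have h2 := (hout j (by lia)).normal
        have h3 := (hout (j + 1) hj).normal
        have h4 : t ≤ ‖z‖ + 2 := by
          rw [← h1]
          refine (norm_sub_le _ _).trans ?_
          have := norm_add_le (side z j) ((st (j + 1)).position - centre u h v (j + 1))
          rw [norm_side, h3] at this
          rw [h2]
          linarith
        rw [ht.time]
        push_cast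
        linarith [ih (by lia)]
    have h1 := hst (k - 1) (by lia)
    rw [show k - 1 + 1 = k by lia, hs] at h1
    rw [Option.some.inj h1]
    exact htime (k - 1) (by lia)

end collision

/-! ### Axial description of a path -/

/-- The axial data of a path with `k` collisions of two unit balls at distance `D`: the components
`n` of the normal and `σ` of the velocity in the direction of the other ball, the strength `c` of
the collision and the length `t` of the subsequent flight. -/
structure AxialPath (k : ℕ) (D : ℝ) (n σ c t : ℕ → ℝ) : Prop where
  sq_n : ∀ j < k, n j ^ 2 ≤ 1
  sq_σ : ∀ j < k, σ j ^ 2 ≤ 1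
  c_pos : ∀ j < k, 0 < c j
  t_nonneg : ∀ j, 0 ≤ t j
  axial : ∀ j, j + 1 < k → t j * σ j = D - n (j + 1) - n j
  along : ∀ j, j + 1 < k → (c j + c (j + 1)) / 2 = D * σ j - t j
  reflect : ∀ j, j + 1 < k → σ (j + 1) = c (j + 1) * n (j + 1) - σ j
  -- The quantity `c j / 2 - n j * σ j`, called radial momentum below, is the scalar product of the
  -- components of `ν j` and `w j` orthogonal to the axis; their squared lengths are `1 - n j ^ 2`
  -- and `1 - σ j ^ 2`.
  radial : ∀ j, j + 1 < k →
    n j ^ 2 - n (j + 1) ^ 2 = 2 * t j * (c j / 2 - n j * σ j) + t j ^ 2 * (1 - σ j ^ 2)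
  cauchy : ∀ j < k, (c j / 2 - n j * σ j) ^ 2 ≤ (1 - n j ^ 2) * (1 - σ j ^ 2)
  avoid : ∀ j < k, 2 * n j ≤ D

section vectors

variable {k : ℕ} {u z : E3} {ν w : ℕ → E3}

lemma IsPath.inner_vel_succ_normal (h : IsPath (0 < ·) k u z ν w) {j : ℕ} (hj : j + 1 < k) :
    inner ℝ (w j) (ν (j + 1)) = -inner ℝ (w (j + 1)) (ν (j + 1)) := by
  have h1 := congrArg (inner ℝ · (ν (j + 1))) (h.reflect j hj)
  simp only [inner_add_left, inner_smul_left, RCLike.conj_to_real, real_inner_self_eq_norm_sq,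
    h.normal _ hj] at h1
  linarith

lemma inner_sub_axial (x y a : E3) (ha : ‖a‖ ≠ 0) :
    inner ℝ (x - (inner ℝ x a / ‖a‖ ^ 2) • a) (y - (inner ℝ y a / ‖a‖ ^ 2) • a) =
      inner ℝ x y - inner ℝ x a / ‖a‖ * (inner ℝ y a / ‖a‖) := by
  simp only [inner_sub_left, inner_sub_right, inner_smul_left, inner_smul_right,
    RCLike.conj_to_real, real_inner_self_eq_norm_sq, real_inner_comm y a]
  field_simp
  ring

lemma IsPath.axialPath (h : IsPath (0 < ·) k u z ν w) (hz : z ≠ 0) :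
    AxialPath k ‖z‖ (fun j ↦ inner ℝ (ν j) (side z j) / ‖z‖)
      (fun j ↦ inner ℝ (w j) (side z j) / ‖z‖) (fun j ↦ 2 * inner ℝ (w j) (ν j))
      (fun j ↦ ‖side z j + ν (j + 1) - ν j‖) := by
  have hD : 0 < ‖z‖ := norm_pos_iff.2 hz
  have hunit (x : E3) (hx : ‖x‖ = 1) (j : ℕ) : (inner ℝ x (side z j) / ‖z‖) ^ 2 ≤ 1 := by
    have h1 := abs_real_inner_le_norm x (side z j)
    rw [hx, norm_side, one_mul] at h1
    rw [sq_le_one_iff_abs_le_one, abs_div, abs_of_pos hD, div_le_one hD]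
    exact h1
  have hside (x : E3) (j : ℕ) : inner ℝ x (side z j) = -inner ℝ x (side z (j + 1)) := by
    rw [side_succ, inner_neg_right, neg_neg]
  have haxial (j : ℕ) (hj : j + 1 < k) : ‖side z j + ν (j + 1) - ν j‖ *
      (inner ℝ (w j) (side z j) / ‖z‖) = ‖z‖ - inner ℝ (ν (j + 1)) (side z (j + 1)) / ‖z‖ -
        inner ℝ (ν j) (side z j) / ‖z‖ := by
    have h1 := congrArg (inner ℝ · (side z j)) (h.flight j hj)
    simp only [inner_add_left, inner_sub_left, inner_smul_left, RCLike.conj_to_real,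
      real_inner_self_eq_norm_sq, norm_side] at h1
    rw [hside (ν (j + 1))] at h1
    field_simp
    linarith
  have halong (j : ℕ) (hj : j + 1 < k) : ‖side z j + ν (j + 1) - ν j‖ =
      inner ℝ (w j) (side z j) - inner ℝ (w (j + 1)) (ν (j + 1)) - inner ℝ (w j) (ν j) := by
    have h1 := congrArg (inner ℝ (w j)) (h.flight j hj)
    simp only [inner_add_right, inner_sub_right, inner_smul_right,
      real_inner_self_eq_norm_sq, h.vel j (by lia), h.inner_vel_succ_normal hj] at h1
    linarith
  refine ⟨fun j hj ↦ hunit _ (h.normal j hj) j, fun j hj ↦ hunit _ (h.vel j hj) j,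
    fun j hj ↦ mul_pos two_pos (h.out j hj), fun j ↦ norm_nonneg _, haxial, fun j hj ↦ ?_,
    fun j hj ↦ ?_, fun j hj ↦ ?_, fun j hj ↦ ?_, fun j hj ↦ ?_⟩
  · have := halong j hj
    field_simp
    linarith
  · have h1 := congrArg (inner ℝ · (side z (j + 1))) (h.reflect j hj)
    simp only [inner_add_left, inner_smul_left, RCLike.conj_to_real] at h1
    rw [h1, hside (w j) j]
    field_simp
    ring
  · have h1 : ν (j + 1) = ν j + ‖side z j + ν (j + 1) - ν j‖ • w j - side z j := by
      rw [← h.flight j hj]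
      abel
    have h2 := halong j hj
    have h3 := haxial j hj
    set t := ‖side z j + ν (j + 1) - ν j‖
    have h4 : (1 : ℝ) = 1 + t ^ 2 + ‖z‖ ^ 2 + 2 * t * inner ℝ (w j) (ν j) -
        2 * inner ℝ (ν j) (side z j) - 2 * t * inner ℝ (w j) (side z j) := by
      have h5 : ‖ν (j + 1)‖ ^ 2 = ‖ν j + t • w j - side z j‖ ^ 2 := by rw [← h1]
      rw [h.normal _ hj, @norm_sub_sq ℝ, normSq_flight _ _ (h.vel j (by lia)), norm_side,
        h.normal j (by lia), inner_add_left, inner_smul_left] at h5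
      simp only [RCLike.conj_to_real, RCLike.re_to_real] at h5
      linarith
    set n := inner ℝ (ν j) (side z j) / ‖z‖ with hn
    set s := inner ℝ (w j) (side z j) / ‖z‖ with hs
    have h6 : inner ℝ (ν j) (side z j) = ‖z‖ * n := by rw [hn]; field_simp
    have h7 : inner ℝ (w j) (side z j) = ‖z‖ * s := by rw [hs]; field_simp
    rw [h6, h7] at h4
    have h8 : inner ℝ (ν (j + 1)) (side z (j + 1)) / ‖z‖ = ‖z‖ - n - t * s := by linarith
    simp only [h8]
    linear_combination h4
  · have h0 : ‖side z j‖ ≠ 0 := by rw [norm_side]; exact hD.ne'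
    set p := ν j - (inner ℝ (ν j) (side z j) / ‖side z j‖ ^ 2) • side z j with hp
    set q := w j - (inner ℝ (w j) (side z j) / ‖side z j‖ ^ 2) • side z j with hq
    have h1 := abs_real_inner_le_norm p q
    have h2 := sq_le_sq' (by linarith [abs_le.1 h1]) (abs_le.1 h1).2
    rw [mul_pow, ← real_inner_self_eq_norm_sq p, ← real_inner_self_eq_norm_sq q, hp, hq,
      inner_sub_axial _ _ _ h0, inner_sub_axial _ _ _ h0, inner_sub_axial _ _ _ h0,
      real_inner_self_eq_norm_sq, real_inner_self_eq_norm_sq, h.normal j hj, h.vel j hj, norm_side,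
      real_inner_comm (w j) (ν j)] at h2
    refine le_trans (le_of_eq ?_) (h2.trans (le_of_eq ?_)) <;> ring
  · have h1 := h.avoid j hj
    rw [← one_le_sq_iff₀ (norm_nonneg _), @norm_sub_sq ℝ, h.normal j hj, norm_side] at h1
    simp only [RCLike.re_to_real] at h1
    rw [← mul_div_assoc, div_le_iff₀ hD]
    linarith

end vectors

namespace AxialPath

variable {k : ℕ} {D : ℝ} {n σ c t : ℕ → ℝ} (h : AxialPath k D n σ c t)
include h

lemma σ_pos (hD : 0 < D) {j : ℕ} (hj : j + 1 < k) : 0 < σ j := by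
  have h1 := h.along j hj
  have h2 := h.c_pos j (by lia)
  have h3 := h.c_pos (j + 1) hj
  have h4 := h.t_nonneg j
  by_contra! hc
  nlinarith

lemma n_pos (hD : 0 < D) {j : ℕ} (hj : j + 2 < k) : 0 < n (j + 1) := by
  have h1 := h.reflect j (by lia)
  have h2 := h.σ_pos hD (j := j) (by lia)
  have h3 := h.σ_pos hD (j := j + 1) (by lia)
  have h4 := h.c_pos (j + 1) (by lia)
  by_contra! hc
  nlinarith

/-- The radial momentum increases during a flight. -/
lemma flight_radial {j : ℕ} (hj : j + 1 < k) :
    n (j + 1) * σ j - c (j + 1) / 2 = c j / 2 - n j * σ j + t j * (1 - σ j ^ 2) := by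
  linear_combination -h.along j hj + σ j * h.axial j hj

/-- The radial momentum increases at a collision. -/
lemma collision_radial {j : ℕ} (hj : j + 1 < k) :
    c (j + 1) / 2 - n (j + 1) * σ (j + 1) =
      n (j + 1) * σ j - c (j + 1) / 2 + c (j + 1) * (1 - n (j + 1) ^ 2) := by
  rw [h.reflect j hj]
  ring

lemma flight_radial_le {j : ℕ} (hj : j + 1 < k) :
    c j / 2 - n j * σ j ≤ n (j + 1) * σ j - c (j + 1) / 2 := by
  rw [h.flight_radial hj]
  nlinarith [h.t_nonneg j, h.sq_σ j (by lia)]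

lemma collision_radial_le {j : ℕ} (hj : j + 1 < k) :
    n (j + 1) * σ j - c (j + 1) / 2 ≤ c (j + 1) / 2 - n (j + 1) * σ (j + 1) := by
  rw [h.collision_radial hj]
  nlinarith [h.c_pos (j + 1) hj, h.sq_n (j + 1) hj]

lemma radial_mono {i j : ℕ} (hij : i ≤ j) (hj : j < k) :
    c i / 2 - n i * σ i ≤ c j / 2 - n j * σ j := by
  induction j, hij using Nat.le_induction with
  | base => exact le_rfl
  | succ j _ ih =>
    exact (ih (by lia)).trans ((h.flight_radial_le hj).trans (h.collision_radial_le hj))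

/-- Flights away from the axis between disjoint balls are effective. -/
lemma gap_le_of_outward (hD : 2 < D) {j : ℕ} (hj : j + 3 < k)
    (hg : 0 ≤ c j / 2 - n j * σ j) : D - 2 ≤ t (j + 1) * (c (j + 1) + c (j + 2)) := by
  have hg1 := hg.trans (h.flight_radial_le (j := j) (by lia))
  have hg2 := hg1.trans (h.collision_radial_le (j := j) (by lia))
  have hσ0 := h.σ_pos (by linarith) (j := j) (by lia)
  have hσ1 := h.σ_pos (by linarith) (j := j + 1) (by lia)
  have hn1 := h.n_pos (by linarith) (j := j) (by lia)
  have hn2 := h.n_pos (by linarith) (j := j + 1) (by lia)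
  have hr := h.reflect j (by lia)
  have hq : 1 / 2 ≤ n (j + 1) := by
    have : σ j + σ (j + 1) ≤ 2 * n (j + 1) ^ 2 * σ j := by nlinarith
    by_contra! hc
    have : n (j + 1) ^ 2 ≤ 1 / 4 := by nlinarith
    nlinarith
  have ht := h.t_nonneg (j + 1)
  have hax := h.axial (j + 1) (by lia)
  have hal := h.along (j + 1) (by lia)
  have hra := h.radial (j + 1) (by lia)
  have hn1' : n (j + 1) ≤ 1 := by nlinarith [h.sq_n (j + 1) (by lia)]
  simp only [add_assoc, Nat.reduceAdd] at hax hal hra hn2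
  have h1 : t (j + 1) * (c (j + 1) + c (j + 2)) =
      2 * (D * (t (j + 1) * σ (j + 1)) - t (j + 1) ^ 2) := by
    linear_combination 2 * t (j + 1) * hal
  have h2 : t (j + 1) ^ 2 ≤ (t (j + 1) * σ (j + 1)) ^ 2 + n (j + 1) ^ 2 - n (j + 2) ^ 2 := by
    nlinarith [mul_nonneg ht hg2]
  rw [hax] at h1 h2
  -- Inserting `h2` on the right, the quadratic terms factor into the left-hand side. With `n (j +
  -- 1)` between `1 / 2` and `1` this is at least `(D - 2) / 2`.
  have h3 : (n (j + 1) + n (j + 2)) * (D - 2 * n (j + 1)) ≤ D * (D - n (j + 2) - n (j + 1)) -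
      t (j + 1) ^ 2 := by nlinarith
  nlinarith [mul_nonneg (sub_nonneg.2 hq) (by linarith : 0 ≤ D - 2), mul_nonneg hn2.le
    (by linarith : 0 ≤ D - 2), mul_nonneg (add_pos hn1 hn2).le (sub_nonneg.2 hn1')]

/-- Flights towards the axis between disjoint balls are effective. -/
lemma gap_le_of_inward (hD : 2 < D) {j : ℕ} (hj : j + 3 < k)
    (hg : c (j + 2) / 2 - n (j + 2) * σ (j + 2) ≤ 0) :
    D - 2 ≤ t (j + 1) * (c (j + 1) + c (j + 2)) := by
  -- This is the time reversal of the outward case, with the two ends of the flight exchanged.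
  have hg1 := (h.collision_radial_le (j := j + 1) (by lia)).trans hg
  have hσ1 := h.σ_pos (by linarith) (j := j + 1) (by lia)
  have hσ2 := h.σ_pos (by linarith) (j := j + 2) (by lia)
  have hn1 := h.n_pos (by linarith) (j := j) (by lia)
  have hn2 := h.n_pos (by linarith) (j := j + 1) (by lia)
  have hr := h.reflect (j + 1) (by lia)
  have ht := h.t_nonneg (j + 1)
  have hax := h.axial (j + 1) (by lia)
  have hal := h.along (j + 1) (by lia)
  have hra := h.radial (j + 1) (by lia)
  have hfl := h.flight_radial (j := j + 1) (by lia)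
  simp only [add_assoc, Nat.reduceAdd] at hax hal hra hn2 hr hg1 hfl
  have hq : 1 / 2 ≤ n (j + 2) := by
    have : σ (j + 1) + σ (j + 2) ≤ 2 * n (j + 2) ^ 2 * σ (j + 2) := by nlinarith
    by_contra! hc
    have : n (j + 2) ^ 2 ≤ 1 / 4 := by nlinarith
    nlinarith
  have hn2' : n (j + 2) ≤ 1 := by nlinarith [h.sq_n (j + 2) (by lia)]
  have h1 : t (j + 1) * (c (j + 1) + c (j + 2)) =
      2 * (D * (t (j + 1) * σ (j + 1)) - t (j + 1) ^ 2) := by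
    linear_combination 2 * t (j + 1) * hal
  have h2 : t (j + 1) ^ 2 ≤ (t (j + 1) * σ (j + 1)) ^ 2 + n (j + 2) ^ 2 - n (j + 1) ^ 2 := by
    have := mul_nonneg ht (neg_nonneg.2 hg1)
    nlinarith
  rw [hax] at h1 h2
  have h3 : (n (j + 1) + n (j + 2)) * (D - 2 * n (j + 2)) ≤ D * (D - n (j + 2) - n (j + 1)) -
      t (j + 1) ^ 2 := by nlinarith
  nlinarith [mul_nonneg (sub_nonneg.2 hq) (by linarith : 0 ≤ D - 2), mul_nonneg hn1.le
    (by linarith : 0 ≤ D - 2), mul_nonneg (add_pos hn1 hn2).le (sub_nonneg.2 hn2')]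

end AxialPath

/-! ### Overlapping balls -/

/-- In a free planar motion the radial velocity `g / r` does not decrease, as the distance is a
convex function of time. The form without division also covers radius `0`. -/
lemma radial_velocity_le {g t P r r' : ℝ} (ht : 0 ≤ t) (hP : 0 ≤ P) (hr : 0 ≤ r) (hr' : 0 ≤ r')
    (h : r' ^ 2 = r ^ 2 + 2 * t * g + t ^ 2 * P) (hc : g ^ 2 ≤ r ^ 2 * P) :
    g * r' ≤ (g + t * P) * r := by
  have htP : 0 ≤ t * P := mul_nonneg ht hP
  rcases le_or_gt 0 g with hg | hg
  · refine le_of_sq_le_sq ?_ (by positivity)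
    rw [mul_pow, mul_pow, h]
    nlinarith [mul_nonneg (mul_nonneg ht hg) (sub_nonneg.2 hc),
      mul_nonneg (mul_nonneg ht htP) (sub_nonneg.2 hc)]
  · rcases le_or_gt 0 (g + t * P) with hg' | hg'
    · nlinarith [mul_nonneg hg' hr, mul_nonneg (neg_nonneg.2 hg.le) hr']
    · have : -(g + t * P) * r ≤ -g * r' := by
        refine le_of_sq_le_sq ?_ (mul_nonneg (by linarith) hr')
        rw [mul_pow, mul_pow, h]
        nlinarith [mul_nonneg (mul_nonneg ht (by linarith : 0 ≤ -(g + (g + t * P))))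
          (sub_nonneg.2 hc)]
      linarith

/-- In the plane of the axis and the normal, with axis orientation switching from ball to ball, the
collision preserves `q ^ 2 + s ^ 2` and turns the direction by an angle of cosine `1 - 2 r ^ 2`.
That angle is at least `2 r`, because `1 - x ^ 2 / 2 ≤ cos x`. -/
lemma arctan_reflect {q s q' s' n r c : ℝ} (hs : 0 < s) (hs' : 0 < s') (hr : 0 < r)
    (hn : 0 < n) (hnr : n ^ 2 + r ^ 2 = 1) (hc : c / 2 = n * s - r * q) (hq' : q' = q + c * r)
    (hs'c : s' = c * n - s) : Real.arctan (q / s) + 2 * r ≤ Real.arctan (q' / s') := by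
  have hnorm : q' ^ 2 + s' ^ 2 = q ^ 2 + s ^ 2 := by
    rw [hq', hs'c]
    have : c = 2 * (n * s - r * q) := by linarith
    rw [this]
    linear_combination 4 * (n * s - r * q) ^ 2 * hnr
  set τ := √(q ^ 2 + s ^ 2)
  have hτ2 : τ ^ 2 = q ^ 2 + s ^ 2 := Real.sq_sqrt (by positivity)
  have hτ : 0 < τ := Real.sqrt_pos.2 (by positivity)
  have hsqrt {a b : ℝ} (hb : 0 < b) (hab : a ^ 2 + b ^ 2 = q ^ 2 + s ^ 2) :
      √(1 + (a / b) ^ 2) = τ / b := by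
    rw [Real.sqrt_eq_iff_mul_self_eq (by positivity) (by positivity)]
    field_simp
    rw [hτ2, ← hab]
    ring
  have hlt : q / s < q' / s' := by
    rw [div_lt_div_iff₀ hs hs']
    have : q' * s - q * s' = 2 * n * r * (q ^ 2 + s ^ 2) := by
      rw [hq', hs'c]
      have : c = 2 * (n * s - r * q) := by linarith
      rw [this]
      linear_combination (-2) * q * s * hnr
    have h2 : 0 < 2 * n * r * (q ^ 2 + s ^ 2) := by positivity
    linarith
  have hlt' := Real.arctan_strictMono hlt
  have hcos : Real.cos (Real.arctan (q' / s') - Real.arctan (q / s)) = 1 - 2 * r ^ 2 := by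
    rw [Real.cos_sub, Real.cos_arctan, Real.cos_arctan, Real.sin_arctan, Real.sin_arctan,
      hsqrt hs rfl, hsqrt hs' hnorm]
    have : s' * s + q' * q = (1 - 2 * r ^ 2) * τ ^ 2 := by
      rw [hτ2, hq', hs'c]
      have : c = 2 * (n * s - r * q) := by linarith
      rw [this]
      linear_combination 2 * s ^ 2 * hnr
    field_simp
    linarith
  have h1 := Real.one_sub_sq_div_two_le_cos (x := Real.arctan (q' / s') - Real.arctan (q / s))
  rw [hcos] at h1
  have : 2 * r ≤ Real.arctan (q' / s') - Real.arctan (q / s) := by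
    refine le_of_sq_le_sq ?_ (by linarith)
    linarith
  linarith

namespace AxialPath

variable {k : ℕ} {D : ℝ} {n σ c t : ℕ → ℝ} (h : AxialPath k D n σ c t)
include h

/-- Overlap forces `2 n ≤ D` at each impact, which bounds the radial part of the normal, and so the
turn at each collision, from below. The preceding flight changes the angle in the same direction. -/
lemma arctan_add_le (hD : 0 < D) (hD2 : D < 2) {r : ℝ} (hrD : r ^ 2 ≤ 1 - D ^ 2 / 4)
    {j : ℕ} (hj : j + 3 < k) :
    Real.arctan ((c (j + 1) / 2 - n (j + 1) * σ (j + 1)) / √(1 - n (j + 1) ^ 2) / σ (j + 1)) +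
      2 * r ≤
    Real.arctan ((c (j + 2) / 2 - n (j + 2) * σ (j + 2)) / √(1 - n (j + 2) ^ 2) / σ (j + 2)) := by
  have hσ1 := h.σ_pos hD (j := j + 1) (by lia)
  have hσ2 := h.σ_pos hD (j := j + 2) (by lia)
  have hn1 := h.n_pos hD (j := j) (by lia)
  have hn2 := h.n_pos hD (j := j + 1) (by lia)
  have ha1 := h.avoid (j + 1) (by lia)
  have ha2 := h.avoid (j + 2) (by lia)
  have hra := h.radial (j + 1) (by lia)
  have hfl := h.flight_radial (j := j + 1) (by lia)
  have hcr := h.collision_radial (j := j + 1) (by lia)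
  have hre := h.reflect (j + 1) (by lia)
  have hca := h.cauchy (j + 1) (by lia)
  have hP : 0 ≤ 1 - σ (j + 1) ^ 2 := by linarith [h.sq_σ (j + 1) (by lia)]
  simp only [add_assoc, Nat.reduceAdd] at hn2 hra hfl hcr hre
  have h1 : r ^ 2 ≤ 1 - n (j + 1) ^ 2 := by nlinarith
  have h2 : r ^ 2 ≤ 1 - n (j + 2) ^ 2 := by nlinarith
  have hp1 : 0 < 1 - n (j + 1) ^ 2 := by nlinarith
  have hp2 : 0 < 1 - n (j + 2) ^ 2 := by nlinarith
  set ρ := √(1 - n (j + 1) ^ 2)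
  set ρ' := √(1 - n (j + 2) ^ 2)
  have hρ2 : ρ ^ 2 = 1 - n (j + 1) ^ 2 := Real.sq_sqrt hp1.le
  have hρ'2 : ρ' ^ 2 = 1 - n (j + 2) ^ 2 := Real.sq_sqrt hp2.le
  have hρ : 0 < ρ := Real.sqrt_pos.2 hp1
  have hρ' : 0 < ρ' := Real.sqrt_pos.2 hp2
  have hrρ' : r ≤ ρ' := le_of_sq_le_sq (by linarith) hρ'.le
  set g := c (j + 1) / 2 - n (j + 1) * σ (j + 1)
  have hmono := radial_velocity_le (h.t_nonneg (j + 1)) hP hρ.le hρ'.le (g := g)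
    (by rw [hρ2, hρ'2]; linarith) (by rw [hρ2]; exact hca)
  rw [← hfl] at hmono
  have h3 : g / ρ / σ (j + 1) ≤ (n (j + 2) * σ (j + 1) - c (j + 2) / 2) / ρ' / σ (j + 1) := by
    gcongr ?_ / _
    rw [div_le_div_iff₀ hρ hρ']
    exact hmono
  have h4 := arctan_reflect (q := (n (j + 2) * σ (j + 1) - c (j + 2) / 2) / ρ')
    (q' := (c (j + 2) / 2 - n (j + 2) * σ (j + 2)) / ρ') (n := n (j + 2)) (c := c (j + 2))
    hσ1 hσ2 hρ' hn2 (by linarith) (by field_simp; ring)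
    (by rw [hcr, ← hρ'2]; field_simp) hre
  linarith [Real.arctan_strictMono.monotone h3]

/-- The number of collisions with two overlapping balls is bounded. -/
lemma card_le_of_overlap (hD : 0 < D) (hD2 : D < 2) : (k : ℝ) ^ 2 * (2 - D) ≤ 80 := by
  rcases Nat.lt_or_ge k 4 with hk | hk
  · have : (k : ℝ) ≤ 3 := by exact_mod_cast (by lia : k ≤ 3)
    have h0 : (0 : ℝ) ≤ k := by positivity
    nlinarith
  -- The first and last collisions are left out: there the signs of `n` and of the outgoing `σ` are
  -- not controlled.
  obtain ⟨m, rfl⟩ : ∃ m, k = m + 3 := ⟨k - 3, by lia⟩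
  set r := √(1 - D ^ 2 / 4)
  have hr2 : r ^ 2 = 1 - D ^ 2 / 4 := Real.sq_sqrt (by nlinarith)
  have hr : 0 ≤ r := Real.sqrt_nonneg _
  set A : ℕ → ℝ := fun j ↦ Real.arctan ((c (j + 1) / 2 - n (j + 1) * σ (j + 1)) /
    √(1 - n (j + 1) ^ 2) / σ (j + 1))
  have hA (j : ℕ) (hj : j ≤ m) : A 0 + j * (2 * r) ≤ A j := by
    induction j with
    | zero => simp
    | succ j ih =>
      have := h.arctan_add_le hD hD2 hr2.le (j := j) (by lia)
      have ih := ih (by lia)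
      push_cast
      change _ ≤ A (j + 1) at this
      change A j + _ ≤ _ at this
      linarith
  have h1 := hA m le_rfl
  have h2 : -(Real.pi / 2) < A 0 := Real.neg_pi_div_two_lt_arctan _
  have h3 : A m < Real.pi / 2 := Real.arctan_lt_pi_div_two _
  -- The arctangent ranges over an interval of length `π`, and each of the `m` steps uses up `2 r`.
  have h4 : m * r ≤ 1.58 := by linarith [Real.pi_lt_d2]
  have h5 : (m * r) ^ 2 ≤ 1.58 ^ 2 := by gcongr
  have h6 : (2 - D) ≤ 2 * r ^ 2 := by rw [hr2]; nlinarith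
  have hm : (1 : ℝ) ≤ m := by exact_mod_cast (by lia : 1 ≤ m)
  push_cast
  calc ((m : ℝ) + 3) ^ 2 * (2 - D) ≤ (4 * m) ^ 2 * (2 * r ^ 2) := by
        gcongr
        linarith
    _ = 32 * (m * r) ^ 2 := by ring
    _ ≤ 80 := by norm_num at h5 ⊢; linarith

end AxialPath

/-! ### Divergence of two paths -/

/-- Divergence of two paths: `R j` and `Q j` are the scalar products of the differences of the
velocities and of the positions just after the `j`-th and just before the `j + 1`-st collision, `X`
and `W` the norms of these differences, `c` and `t` the sums of the strengths of the collisions and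
of the lengths of the flights. -/
structure Divergence (k : ℕ) (R Q X W c t : ℕ → ℝ) : Prop where
  X_nonneg : ∀ j, 0 ≤ X j
  W_nonneg : ∀ j, 0 ≤ W j
  c_nonneg : ∀ j < k, 0 ≤ c j
  t_nonneg : ∀ j, 0 ≤ t j
  R_le : ∀ j, R j ≤ W j * X j
  Q_le : ∀ j, Q j ≤ W j * X (j + 1)
  R_zero : 0 ≤ R 0
  flight : ∀ j, j + 1 < k → Q j = R j + t j / 2 * W j ^ 2
  collision : ∀ j, j + 1 < k → R (j + 1) = Q j + c (j + 1) / 2 * X (j + 1) ^ 2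

lemma inner_unit_sub {a b : E3} (ha : ‖a‖ = 1) (hb : ‖b‖ = 1) (s r : ℝ) :
    inner ℝ (a - b) (s • a - r • b) = (s + r) / 2 * ‖a - b‖ ^ 2 := by
  have h1 : inner ℝ a a = (1 : ℝ) := by rw [real_inner_self_eq_norm_sq, ha, one_pow]
  have h2 : inner ℝ b b = (1 : ℝ) := by rw [real_inner_self_eq_norm_sq, hb, one_pow]
  rw [← real_inner_self_eq_norm_sq]
  simp only [inner_sub_left, inner_sub_right, inner_smul_right, real_inner_comm a b, h1, h2]
  ring

/-- The flight changes positions along the unit vectors `w j`, `w' j`, and the collision changes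
velocities along the unit normals. Each increment is therefore given by `inner_unit_sub` and is
nonnegative. The centres drop out because both paths have the same `z`. -/
lemma IsPath.divergence {k : ℕ} {u u' z : E3} {ν w ν' w' : ℕ → E3} (hk : 0 < k)
    (h : IsPath (0 < ·) k u z ν w) (h' : IsPath (0 < ·) k u' z ν' w') :
    Divergence k (fun j ↦ inner ℝ (w j - w' j) (ν j - ν' j))
      (fun j ↦ inner ℝ (w j - w' j) (ν (j + 1) - ν' (j + 1))) (fun j ↦ ‖ν j - ν' j‖)
      (fun j ↦ ‖w j - w' j‖) (fun j ↦ 2 * inner ℝ (w j) (ν j) + 2 * inner ℝ (w' j) (ν' j))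
      (fun j ↦ ‖side z j + ν (j + 1) - ν j‖ + ‖side z j + ν' (j + 1) - ν' j‖) := by
  refine ⟨fun j ↦ norm_nonneg _, fun j ↦ norm_nonneg _, fun j hj ↦ ?_, fun j ↦ by positivity,
    fun j ↦ real_inner_le_norm _ _, fun j ↦ real_inner_le_norm _ _, ?_, fun j hj ↦ ?_,
    fun j hj ↦ ?_⟩
  · have h1 : 0 < inner ℝ (w j) (ν j) := h.out j hj
    have h2 : 0 < inner ℝ (w' j) (ν' j) := h'.out j hj
    positivity
  · have h0 : w 0 - w' 0 = (2 * inner ℝ u (ν 0)) • ν 0 - (2 * inner ℝ u' (ν' 0)) • ν' 0 := by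
      conv_lhs => rw [h.vel_zero, h'.vel_zero, h.init, h'.init]
      abel
    rw [h0, real_inner_comm, inner_unit_sub (h.normal 0 hk) (h'.normal 0 hk)]
    have h1 : 0 < inner ℝ (w 0) (ν 0) := h.out 0 hk
    have h2 : 0 < inner ℝ (w' 0) (ν' 0) := h'.out 0 hk
    rw [h.vel_zero] at h1
    rw [h'.vel_zero] at h2
    positivity
  · rw [← inner_unit_sub (h.vel j (by lia)) (h'.vel j (by lia)), ← inner_add_right, ← h.flight j hj,
      ← h'.flight j hj]
    congr 1
    abel
  · have h0 : w (j + 1) - w' (j + 1) = (w j - w' j) +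
        ((2 * inner ℝ (w (j + 1)) (ν (j + 1))) • ν (j + 1) -
          (2 * inner ℝ (w' (j + 1)) (ν' (j + 1))) • ν' (j + 1)) := by
      conv_lhs => rw [h.reflect j hj, h'.reflect j hj]
      abel
    rw [← inner_unit_sub (h.normal _ hj) (h'.normal _ hj)]
    conv_lhs => rw [h0, inner_add_left]
    exact congrArg _ (real_inner_comm _ _)

lemma two_mul_mul_le {a b x y κ : ℝ} (ha : 0 ≤ a) (hb : 0 ≤ b)
    (h : κ ^ 2 ≤ a * b) : κ * (x * y) ≤ a / 2 * x ^ 2 + b / 2 * y ^ 2 := by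
  refine le_of_sq_le_sq ?_ (by positivity)
  have h1 : 0 ≤ (x * y) ^ 2 := by positivity
  nlinarith [sq_nonneg (a * x ^ 2 - b * y ^ 2), mul_le_mul_of_nonneg_right h h1]

namespace Divergence

variable {k : ℕ} {R Q X W c t : ℕ → ℝ} (h : Divergence k R Q X W c t)
include h

lemma R_le_Q {j : ℕ} (hj : j + 1 < k) : R j ≤ Q j := by
  have := h.t_nonneg j
  rw [h.flight j hj]
  exact le_add_of_nonneg_right (by positivity)

lemma Q_le_R {j : ℕ} (hj : j + 1 < k) : Q j ≤ R (j + 1) := by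
  have := h.c_nonneg (j + 1) hj
  rw [h.collision j hj]
  exact le_add_of_nonneg_right (by positivity)

lemma mono {i j : ℕ} (hij : i ≤ j) (hj : j < k) : R i ≤ R j := by
  induction j, hij using Nat.le_induction with
  | base => exact le_rfl
  | succ j _ ih => exact (ih (by lia)).trans ((h.R_le_Q hj).trans (h.Q_le_R hj))

lemma R_nonneg {j : ℕ} (hj : j < k) : 0 ≤ R j := h.R_zero.trans (h.mono (Nat.zero_le j) hj)

/-- An effective flight increases the divergence. -/
lemma growth {κ : ℝ} (hκ : 0 ≤ κ) {j : ℕ} (hj : j + 2 < k)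
    (hgood : 2 * κ ^ 2 ≤ t (j + 1) * (c (j + 1) + c (j + 2))) : (1 + κ) * R j ≤ R (j + 2) := by
  have hc1 := h.c_nonneg (j + 1) (by lia)
  have hc2 := h.c_nonneg (j + 2) (by lia)
  have ht := h.t_nonneg (j + 1)
  have hR := h.R_nonneg (j := j) (by lia)
  have e1 := h.R_le_Q (j := j) (by lia)
  have e2 := h.collision j (by lia)
  have e3 := h.flight (j + 1) (by lia)
  have e4 := h.collision (j + 1) (by lia)
  have e5 := h.R_le_Q (j := j + 1) (by lia)
  have e6 := h.Q_le_R (j := j + 1) (by lia)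
  have e7 := h.Q_le_R (j := j) (by lia)
  have r1 := h.R_le (j + 1)
  have r2 := h.Q_le (j + 1)
  simp only [add_assoc, Nat.reduceAdd] at e3 e4 e5 e6 r2
  -- For the stronger of the two collisions `κ ^ 2 ≤ t c`; the arithmetic-geometric mean then bounds
  -- the joint gain of flight and collision from below by `κ W X`, hence by `κ` times the divergence
  -- between them.
  rcases le_total (c (j + 2)) (c (j + 1)) with hcc | hcc
  · have := two_mul_mul_le (κ := κ) ht hc1 (x := W (j + 1)) (y := X (j + 1)) (by nlinarith)
    have h3 := mul_le_mul_of_nonneg_left r1 hκ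
    have h4 := mul_le_mul_of_nonneg_left (e1.trans e7) hκ
    linarith
  · have := two_mul_mul_le (κ := κ) ht hc2 (x := W (j + 1)) (y := X (j + 2)) (by nlinarith)
    have h3 := mul_le_mul_of_nonneg_left r2 hκ
    have h4 := mul_le_mul_of_nonneg_left ((e1.trans e7).trans e5) hκ
    linarith

lemma growth_iterate {κ : ℝ} (hκ : 0 ≤ κ) {m i : ℕ} (hi : m + 2 * i < k)
    (hgood : ∀ l < i, 2 * κ ^ 2 ≤
      t (m + 2 * l + 1) * (c (m + 2 * l + 1) + c (m + 2 * l + 2))) :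
    (1 + κ) ^ i * R m ≤ R (m + 2 * i) := by
  induction i with
  | zero => simp
  | succ i ih =>
    have h1 := ih (by lia) fun l hl ↦ hgood l (by lia)
    have h2 := h.growth hκ (j := m + 2 * i) (by lia) (hgood i (by lia))
    calc (1 + κ) ^ (i + 1) * R m = (1 + κ) * ((1 + κ) ^ i * R m) := by ring
      _ ≤ (1 + κ) * R (m + 2 * i) := by gcongr
      _ ≤ R (m + 2 * (i + 1)) := h2

/-- Divergence of two paths between disjoint balls. -/
lemma growth_gap {D : ℝ} {n σ c₁ t₁ : ℕ → ℝ} (hp : AxialPath k D n σ c₁ t₁) (hD : 2 < D)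
    (hc : ∀ j < k, c₁ j ≤ c j) (ht : ∀ j, t₁ j ≤ t j) {i : ℕ} (hi : 4 * i + 1 < k) :
    (1 + √((D - 2) / 2)) ^ i * R 0 ≤ R (k - 1) := by
  have hκ2 : 2 * √((D - 2) / 2) ^ 2 = D - 2 := by
    rw [Real.sq_sqrt (by linarith)]
    ring
  have hκ : 0 ≤ √((D - 2) / 2) := Real.sqrt_nonneg _
  have key (j : ℕ) (hj : j + 3 < k) (h0 : D - 2 ≤ t₁ (j + 1) * (c₁ (j + 1) + c₁ (j + 2))) :
      D - 2 ≤ t (j + 1) * (c (j + 1) + c (j + 2)) := by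
    refine h0.trans ?_
    have := hp.t_nonneg (j + 1)
    have := hp.c_pos (j + 1) (by lia)
    have := hp.c_pos (j + 2) (by lia)
    have := ht (j + 1)
    have := hc (j + 1) (by lia)
    have := hc (j + 2) (by lia)
    have := h.t_nonneg (j + 1)
    gcongr
  -- The radial momentum is nondecreasing, so its sign at the middle collision makes either the
  -- later flights outward or the earlier ones inward. Every second flight of that half is
  -- effective.
  rcases le_or_gt 0 (c₁ (2 * i) / 2 - n (2 * i) * σ (2 * i)) with hg | hg
  · have h1 := h.growth_iterate hκ (m := 2 * i) (i := i) (by lia) fun l hl ↦ by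
      rw [hκ2]
      refine key _ (by lia) (hp.gap_le_of_outward hD (by lia) ?_)
      exact hg.trans (hp.radial_mono (by lia) (by lia))
    have h2 := h.mono (Nat.zero_le (2 * i)) (by lia)
    have h3 := h.mono (i := 2 * i + 2 * i) (j := k - 1) (by lia) (by lia)
    refine le_trans ?_ (h1.trans h3)
    gcongr
  · have h1 := h.growth_iterate hκ (m := 0) (i := i) (by lia) fun l hl ↦ by
      rw [hκ2]
      refine key _ (by lia) (hp.gap_le_of_inward hD (by lia) ?_)
      exact (hp.radial_mono (by lia) (by lia)).trans hg.le
    exact h1.trans (h.mono (by lia) (by lia))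

end Divergence

/-- Bernoulli's inequality with exponent `i / 4`, raised to the fourth power. The fourth power is
what makes the later integral over the distance decay like `1 / k ^ 2`. -/
lemma pow_four_le_growth {κ : ℝ} (hκ : 0 ≤ κ) (hκ5 : κ ^ 2 ≤ 5) {k i : ℕ} (hk : k ≤ 4 * i + 5) :
    (k * κ) ^ 4 ≤ 51 ^ 4 * (1 + κ) ^ i := by
  set m := i / 4
  have hm : 4 * m ≤ i := by lia
  have hkm : k ≤ 16 * m + 17 := by lia
  have hk' : (k : ℝ) ≤ 16 * m + 17 := by exact_mod_cast hkm
  have hκ3 : κ ≤ 3 := by nlinarith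
  have h1 : k * κ ≤ 51 * (1 + m * κ) := by
    have := mul_le_mul_of_nonneg_right hk' hκ
    have : 0 ≤ m * κ := by positivity
    nlinarith
  have h2 : 1 + m * κ ≤ (1 + κ) ^ m := one_add_mul_le_pow (by linarith) m
  have h3 : k * κ ≤ 51 * (1 + κ) ^ m := by linarith
  calc (k * κ) ^ 4 ≤ (51 * (1 + κ) ^ m) ^ 4 := by gcongr
    _ = 51 ^ 4 * (1 + κ) ^ (4 * m) := by ring
    _ ≤ 51 ^ 4 * (1 + κ) ^ i := by
      gcongr
      · linarith

/-- Near obstacles: the initial divergence of two paths is small. -/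
lemma divergence_le_of_near {k : ℕ} {R Q X W c t : ℕ → ℝ} (h : Divergence k R Q X W c t) {D : ℝ}
    {n σ c₁ t₁ : ℕ → ℝ} (hp : AxialPath k D n σ c₁ t₁) (hk : 2 ≤ k)
    (hD0 : 0 < D) (hD2 : D ≠ 2) (hD : D ≤ 12) (hc : ∀ j < k, c₁ j ≤ c j) (ht : ∀ j, t₁ j ≤ t j) :
    R 0 * (k ^ 4 * (D - 2) ^ 2) ≤ 10 ^ 8 * R (k - 1) := by
  have hR0 := h.R_zero
  have hR := h.mono (Nat.zero_le (k - 1)) (by lia)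
  rcases lt_or_gt_of_ne hD2 with hlt | hgt
  · have h1 := hp.card_le_of_overlap hD0 hlt
    have h2 : 0 ≤ (k : ℝ) ^ 2 * (2 - D) := mul_nonneg (by positivity) (by linarith)
    have h3 : (k : ℝ) ^ 4 * (D - 2) ^ 2 ≤ 80 ^ 2 := by
      calc (k : ℝ) ^ 4 * (D - 2) ^ 2 = (k ^ 2 * (2 - D)) ^ 2 := by ring
        _ ≤ 80 ^ 2 := by gcongr
    nlinarith [mul_le_mul_of_nonneg_left h3 hR0]
  · have hκ2 : √((D - 2) / 2) ^ 2 = (D - 2) / 2 := Real.sq_sqrt (by linarith)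
    have h1 := h.growth_gap hp hgt hc ht (i := (k - 2) / 4) (by lia)
    have h2 := pow_four_le_growth (Real.sqrt_nonneg ((D - 2) / 2)) (by rw [hκ2]; linarith)
      (k := k) (i := (k - 2) / 4) (by lia)
    -- The constant `10 ^ 8` exceeds both `4 * 51 ^ 4` and `80 ^ 2`.
    have h3 : (k : ℝ) ^ 4 * (D - 2) ^ 2 = 4 * (k * √((D - 2) / 2)) ^ 4 := by
      rw [mul_pow, show √((D - 2) / 2) ^ 4 = (√((D - 2) / 2) ^ 2) ^ 2 by ring, hκ2]
      ring
    rw [h3]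
    have h4 := mul_le_mul_of_nonneg_left h2 hR0
    have h5 : 0 ≤ R (k - 1) := hR0.trans hR
    nlinarith

/-! ### Sections of the set of paths -/

lemma IsPath.normal_zero {k : ℕ} {u z : E3} {ν w : ℕ → E3} (h : IsPath (0 < ·) k u z ν w)
    (hk : 0 < k) : ν 0 = -centreA 1 u := by
  have h0 : 0 < inner ℝ (w 0) (ν 0) := h.out 0 hk
  rw [h.vel_zero] at h0
  set c := 2 * inner ℝ u (ν 0) with hc
  have hc0 : 0 < c := by positivity
  have h1 : e - u = -(c • ν 0) := by
    conv_lhs => rw [h.init]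
    rw [← hc]
    abel
  have h2 : ‖e - u‖ = c := by
    rw [h1, norm_neg, norm_smul, h.normal 0 hk, mul_one, Real.norm_of_nonneg hc0.le]
  rw [centreA, h2, h1, smul_neg, neg_neg, smul_smul, one_div, inv_mul_cancel₀ hc0.ne', one_smul]

lemma norm_sub_le_two_mul {a b : E3} {δ : ℝ} (ha : ‖a + e‖ ≤ δ) (hb : ‖b + e‖ ≤ δ) :
    ‖a - b‖ ≤ 2 * δ := by
  rw [show a - b = (a + e) - (b + e) by abel]
  linarith [norm_sub_le (a + e) (b + e)]

/-- The initial velocities of the paths near a given direction, for obstacles at distance at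
most `12`. -/
lemma uniformSphere_near_le : ∃ C : ℝ≥0∞, C ≠ ∞ ∧ ∀ (k : ℕ) (δ : ℝ) (z : E3), 2 ≤ k → 0 < δ →
    z ≠ 0 → ‖z‖ ≠ 2 → ‖z‖ ≤ 12 →
    uniformSphere {u | (u : E3) ≠ e ∧ (u, z) ∈ pathSet k δ} ≤
      C * ENNReal.ofReal (δ * min 1 (1 / (k ^ 4 * (‖z‖ - 2) ^ 2))) := by
  obtain ⟨C, hC, hle⟩ := uniformSphere_le_of_divergence
  refine ⟨C * ENNReal.ofReal (4 * 10 ^ 8), ENNReal.mul_ne_top hC ENNReal.ofReal_ne_top,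
    fun k δ z hk hδ hz hz2 hz12 ↦ ?_⟩
  have hp : 0 < (k : ℝ) ^ 4 * (‖z‖ - 2) ^ 2 := by
    have h1 : (0 : ℝ) < k := by exact_mod_cast (by lia : 0 < k)
    have h2 := sq_pos_of_ne_zero (sub_ne_zero.2 hz2)
    positivity
  rw [mul_assoc, ← ENNReal.ofReal_mul (by positivity)]
  refine hle _ _ (by positivity) (fun u hu ↦ hu.1) ?_
  rintro u ⟨hue, ν, w, h, hw⟩ u' ⟨hue', ν', w', h', hw'⟩
  have hd := h.divergence (by lia) h'
  have hR := divergence_le_of_near hd (h.axialPath hz) hk (norm_pos_iff.2 hz) hz2 hz12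
    (fun j hj ↦ le_add_of_nonneg_right (by
      have : 0 < inner ℝ (w' j) (ν' j) := h'.out j hj
      positivity)) (fun j ↦ le_add_of_nonneg_right (norm_nonneg _))
  have hR' := hd.mono (Nat.zero_le (k - 1)) (by lia)
  have hlast := hd.R_le (k - 1)
  dsimp only at hR hR' hlast
  have h1 := norm_sub_le_two_mul hw hw'
  have h2 : ‖ν (k - 1) - ν' (k - 1)‖ ≤ 2 := by
    refine (norm_sub_le _ _).trans ?_
    linarith [h.normal_le (k - 1), h'.normal_le (k - 1)]
  have h3 : ‖w (k - 1) - w' (k - 1)‖ * ‖ν (k - 1) - ν' (k - 1)‖ ≤ 2 * δ * 2 := by gcongr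
  have h0 : inner ℝ (w 0 - w' 0) (ν 0 - ν' 0) =
      inner ℝ ((u : E3) - u') (centreA 1 u' - centreA 1 u) := by
    rw [h.vel_zero, h'.vel_zero, h.normal_zero (by lia), h'.normal_zero (by lia)]
    congr 1
    abel
  rw [← h0]
  rw [mul_min_of_nonneg _ _ hδ.le, mul_min_of_nonneg _ _ (by norm_num), le_min_iff]
  constructor
  · linarith
  · rw [mul_one_div, mul_div_assoc', le_div_iff₀ hp]
    linarith

/-! ### Distant obstacles: expansion of velocity differences -/

/-- Divergence of two unit velocities near a sphere, where `a` is the velocity before and `w` after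
a collision, and `ξ` is a point of the incoming line, relative to the centre. -/
lemma inner_sub_normal_le {a a' w w' ν ν' ξ ξ' : E3} {c c' t t' r : ℝ}
    (ha : ‖a‖ = 1) (ha' : ‖a'‖ = 1)
    (hw : ‖w‖ = 1) (hw' : ‖w'‖ = 1) (hν : ‖ν‖ = 1) (hν' : ‖ν'‖ = 1) (hξ : ‖ξ‖ ≤ r) (hξ' : ‖ξ'‖ ≤ r)
    (h : w = a + c • ν) (h' : w' = a' + c' • ν') (hf : ν = ξ + t • a) (hf' : ν' = ξ' + t' • a') :
    inner ℝ (w - w') (ν - ν') ≤ 3 * ‖w - w'‖ ^ 2 +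
      2 * ‖w - w'‖ * (r * ‖a - a'‖ + ‖ξ - ξ'‖) := by
  -- Conservation of the angular momentum about the centre, `ν ∧ w = ξ ∧ a`, contracted with `x`.
  -- For `x = w` it recovers the part of `ν` orthogonal to `w`, so `ν - ν'` is controlled by
  -- incoming data and by `w - w'`.
  have key (w ν a ξ : E3) (c t : ℝ) (h : w = a + c • ν) (hf : ν = ξ + t • a) (x : E3) :
      (inner ℝ w x : ℝ) • ν - (inner ℝ ν x : ℝ) • w =
        (inner ℝ a x : ℝ) • ξ - (inner ℝ ξ x : ℝ) • a := by
    subst h hf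
    simp only [inner_add_left, inner_smul_left, RCLike.conj_to_real]
    module
  have hle (x y v : E3) : ‖(inner ℝ x y : ℝ) • v‖ ≤ ‖x‖ * ‖y‖ * ‖v‖ := by
    rw [norm_smul]
    gcongr
    exact norm_inner_le_norm x y
  have h1 := key w ν a ξ c t h hf w
  have h2 := key w' ν' a' ξ' c' t' h' hf' w'
  have h3 := key w' ν' a' ξ' c' t' h' hf' w
  rw [real_inner_self_eq_norm_sq, hw, one_pow, one_smul] at h1
  rw [real_inner_self_eq_norm_sq, hw', one_pow, one_smul] at h2
  set V := ‖w - w'‖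
  set A := ‖a - a'‖
  set X := ‖ξ - ξ'‖
  have hm (ν w : E3) (hν : ‖ν‖ = 1) (hw : ‖w‖ = 1) : inner ℝ ν w ≤ (1 : ℝ) := by
    have := real_inner_le_norm ν w
    rwa [hν, hw, one_mul] at this
  have hsplit : ν - ν' = ((inner ℝ a w : ℝ) • ξ - (inner ℝ ξ w : ℝ) • a -
      ((inner ℝ a' w' : ℝ) • ξ' - (inner ℝ ξ' w' : ℝ) • a')) +
      ((inner ℝ ν w : ℝ) • w - (inner ℝ ν' w' : ℝ) • w') := by
    rw [← h1, ← h2]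
    abel
  have hπ : (inner ℝ a w : ℝ) • ξ - (inner ℝ ξ w : ℝ) • a -
      ((inner ℝ a' w' : ℝ) • ξ' - (inner ℝ ξ' w' : ℝ) • a') =
      ((inner ℝ (a - a') w : ℝ) • ξ + (inner ℝ a' w : ℝ) • (ξ - ξ') -
        (inner ℝ (ξ - ξ') w : ℝ) • a - (inner ℝ ξ' w : ℝ) • (a - a')) +
      ((inner ℝ w' (w - w') : ℝ) • ν' - (inner ℝ ν' (w - w') : ℝ) • w') := by
    have h4 : (inner ℝ w' (w - w') : ℝ) • ν' - (inner ℝ ν' (w - w') : ℝ) • w' =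
        ((inner ℝ a' w : ℝ) • ξ' - (inner ℝ ξ' w : ℝ) • a') -
        ((inner ℝ a' w' : ℝ) • ξ' - (inner ℝ ξ' w' : ℝ) • a') := by
      rw [← h3, ← h2, inner_sub_right, inner_sub_right, real_inner_self_eq_norm_sq, hw']
      module
    rw [h4]
    simp only [inner_sub_left]
    module
  have hπn : ‖(inner ℝ a w : ℝ) • ξ - (inner ℝ ξ w : ℝ) • a -
      ((inner ℝ a' w' : ℝ) • ξ' - (inner ℝ ξ' w' : ℝ) • a')‖ ≤ 2 * (r * A + X) + 2 * V := by
    rw [hπ]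
    have b1 := hle (a - a') w ξ
    have b2 := hle a' w (ξ - ξ')
    have b3 := hle (ξ - ξ') w a
    have b4 := hle ξ' w (a - a')
    have b5 := hle w' (w - w') ν'
    have b6 := hle ν' (w - w') w'
    rw [hw] at b1 b2 b3 b4
    rw [ha'] at b2
    rw [ha] at b3
    rw [hw', hν'] at b5 b6
    have c1 : A * 1 * ‖ξ‖ ≤ r * A := by nlinarith [norm_nonneg (a - a')]
    have c4 : ‖ξ'‖ * 1 * A ≤ r * A := by nlinarith [norm_nonneg (a - a')]
    refine (norm_add_le _ _).trans ?_
    have d1 := norm_sub_le ((inner ℝ (a - a') w : ℝ) • ξ + (inner ℝ a' w : ℝ) • (ξ - ξ') -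
        (inner ℝ (ξ - ξ') w : ℝ) • a) ((inner ℝ ξ' w : ℝ) • (a - a'))
    have d2 := norm_sub_le ((inner ℝ (a - a') w : ℝ) • ξ + (inner ℝ a' w : ℝ) • (ξ - ξ'))
      ((inner ℝ (ξ - ξ') w : ℝ) • a)
    have d3 := norm_add_le ((inner ℝ (a - a') w : ℝ) • ξ) ((inner ℝ a' w : ℝ) • (ξ - ξ'))
    have d4 := norm_sub_le ((inner ℝ w' (w - w') : ℝ) • ν') ((inner ℝ ν' (w - w') : ℝ) • w')
    linarith
  rw [hsplit, inner_add_right, inner_unit_sub hw hw']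
  have e1 := real_inner_le_norm (w - w') ((inner ℝ a w : ℝ) • ξ - (inner ℝ ξ w : ℝ) • a -
      ((inner ℝ a' w' : ℝ) • ξ' - (inner ℝ ξ' w' : ℝ) • a'))
  have hV : 0 ≤ V := norm_nonneg _
  have e2 := mul_le_mul_of_nonneg_left hπn hV
  have e3 : (inner ℝ ν w + inner ℝ ν' w') / 2 * V ^ 2 ≤ 1 * V ^ 2 := by
    gcongr
    linarith [hm ν w hν hw, hm ν' w' hν' hw']
  change _ + _ * V ^ 2 ≤ _
  nlinarith

namespace AxialPath

variable {k : ℕ} {D : ℝ} {n σ c t : ℕ → ℝ} (h : AxialPath k D n σ c t)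
include h

lemma sub_two_le {j : ℕ} (hj : j + 1 < k) : D - 2 ≤ t j := by
  have h1 := h.axial j hj
  have h2 := h.sq_n j (by lia)
  have h3 := h.sq_n (j + 1) hj
  have h4 := h.sq_σ j (by lia)
  have h5 : σ j ≤ 1 := by nlinarith
  have h6 : n j ≤ 1 := by nlinarith
  have h7 : n (j + 1) ≤ 1 := by nlinarith
  linarith [mul_le_mul_of_nonneg_left h5 (h.t_nonneg j)]

/-- Between distant balls each flight is within 60 degrees of the axis, since `t σ ≥ D - 2 ≥ D / 2 ≥
t / 2`. Reflection then gives `c ≥ c n = σ + σ' ≥ 1`. -/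
lemma one_le_c (hD : 4 ≤ D) {j : ℕ} (hj : j + 2 < k) : 1 ≤ c (j + 1) := by
  have hσ {i : ℕ} (hi : i + 1 < k) : 1 / 2 ≤ σ i := by
    have h1 := h.axial i hi
    have h2 := h.sq_n i (by lia)
    have h3 := h.sq_n (i + 1) hi
    have h4 := h.sq_σ i (by lia)
    have h5 := h.along i hi
    have h6 := h.c_pos i (by lia)
    have h7 := h.c_pos (i + 1) hi
    have h8 : σ i ≤ 1 := by nlinarith
    have h9 := h.t_nonneg i
    have h10 : t i ≤ D := by nlinarith
    have h11 : n i ≤ 1 := by nlinarith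
    have h12 : n (i + 1) ≤ 1 := by nlinarith
    by_contra! hc
    have h13 : 0 < t i := h9.lt_of_ne fun h0 ↦ by
      rw [← h0] at h1
      linarith
    nlinarith [mul_lt_mul_of_pos_left hc h13]
  have h1 := hσ (i := j) (by lia)
  have h2 := hσ (i := j + 1) (by lia)
  have h3 := h.reflect j (by lia)
  have h4 := h.c_pos (j + 1) (by lia)
  have h5 := h.sq_n (j + 1) (by lia)
  have h6 : n (j + 1) ≤ 1 := by nlinarith
  linarith [mul_le_mul_of_nonneg_left h6 h4.le]

end AxialPath

namespace Divergence

variable {k : ℕ} {R Q X W c t : ℕ → ℝ} (h : Divergence k R Q X W c t)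
include h

lemma mul_W_le_X {b : ℝ} {j : ℕ} (hj : j + 1 < k) (hb : 2 * b ≤ t j) : b * W j ≤ X (j + 1) := by
  have h1 := h.flight j hj
  have h2 := h.R_nonneg (j := j) (by lia)
  have h3 := h.Q_le j
  rcases (h.W_nonneg j).eq_or_lt with h0 | h0
  · rw [← h0, mul_zero]
    exact h.X_nonneg _
  · by_contra! hc
    nlinarith [mul_pos h0 (sub_pos.2 hc)]

lemma sq_X_le_R {j : ℕ} (hj : j + 1 < k) (hc : 2 ≤ c (j + 1)) : X (j + 1) ^ 2 ≤ R (j + 1) := by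
  have h1 := h.collision j hj
  have h2 := h.R_nonneg (j := j) (by lia)
  have h3 := h.R_le_Q hj
  nlinarith [sq_nonneg (X (j + 1))]

lemma X_le_W {j : ℕ} (hj : j + 1 < k) (hc : 2 ≤ c (j + 1)) : X (j + 1) ≤ W (j + 1) := by
  have h1 := h.sq_X_le_R hj hc
  have h2 := h.R_le (j + 1)
  rcases (h.X_nonneg (j + 1)).eq_or_lt with h0 | h0
  · rw [← h0]
    exact h.W_nonneg _
  · by_contra! hc
    nlinarith [mul_pos h0 (sub_pos.2 hc)]

/-- A flight turns a velocity difference `W` into a distance at least `b W` between the impact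
points, and a collision turns a distance `X` into a velocity difference at least `X`. -/
lemma pow_mul_W_le {b : ℝ} (hb0 : 0 ≤ b) (hb : ∀ j, j + 1 < k → 2 * b ≤ t j)
    (hc : ∀ j, j + 2 < k → 2 ≤ c (j + 1)) {j : ℕ} (hj : j + 1 < k) : b ^ j * W 0 ≤ W j := by
  induction j with
  | zero => simp
  | succ j ih =>
    have h1 := ih (by lia)
    have h2 := h.mul_W_le_X (j := j) (by lia) (hb j (by lia))
    have h3 := h.X_le_W (j := j) (by lia) (hc j (by lia))
    calc b ^ (j + 1) * W 0 = b * (b ^ j * W 0) := by ring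
      _ ≤ b * W j := by gcongr
      _ ≤ W (j + 1) := h2.trans h3

end Divergence

section far

variable {k : ℕ} {u u' z : E3} {ν w ν' w' : ℕ → E3}

lemma IsPath.pow_mul_norm_sub_le (h : IsPath (0 < ·) k u z ν w) (h' : IsPath (0 < ·) k u' z ν' w')
    (hk : 2 ≤ k) (hz : 8 ≤ ‖z‖) : (‖z‖ - 2) ^ (k - 2) * ‖u - u'‖ ≤ ‖w (k - 2) - w' (k - 2)‖ ∧
      (‖z‖ - 2) ^ (k - 1) * ‖u - u'‖ ≤ 2 := by
  have hz0 : z ≠ 0 := norm_pos_iff.1 (by linarith)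
  have hd := h.divergence (by lia) h'
  have ha := h.axialPath hz0
  have ha' := h'.axialPath hz0
  have ht : ∀ j, j + 1 < k → 2 * (‖z‖ - 2) ≤
      ‖side z j + ν (j + 1) - ν j‖ + ‖side z j + ν' (j + 1) - ν' j‖ := fun j hj ↦ by
    linarith [ha.sub_two_le hj, ha'.sub_two_le hj]
  have h1 := hd.pow_mul_W_le (b := ‖z‖ - 2) (by linarith) ht (fun j hj ↦ by
    linarith [ha.one_le_c (by linarith) hj, ha'.one_le_c (by linarith) hj])
    (j := k - 2) (by lia)
  have h2 := hd.mul_W_le_X (j := k - 2) (by lia) (ht _ (by lia))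
  rw [h.vel_zero, h'.vel_zero] at h1
  refine ⟨h1, ?_⟩
  have h3 : ‖ν (k - 2 + 1) - ν' (k - 2 + 1)‖ ≤ 2 := by
    refine (norm_sub_le _ _).trans ?_
    linarith [h.normal_le (k - 2 + 1), h'.normal_le (k - 2 + 1)]
  calc (‖z‖ - 2) ^ (k - 1) * ‖u - u'‖ = (‖z‖ - 2) * ((‖z‖ - 2) ^ (k - 2) * ‖u - u'‖) := by
        rw [show k - 1 = k - 2 + 1 by lia]
        ring
    _ ≤ (‖z‖ - 2) * ‖w (k - 2) - w' (k - 2)‖ := by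
        gcongr
        linarith
    _ ≤ 2 := h2.trans h3

/-- The crude bound of the last divergence by `4 δ` would only give a difference of order `√δ`.
Bounding it by `inner_sub_normal_le` instead, linearly in the final velocity difference with
coefficients that are small with the preceding one, gives order `δ`. -/
lemma IsPath.norm_sub_penultimate_le (h : IsPath (0 < ·) k u z ν w)
    (h' : IsPath (0 < ·) k u' z ν' w') (hk : 3 ≤ k) (hz : 8 ≤ ‖z‖) {δ : ℝ} (hδ : 0 < δ)
    (hw : ‖w (k - 1) + e‖ ≤ δ) (hw' : ‖w' (k - 1) + e‖ ≤ δ) :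
    ‖w (k - 2) - w' (k - 2)‖ ≤ 9 * δ := by
  obtain ⟨i, rfl⟩ : ∃ i, k = i + 3 := ⟨k - 3, by lia⟩
  simp only [show i + 3 - 1 = i + 2 by lia, show i + 3 - 2 = i + 1 by lia] at hw hw' ⊢
  have hz0 : z ≠ 0 := norm_pos_iff.1 (by linarith)
  have hd := h.divergence (by lia) h'
  have ha := h.axialPath hz0
  have ha' := h'.axialPath hz0
  have hc : 2 ≤ 2 * inner ℝ (w (i + 1)) (ν (i + 1)) + 2 * inner ℝ (w' (i + 1)) (ν' (i + 1)) := by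
    linarith [ha.one_le_c (by linarith) (j := i) (by lia),
      ha'.one_le_c (by linarith) (j := i) (by lia)]
  have hXW := hd.X_le_W (j := i) (by lia) hc
  have hX := hd.sq_X_le_R (j := i) (by lia) hc
  have hQ := hd.flight (i + 1) (by lia)
  have hQR := hd.Q_le_R (j := i + 1) (by lia)
  have ht := ha.sub_two_le (j := i + 1) (by lia)
  have ht' := ha'.sub_two_le (j := i + 1) (by lia)
  have hξ (ν : ℕ → E3) (hν : ‖ν (i + 1)‖ ≤ 1) : ‖ν (i + 1) - side z (i + 1)‖ ≤ ‖z‖ + 1 := by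
    have := norm_sub_le (ν (i + 1)) (side z (i + 1))
    rw [norm_side] at this
    linarith
  have hfl (u : E3) (ν w : ℕ → E3) (h : IsPath (0 < ·) (i + 3) u z ν w) :
      ν (i + 2) = (ν (i + 1) - side z (i + 1)) +
        ‖side z (i + 1) + ν (i + 2) - ν (i + 1)‖ • w (i + 1) := by
    have := h.flight (i + 1) (by lia)
    rw [add_assoc i 1 1] at this
    rw [← this]
    abel
  have hlast := inner_sub_normal_le (h.vel (i + 1) (by lia)) (h'.vel (i + 1) (by lia))
    (h.vel (i + 2) (by lia)) (h'.vel (i + 2) (by lia)) (h.normal (i + 2) (by lia))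
    (h'.normal (i + 2) (by lia)) (hξ ν (h.normal_le _)) (hξ ν' (h'.normal_le _))
    (h.reflect (i + 1) (by lia)) (h'.reflect (i + 1) (by lia)) (hfl _ _ _ h) (hfl _ _ _ h')
  rw [sub_sub_sub_cancel_right] at hlast
  simp only [add_assoc, Nat.reduceAdd] at hXW hX hQ hQR ht ht' hlast
  have hV := norm_sub_le_two_mul hw hw'
  set V := ‖w (i + 2) - w' (i + 2)‖
  set A := ‖w (i + 1) - w' (i + 1)‖
  set X := ‖ν (i + 1) - ν' (i + 1)‖
  have hV0 : 0 ≤ V := norm_nonneg _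
  have hA0 : 0 ≤ A := norm_nonneg _
  have hX0 : 0 ≤ X := norm_nonneg _
  have h1 : (‖z‖ - 2) * A ^ 2 ≤ 3 * V ^ 2 + 2 * V * ((‖z‖ + 1) * A + X) := by
    refine le_trans ?_ (hQR.trans hlast)
    rw [hQ]
    nlinarith [sq_nonneg A, sq_nonneg X]
  have h2 : 3 * V ^ 2 + 2 * V * ((‖z‖ + 1) * A + X) ≤
      3 * (2 * δ) ^ 2 + 2 * (2 * δ) * ((‖z‖ + 1) * A + A) := by
    have : 0 ≤ (‖z‖ + 1) * A := by positivity
    gcongr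
  by_contra! hlt
  -- The factor `‖z‖ - 2` cancels because `‖z‖ ≥ 8`; the remaining quadratic inequality is
  -- incompatible with `A > 9 δ`.
  have h3 : (‖z‖ - 2) * A ^ 2 ≤ (‖z‖ - 2) * (2 * δ ^ 2 + 8 * δ * A) := by
    have h4 : 0 ≤ δ * A := by positivity
    nlinarith [mul_nonneg (by linarith : 0 ≤ ‖z‖ - 8) h4, mul_nonneg (by linarith : 0 ≤ ‖z‖ - 8)
      (sq_nonneg δ)]
  have h5 := le_of_mul_le_mul_left h3 (by linarith)
  nlinarith

end far

/-- The initial velocities of the paths with `k` collisions, for distant obstacles. -/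
lemma uniformSphere_far_le : ∃ C : ℝ≥0∞, C ≠ ∞ ∧ ∀ (k : ℕ) (δ : ℝ) (z : E3), 3 ≤ k → 0 < δ →
    8 ≤ ‖z‖ → uniformSphere {u | (u : E3) ≠ e ∧ (u, z) ∈ pathSet k δ} ≤
      C * ENNReal.ofReal (((‖z‖ - 2) ^ (k - 1))⁻¹ ^ 2) ∧
      uniformSphere {u | (u : E3) ≠ e ∧ (u, z) ∈ pathSet k δ} ≤
      C * ENNReal.ofReal ((δ * ((‖z‖ - 2) ^ (k - 2))⁻¹) ^ 2) := by
  obtain ⟨C, hC, hle⟩ := uniformSphere_le_of_diam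
  refine ⟨C * ENNReal.ofReal (9 ^ 2), ENNReal.mul_ne_top hC ENNReal.ofReal_ne_top,
    fun k δ z hk hδ hz ↦ ?_⟩
  have hb : 0 < ‖z‖ - 2 := by linarith
  rw [mul_assoc, mul_assoc, ← ENNReal.ofReal_mul (by positivity),
    ← ENNReal.ofReal_mul (by positivity), ← mul_pow, ← mul_pow]
  constructor
  · refine hle _ _ (by positivity) ?_
    rintro u ⟨hue, ν, w, h, hw⟩ u' ⟨hue', ν', w', h', hw'⟩
    have := (h'.pow_mul_norm_sub_le h (by lia) hz).2
    rw [← div_eq_mul_inv, le_div_iff₀ (by positivity), mul_comm]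
    linarith
  · refine hle _ _ (by positivity) ?_
    rintro u ⟨hue, ν, w, h, hw⟩ u' ⟨hue', ν', w', h', hw'⟩
    have h1 := (h'.pow_mul_norm_sub_le h (by lia) hz).1
    have h2 := h'.norm_sub_penultimate_le h hk hz hδ hw' hw
    rw [← mul_assoc, ← div_eq_mul_inv, le_div_iff₀ (by positivity), mul_comm]
    linarith

/-! ### The measure of the parameters of the paths -/

lemma lam_relPos_radial_le : ∃ C : ℝ≥0∞, C ≠ ∞ ∧ ∀ (T : Set (S2 × E3)) (f : ℝ → ℝ≥0∞),
    MeasurableSet T → Measurable f → (∀ z : E3, z ≠ 0 → ‖z‖ ≠ 2 →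
      uniformSphere {u | (u : E3) ≠ e ∧ (u, z) ∈ T} ≤ f ‖z‖) →
    lam (properSet ∩ relPos ⁻¹' T) ≤ C * ∫⁻ y in Ioi (0 : ℝ), ENNReal.ofReal (y ^ 2) * f y := by
  obtain ⟨C, hC, hle⟩ := lam_relPos_le
  obtain ⟨C', hC', hle'⟩ := lintegral_radial_le
  refine ⟨C * C', ENNReal.mul_ne_top hC hC', fun T f hT hf hs ↦ (hle T hT).trans ?_⟩
  rw [mul_assoc]
  gcongr
  refine le_trans (lintegral_mono_ae ?_) (hle' f hf)
  have h0 : ∀ᵐ z : E3, z ≠ 0 := by simp [ae_iff]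
  have h2 : ∀ᵐ z : E3, ‖z‖ ≠ 2 := by
    have := Measure.addHaar_sphere (volume : Measure E3) 0 2
    rw [ae_iff]
    simpa [Metric.sphere] using this
  filter_upwards [h0, h2] with z hz0 hz2 using hs z hz0 hz2

lemma lintegral_inv_one_add_sq_mul {m : ℝ} (hm : 0 < m) (a : ℝ) :
    ∫⁻ y : ℝ, ENNReal.ofReal (1 + (m * (y - a)) ^ 2)⁻¹ = ENNReal.ofReal (Real.pi / m) := by
  rw [lintegral_sub_right_eq_self (fun y ↦ ENNReal.ofReal (1 + (m * y) ^ 2)⁻¹) a,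
    ← ofReal_integral_eq_lintegral_ofReal (integrable_inv_one_add_sq.comp_mul_left' hm.ne')
      (.of_forall fun _ ↦ by positivity),
    Measure.integral_comp_mul_left (fun y ↦ (1 + y ^ 2)⁻¹), integral_univ_inv_one_add_sq,
    abs_of_pos (inv_pos.2 hm), smul_eq_mul]
  congr 1
  ring

lemma lam_near_le : ∃ C : ℝ≥0∞, C ≠ ∞ ∧ ∀ (k : ℕ) (δ : ℝ), 2 ≤ k → 0 < δ →
    lam (properSet ∩ relPos ⁻¹' (pathSet k δ ∩ {q | ‖q.2‖ ≤ 12})) ≤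
      C * ENNReal.ofReal (δ / k ^ 2) := by
  obtain ⟨C, hC, hle⟩ := lam_relPos_radial_le
  obtain ⟨C', hC', hle'⟩ := uniformSphere_near_le
  refine ⟨C * (C' * ENNReal.ofReal (288 * Real.pi)),
    ENNReal.mul_ne_top hC (ENNReal.mul_ne_top hC' ENNReal.ofReal_ne_top), fun k δ hk hδ ↦ ?_⟩
  have hk0 : (0 : ℝ) < k := by exact_mod_cast (by lia : 0 < k)
  have hm : MeasurableSet {q : S2 × E3 | ‖q.2‖ ≤ 12} :=
    measurableSet_le (by fun_prop) measurable_const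
  refine (hle _ ((Iic 12).indicator fun y : ℝ ↦
    C' * ENNReal.ofReal (δ * min 1 (1 / (k ^ 4 * (y - 2) ^ 2))))
    ((measurableSet_pathSet k δ).inter hm) (Measurable.indicator (by fun_prop) measurableSet_Iic)
    fun z hz0 hz2 ↦ ?_).trans ?_
  · rcases le_or_gt ‖z‖ 12 with h12 | h12
    · rw [indicator_of_mem (mem_Iic.2 h12)]
      refine le_trans (measure_mono ?_) (hle' k δ z hk hδ hz0 hz2 h12)
      exact fun u hu ↦ ⟨hu.1, hu.2.1⟩
    · exact (measure_mono_null (t := (∅ : Set S2)) (fun u hu ↦ (h12.not_ge hu.2.2).elim)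
        measure_empty).trans_le zero_le
  · rw [mul_assoc]
    gcongr
    calc ∫⁻ y in Ioi (0 : ℝ), ENNReal.ofReal (y ^ 2) * (Iic 12).indicator (fun y : ℝ ↦
          C' * ENNReal.ofReal (δ * min 1 (1 / (k ^ 4 * (y - 2) ^ 2)))) y
        ≤ ∫⁻ y in Ioi (0 : ℝ), C' * ENNReal.ofReal (288 * δ) *
            ENNReal.ofReal (1 + ((k : ℝ) ^ 2 * (y - 2)) ^ 2)⁻¹ := by
          refine setLIntegral_mono' measurableSet_Ioi fun y hy ↦ ?_
          rcases le_or_gt y 12 with h12 | h12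
          · rw [indicator_of_mem (mem_Iic.2 h12), mul_left_comm, mul_assoc,
              ← ENNReal.ofReal_mul (by positivity), ← ENNReal.ofReal_mul (by positivity)]
            refine mul_le_mul' le_rfl (ENNReal.ofReal_le_ofReal ?_)
            have h1 : y ^ 2 ≤ 144 := by nlinarith [mem_Ioi.1 hy]
            -- The majorant is a Cauchy density of width `1 / k ^ 2` about the tangency distance
            -- `2`, whose integral is explicit. The factor `288` is `2 * 12 ^ 2`.
            have h2 : min 1 (1 / ((k : ℝ) ^ 4 * (y - 2) ^ 2)) ≤
                2 * (1 + ((k : ℝ) ^ 2 * (y - 2)) ^ 2)⁻¹ := by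
              rw [show (k : ℝ) ^ 4 * (y - 2) ^ 2 = ((k : ℝ) ^ 2 * (y - 2)) ^ 2 by ring]
              set x := ((k : ℝ) ^ 2 * (y - 2)) ^ 2
              have hx : 0 ≤ x := sq_nonneg _
              rw [← div_eq_mul_inv, le_div_iff₀ (by positivity)]
              rcases le_total x 1 with h | h
              · nlinarith [min_le_left 1 (1 / x)]
              · have h3 : 1 / x * x = 1 := by field_simp
                have h4 : 1 / x ≤ 1 := by rw [div_le_one (by linarith)]; exact h
                nlinarith [min_le_right 1 (1 / x)]
            have h3 : 0 ≤ min 1 (1 / ((k : ℝ) ^ 4 * (y - 2) ^ 2)) := by positivity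
            calc y ^ 2 * (δ * min 1 (1 / ((k : ℝ) ^ 4 * (y - 2) ^ 2)))
                ≤ 144 * (δ * (2 * (1 + ((k : ℝ) ^ 2 * (y - 2)) ^ 2)⁻¹)) := by gcongr
              _ = _ := by ring
          · rw [indicator_of_notMem (by simpa using h12), mul_zero]
            exact zero_le
      _ ≤ ∫⁻ y : ℝ, C' * ENNReal.ofReal (288 * δ) *
            ENNReal.ofReal (1 + ((k : ℝ) ^ 2 * (y - 2)) ^ 2)⁻¹ := setLIntegral_le_lintegral _ _
      _ = C' * ENNReal.ofReal (288 * Real.pi) * ENNReal.ofReal (δ / k ^ 2) := by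
          rw [lintegral_const_mul _ (by fun_prop), lintegral_inv_one_add_sq_mul (by positivity),
            mul_assoc, mul_assoc, ← ENNReal.ofReal_mul (by positivity),
            ← ENNReal.ofReal_mul (by positivity)]
          congr 2
          ring

lemma lam_far_le : ∃ C : ℝ≥0∞, C ≠ ∞ ∧ ∀ (k : ℕ) (δ : ℝ) (J : Set ℝ), 3 ≤ k → 0 < δ →
    MeasurableSet J → J ⊆ Ici 6 →
    lam (properSet ∩ relPos ⁻¹' (pathSet k δ ∩ {q | ‖q.2‖ - 2 ∈ J})) ≤
      C * ∫⁻ b in J, ENNReal.ofReal ((b ^ (k - 2))⁻¹ ^ 2) ∧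
    lam (properSet ∩ relPos ⁻¹' (pathSet k δ ∩ {q | ‖q.2‖ - 2 ∈ J})) ≤
      C * ∫⁻ b in J, ENNReal.ofReal ((δ * (b ^ (k - 3))⁻¹) ^ 2) := by
  obtain ⟨C, hC, hle⟩ := lam_relPos_radial_le
  obtain ⟨C', hC', hle'⟩ := uniformSphere_far_le
  refine ⟨C * (C' * ENNReal.ofReal 2), ENNReal.mul_ne_top hC
    (ENNReal.mul_ne_top hC' ENNReal.ofReal_ne_top), fun k δ J hk hδ hJ hJ6 ↦ ?_⟩
  have hm : MeasurableSet {q : S2 × E3 | ‖q.2‖ - 2 ∈ J} :=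
    (by fun_prop : Measurable fun q : S2 × E3 ↦ ‖q.2‖ - 2) hJ
  have key (φ ψ : ℝ → ℝ) (hφ : Measurable φ) (hψ : Measurable ψ)
            (hφψ : ∀ b ∈ J, (b + 2) ^ 2 * φ b ≤ 2 * ψ b)
      (hs : ∀ z : E3, ‖z‖ - 2 ∈ J → uniformSphere {u | (u : E3) ≠ e ∧ (u, z) ∈ pathSet k δ} ≤
        C' * ENNReal.ofReal (φ (‖z‖ - 2))) :
      lam (properSet ∩ relPos ⁻¹' (pathSet k δ ∩ {q | ‖q.2‖ - 2 ∈ J})) ≤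
        C * (C' * ENNReal.ofReal 2) * ∫⁻ b in J, ENNReal.ofReal (ψ b) := by
    refine (hle _ (fun y ↦ J.indicator (fun b ↦ C' * ENNReal.ofReal (φ b)) (y - 2))
      ((measurableSet_pathSet k δ).inter hm) ?_ fun z _ _ ↦ ?_).trans ?_
    · exact (Measurable.indicator (by fun_prop) hJ).comp (measurable_id.sub_const 2)
    · by_cases hz : ‖z‖ - 2 ∈ J
      · rw [indicator_of_mem hz]
        refine le_trans (measure_mono ?_) (hs z hz)
        exact fun u hu ↦ ⟨hu.1, hu.2.1⟩
      · exact (measure_mono_null (t := (∅ : Set S2)) (fun u hu ↦ (hz hu.2.2).elim)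
          measure_empty).trans_le zero_le
    · rw [mul_assoc C]
      gcongr
      refine (setLIntegral_le_lintegral _ _).trans ?_
      calc ∫⁻ y : ℝ, ENNReal.ofReal (y ^ 2) *
            J.indicator (fun b ↦ C' * ENNReal.ofReal (φ b)) (y - 2)
          ≤ ∫⁻ y : ℝ, J.indicator (fun b ↦ C' * ENNReal.ofReal 2 * ENNReal.ofReal (ψ b))
              (y - 2) := by
            refine lintegral_mono fun y ↦ ?_
            by_cases hy : y - 2 ∈ J
            · simp only [indicator_of_mem hy]
              rw [mul_left_comm, mul_assoc, ← ENNReal.ofReal_mul (by positivity),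
                ← ENNReal.ofReal_mul (by positivity)]
              refine mul_le_mul' le_rfl (ENNReal.ofReal_le_ofReal ?_)
              have := hφψ _ hy
              rwa [sub_add_cancel] at this
            · simp [indicator_of_notMem hy]
        _ = C' * ENNReal.ofReal 2 * ∫⁻ b in J, ENNReal.ofReal (ψ b) := by
            rw [lintegral_sub_right_eq_self (fun y ↦
              J.indicator (fun b ↦ C' * ENNReal.ofReal 2 * ENNReal.ofReal (ψ b)) y) 2,
              lintegral_indicator hJ, lintegral_const_mul _ (by fun_prop)]
  -- The radial weight costs one factor `b ^ 2`, lowering the exponents of `uniformSphere_far_le` by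
  -- one.
  have hb (b : ℝ) (h : b ∈ J) : (b + 2) ^ 2 ≤ 2 * b ^ 2 ∧ 0 < b := by
    have : 6 ≤ b := hJ6 h
    exact ⟨by nlinarith, by linarith⟩
  have h8 (z : E3) (hz : ‖z‖ - 2 ∈ J) : 8 ≤ ‖z‖ := by
    have : 6 ≤ ‖z‖ - 2 := hJ6 hz
    linarith
  constructor
  · refine key (fun b ↦ (b ^ (k - 1))⁻¹ ^ 2) _ (by fun_prop) (by fun_prop) (fun b h ↦ ?_)
      fun z hz ↦ (hle' k δ z hk hδ (h8 z hz)).1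
    obtain ⟨h1, h2⟩ := hb b h
    calc (b + 2) ^ 2 * (b ^ (k - 1))⁻¹ ^ 2 ≤ 2 * b ^ 2 * (b ^ (k - 1))⁻¹ ^ 2 := by gcongr
      _ = 2 * (b ^ (k - 2))⁻¹ ^ 2 := by
        rw [show k - 1 = k - 2 + 1 by lia]
        field_simp
        ring
  · refine key (fun b ↦ (δ * (b ^ (k - 2))⁻¹) ^ 2) _ (by fun_prop) (by fun_prop) (fun b h ↦ ?_)
      fun z hz ↦ (hle' k δ z hk hδ (h8 z hz)).2
    obtain ⟨h1, h2⟩ := hb b h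
    calc (b + 2) ^ 2 * (δ * (b ^ (k - 2))⁻¹) ^ 2 ≤ 2 * b ^ 2 * (δ * (b ^ (k - 2))⁻¹) ^ 2 := by
          gcongr
      _ = 2 * (δ * (b ^ (k - 3))⁻¹) ^ 2 := by
        rw [show k - 2 = k - 3 + 1 by lia]
        field_simp
        ring

lemma setLIntegral_Ici_inv_pow_le {ρ : ℝ} (hρ : 0 < ρ) (m : ℕ) :
    ∫⁻ b in Ici ρ, ENNReal.ofReal ((b ^ (m + 1))⁻¹ ^ 2) ≤ ENNReal.ofReal ((ρ ^ m)⁻¹ ^ 2 / ρ) := by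
  rw [← setLIntegral_congr Ioi_ae_eq_Ici]
  have h1 := integrableOn_Ioi_rpow_of_lt (a := -2) (by norm_num) hρ
  have h2 := integral_Ioi_rpow_of_lt (a := -2) (by norm_num) hρ
  calc ∫⁻ b in Ioi ρ, ENNReal.ofReal ((b ^ (m + 1))⁻¹ ^ 2)
      ≤ ∫⁻ b in Ioi ρ, ENNReal.ofReal ((ρ ^ m)⁻¹ ^ 2) * ENNReal.ofReal (b ^ (-2 : ℝ)) := by
        refine setLIntegral_mono' measurableSet_Ioi fun b hb ↦ ?_
        have hb0 : 0 < b := hρ.trans hb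
        rw [← ENNReal.ofReal_mul (by positivity), Real.rpow_neg hb0.le, Real.rpow_two,
          pow_succ b m, mul_inv, mul_pow, inv_pow b 2]
        have : ρ ≤ b := (mem_Ioi.1 hb).le
        gcongr
    _ = ENNReal.ofReal ((ρ ^ m)⁻¹ ^ 2 / ρ) := by
        rw [lintegral_const_mul' _ _ ENNReal.ofReal_ne_top,
          ← ofReal_integral_eq_lintegral_ofReal h1 ((ae_restrict_iff' measurableSet_Ioi).2
            (.of_forall fun b hb ↦ Real.rpow_nonneg (hρ.trans hb).le _)), h2,
          ← ENNReal.ofReal_mul (by positivity), show (-2 : ℝ) + 1 = -1 by norm_num,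
          Real.rpow_neg_one]
        congr 1
        field_simp

/-! ### The exit events -/

lemma lam_le_of_relPos {E : Set (S2 × ℝ × S2)} {T : Set (S2 × E3)}
    (h : ∀ p ∈ properSet, p ∈ E → relPos p ∈ T) : lam E ≤ lam (properSet ∩ relPos ⁻¹' T) := by
  calc lam E ≤ lam (properSetᶜ ∪ properSet ∩ relPos ⁻¹' T) := by
        refine measure_mono fun p hp ↦ ?_
        by_cases hpp : p ∈ properSet
        · exact .inr ⟨hpp, h p hpp hp⟩
        · exact .inl hpp
    _ ≤ lam properSetᶜ + lam (properSet ∩ relPos ⁻¹' T) := measure_union_le _ _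
    _ = _ := by rw [lam_compl_properSet, zero_add]

lemma norm_relPos_sub_le {p : S2 × ℝ × S2} (hp : p ∈ properSet) :
    |‖(relPos p).2‖ - p.2.1| ≤ 2 := by
  obtain ⟨hu, hv, hh⟩ := hp
  have ha := norm_sub_div hu.symm
  have hb := norm_sub_div hv.symm
  have hz : (relPos p).2 = p.2.1 • (p.1 : E3) +
      ((1 / ‖(p.1 : E3) - p.2.2‖) • ((p.1 : E3) - p.2.2) - (1 / ‖e - p.1‖) • (e - p.1)) :=
    add_sub_assoc _ _ _
  have hn : ‖p.2.1 • (p.1 : E3)‖ = p.2.1 := by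
    rw [norm_smul, norm_S2, mul_one, Real.norm_of_nonneg hh.le]
  have h1 := abs_norm_sub_norm_le (relPos p).2 (p.2.1 • (p.1 : E3))
  rw [hn] at h1
  refine h1.trans ?_
  rw [hz, add_sub_cancel_left]
  refine (norm_sub_le _ _).trans ?_
  rw [ha, hb]
  norm_num

/-- The chord is at most the angle `1 / s` and at most `2`; adding the two bounds for `‖w + e‖ * s`
and `‖w + e‖` gives the constant `3`, uniformly for small `s`. -/
lemma norm_add_e_le_of_angle_lt {w : E3} (hw : ‖w‖ = 1) {s : ℝ} (hs : 0 < s)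
    (h : InnerProductGeometry.angle (-e) w < s⁻¹) : ‖w + e‖ ≤ 3 / (1 + s) := by
  have h2 : ‖w + e‖ ≤ 2 := by
    refine (norm_add_le _ _).trans ?_
    rw [hw, norm_e]
    norm_num
  have h1 : ‖w + e‖ ≤ s⁻¹ := by
    refine le_trans ?_ h.le
    set θ := InnerProductGeometry.angle (-e) w
    have hθ : 0 ≤ θ := InnerProductGeometry.angle_nonneg _ _
    have hc : Real.cos θ * (‖-e‖ * ‖w‖) = inner ℝ (-e) w :=
      InnerProductGeometry.cos_angle_mul_norm_mul_norm _ _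
    rw [norm_neg, norm_e, hw, inner_neg_left, real_inner_comm] at hc
    have h3 := norm_add_sq_real w e
    rw [hw, norm_e] at h3
    refine le_of_sq_le_sq ?_ hθ
    linarith [Real.one_sub_sq_div_two_le_cos (x := θ)]
  rw [le_div_iff₀ (by linarith)]
  have h4 : ‖w + e‖ * s ≤ 1 := by
    calc ‖w + e‖ * s ≤ s⁻¹ * s := by gcongr
      _ = 1 := inv_mul_cancel₀ hs.ne'
  linarith

section events

variable {u v : E3} {h : ℝ}

lemma le_numCollisions {k : ℕ} (hk : (collision 1 u h v k).isSome) :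
    (k : ℕ∞) ≤ numCollisions 1 u h v := by
  have hs : ((Finset.Icc 1 k : Finset ℕ) : Set ℕ) ⊆
      {j | 1 ≤ j ∧ (collision 1 u h v j).isSome} := fun j hj ↦ by
    obtain ⟨h1, h2⟩ := Finset.mem_Icc.1 hj
    exact ⟨h1, collision_isSome_of_le k hk j h2⟩
  have := encard_le_encard hs
  rw [encard_coe_eq_coe_finsetCard, Nat.card_Icc, Nat.add_sub_cancel] at this
  exact this

lemma isSome_of_le_numCollisions {k : ℕ} (hk : (k : ℕ∞) ≤ numCollisions 1 u h v) :
    (collision 1 u h v k).isSome := by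
  by_contra hc
  rcases Nat.eq_zero_or_pos k with rfl | h0
  · exact hc rfl
  have hs : {j | 1 ≤ j ∧ (collision 1 u h v j).isSome} ⊆
      ((Finset.Ico 1 k : Finset ℕ) : Set ℕ) := fun j hj ↦ by
    refine Finset.mem_coe.2 (Finset.mem_Ico.2 ⟨hj.1, ?_⟩)
    by_contra! hkj
    exact hc (collision_isSome_of_le j hj.2 k hkj)
  have := hk.trans (encard_le_encard hs)
  rw [encard_coe_eq_coe_finsetCard, Nat.card_Ico, Nat.cast_le] at this
  lia

end events

section relPos

variable {p : S2 × ℝ × S2}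

lemma exists_collision_path (hp : p ∈ properSet) {k : ℕ} (hk : 2 ≤ k) {c : Collision}
    (hc : collision 1 p.1 p.2.1 p.2.2 k = some c) :
    ‖c.velocity‖ = 1 ∧ c.time ≤ (k - 1 : ℕ) * (‖(relPos p).2‖ + 2) ∧
      ∀ δ, ‖c.velocity + e‖ ≤ δ → relPos p ∈ pathSet k δ := by
  obtain ⟨ν, w, h, hw, ht⟩ := exists_isPath (norm_S2 p.1) (norm_S2 p.2.2) hp.1 hp.2.1 hp.2.2 hk hc
  exact ⟨hw ▸ h.vel _ (by lia), ht, fun δ hδ ↦ ⟨ν, w, h, by rwa [hw]⟩⟩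

lemma exists_pathSet_of_exitAngleLT (hp : p ∈ properSet) {s : ℝ} (hs : 0 < s)
    (ha : p ∈ exitAngleLT 1 s⁻¹) : ∃ k : ℕ, numCollisions 1 p.1 p.2.1 p.2.2 = k ∧ 2 ≤ k ∧
      relPos p ∈ pathSet k (3 / (1 + s)) := by
  obtain ⟨w, hw, hang⟩ := ha
  unfold exitVelocity at hw
  split_ifs at hw with htop
  obtain ⟨c, hc, rfl⟩ := Option.map_eq_some_iff.1 hw
  have h2 : (2 : ℕ) ≤ numCollisions 1 p.1 p.2.1 p.2.2 := le_numCollisions rfl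
  obtain ⟨k, hk⟩ := ENat.ne_top_iff_exists.1 htop
  rw [← hk, ENat.toNat_natCast] at hc
  rw [← hk, Nat.cast_le] at h2
  obtain ⟨h3, -, h4⟩ := exists_collision_path hp h2 hc
  exact ⟨k, hk.symm, h2, h4 _ (norm_add_e_le_of_angle_lt h3 hs hang)⟩

/-- A supremum above `s` already yields a single collision later than `s`, which also covers
infinitely many collisions. The value `2` for the distance to `-e` imposes no restriction on a unit
velocity. -/
lemma exists_pathSet_of_trappedLongerThan (hp : p ∈ properSet) {s : ℝ} (hs : 0 < s)
    (ha : p ∈ trappedLongerThan 1 s) {n : ℕ} (h2 : 2 ≤ n)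
    (hn : n ≤ numCollisions 1 p.1 p.2.1 p.2.2) :
    ∃ k : ℕ, k ≤ numCollisions 1 p.1 p.2.1 p.2.2 ∧ n ≤ k ∧ relPos p ∈ pathSet k 2 ∧
      s < (k - 1 : ℕ) * (‖(relPos p).2‖ + 2) := by
  have hpath {k : ℕ} (hk : 2 ≤ k) (hkn : k ≤ numCollisions 1 p.1 p.2.1 p.2.2) :
      relPos p ∈ pathSet k 2 := by
    obtain ⟨c, hc⟩ := Option.isSome_iff_exists.1 (isSome_of_le_numCollisions hkn)
    obtain ⟨h1, -, h⟩ := exists_collision_path hp hk hc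
    refine h _ ((norm_add_le _ _).trans ?_)
    rw [h1, norm_e]
    norm_num
  have ha' : ENNReal.ofReal s < ⨆ (k : ℕ) (c : Collision)
    (_ : collision 1 p.1 p.2.1 p.2.2 k = some c), ENNReal.ofReal c.time := ha
  simp only [lt_iSup_iff] at ha'
  obtain ⟨k, c, hc, hlt⟩ := ha'
  have hsc := (ENNReal.ofReal_lt_ofReal_iff_of_nonneg hs.le).1 hlt
  have hk2 : 2 ≤ k := by
    by_contra! hk
    interval_cases k
    all_goals
      obtain rfl := Option.some_inj.1 hc
      exact hs.not_gt hsc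
  have hkN : (k : ℕ∞) ≤ numCollisions 1 p.1 p.2.1 p.2.2 := le_numCollisions (by rw [hc]; rfl)
  have ht := (exists_collision_path hp hk2 hc).2.1
  -- The late collision may precede the `n`-th one, so the path is taken up to the later of the two.
  have hmax : ((max k n : ℕ) : ℕ∞) ≤ numCollisions 1 p.1 p.2.1 p.2.2 := by
    rcases le_total k n with h | h <;> simpa [h]
  refine ⟨max k n, hmax, le_max_right _ _, hpath (by lia) hmax, hsc.trans_le (ht.trans ?_)⟩
  gcongr
  exact le_max_left _ _

end relPos

/-! ### The five estimates -/

lemma lam_le_tsum_relPos {E : Set (S2 × ℝ × S2)} {T : ℕ → Set (S2 × E3)}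
    (h : ∀ p ∈ properSet, p ∈ E → ∃ k, relPos p ∈ T k) :
    lam E ≤ ∑' k, lam (properSet ∩ relPos ⁻¹' T k) := by
  refine (lam_le_of_relPos (T := ⋃ k, T k) fun p hp hE ↦ mem_iUnion.2 (h p hp hE)).trans ?_
  rw [preimage_iUnion, inter_iUnion]
  exact measure_iUnion_le _

/-- The two ranges overlap: since `h` and `‖z‖` differ by at most `2`, `h ≤ 10` implies `‖z‖ ≤ 12`,
and `h ≥ 10` implies `‖z‖ ≥ 8`. -/
lemma lam_le_near_add_far {E : Set (S2 × ℝ × S2)} {a b : ℝ≥0∞}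
    (hnear : lam (E ∩ {p | ‖(relPos p).2‖ ≤ 12}) ≤ a)
    (hfar : lam (E ∩ {p | 8 ≤ ‖(relPos p).2‖}) ≤ b) : lam E ≤ a + b := by
  refine (measure_mono fun p hp ↦ ?_).trans ((measure_union_le _ _).trans (add_le_add hnear hfar))
  rcases le_total ‖(relPos p).2‖ 12 with h | h
  · exact .inl ⟨hp, h⟩
  · exact .inr ⟨hp, by rw [mem_ofPred_eq]; linarith⟩

lemma lam_far_time_le : ∃ C : ℝ≥0∞, C ≠ ∞ ∧ ∀ (k : ℕ) (δ ρ : ℝ), 0 < δ → 6 ≤ ρ →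
    lam (properSet ∩ relPos ⁻¹' (pathSet (k + 3) δ ∩ {q | ‖q.2‖ - 2 ∈ Ici ρ})) ≤
      C * ENNReal.ofReal ((ρ ^ k)⁻¹ ^ 2 / ρ) := by
  obtain ⟨C, hC, hle⟩ := lam_far_le
  refine ⟨C, hC, fun k δ ρ hδ hρ ↦ ?_⟩
  refine (hle (k + 3) δ (Ici ρ) (by lia) hδ measurableSet_Ici (Ici_subset_Ici.2 hρ)).1.trans ?_
  gcongr
  exact setLIntegral_Ici_inv_pow_le (by linarith) k

lemma lam_far_angle_le : ∃ C : ℝ≥0∞, C ≠ ∞ ∧ ∀ (k : ℕ) (δ : ℝ), 0 < δ →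
    lam (properSet ∩ relPos ⁻¹' (pathSet (k + 4) δ ∩ {q | ‖q.2‖ - 2 ∈ Ici 6})) ≤
      C * ENNReal.ofReal (δ ^ 2 * (1 / 36) ^ k) := by
  obtain ⟨C, hC, hle⟩ := lam_far_le
  refine ⟨C, hC, fun k δ hδ ↦ ?_⟩
  refine (hle (k + 4) δ (Ici 6) (by lia) hδ measurableSet_Ici le_rfl).2.trans ?_
  gcongr
  calc ∫⁻ b in Ici (6 : ℝ), ENNReal.ofReal ((δ * (b ^ (k + 1))⁻¹) ^ 2)
      = ENNReal.ofReal (δ ^ 2) * ∫⁻ b in Ici (6 : ℝ), ENNReal.ofReal ((b ^ (k + 1))⁻¹ ^ 2) := by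
        rw [← lintegral_const_mul' _ _ ENNReal.ofReal_ne_top]
        simp_rw [mul_pow, ENNReal.ofReal_mul (sq_nonneg δ)]
    _ ≤ ENNReal.ofReal (δ ^ 2) * ENNReal.ofReal (((6 : ℝ) ^ k)⁻¹ ^ 2 / 6) := by
        gcongr
        exact setLIntegral_Ici_inv_pow_le (by norm_num) k
    _ ≤ ENNReal.ofReal (δ ^ 2 * (1 / 36) ^ k) := by
        rw [← ENNReal.ofReal_mul (sq_nonneg δ)]
        refine ENNReal.ofReal_le_ofReal (mul_le_mul_of_nonneg_left ?_ (sq_nonneg δ))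
        have : ((6 : ℝ) ^ k)⁻¹ ^ 2 = (1 / 36) ^ k := by
          rw [← inv_pow, ← pow_mul, mul_comm, pow_mul]
          norm_num
        rw [this]
        exact div_le_self (by positivity) (by norm_num)

lemma lam_exitAngle_near_le : ∃ C : ℝ≥0∞, C ≠ ∞ ∧ ∀ s : ℝ, 0 < s →
    lam {p | p ∈ recollisionSet 1 ∧ p ∈ exitAngleLT 1 s⁻¹ ∧ p.2.1 ≤ 10} ≤
      C * ENNReal.ofReal (1 / (1 + s)) := by
  obtain ⟨C, hC, hle⟩ := lam_near_le
  have hsum : Summable fun k : ℕ ↦ 3 * (1 / ((k + 2 : ℕ) : ℝ) ^ 2) :=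
    ((summable_nat_add_iff 2).2 (Real.summable_one_div_nat_pow.2 one_lt_two)).mul_left 3
  refine ⟨C * ∑' k : ℕ, ENNReal.ofReal (3 * (1 / ((k + 2 : ℕ) : ℝ) ^ 2)),
    ENNReal.mul_ne_top hC hsum.tsum_ofReal_ne_top, fun s hs ↦ ?_⟩
  refine le_trans (lam_le_tsum_relPos
    (T := fun k ↦ pathSet (k + 2) (3 / (1 + s)) ∩ {q | ‖q.2‖ ≤ 12}) ?_) ?_
  · rintro p hp ⟨-, ha, hh⟩
    obtain ⟨k, -, hk, hpath⟩ := exists_pathSet_of_exitAngleLT hp hs ha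
    have := abs_le.1 (norm_relPos_sub_le hp)
    exact ⟨k - 2, by rwa [Nat.sub_add_cancel hk], by rw [mem_ofPred_eq]; linarith⟩
  · rw [mul_assoc, ← ENNReal.tsum_mul_right, ← ENNReal.tsum_mul_left]
    refine ENNReal.tsum_le_tsum fun k ↦ (hle (k + 2) _ (by lia) (by positivity)).trans_eq ?_
    rw [← ENNReal.ofReal_mul (by positivity)]
    congr 2
    field_simp

lemma lam_exitAngle_three_le : ∃ C : ℝ≥0∞, C ≠ ∞ ∧ ∀ s : ℝ, 0 < s →
    lam {p | p ∈ recollisionSet 1 ∧ p ∈ exitAngleLT 1 s⁻¹ ∧ 10 ≤ p.2.1 ∧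
      numCollisions 1 p.1 p.2.1 p.2.2 = 3} ≤ C * ENNReal.ofReal (1 / (1 + s)) := by
  obtain ⟨C, hC, hle⟩ := lam_far_le
  obtain ⟨C', hC', hle'⟩ := lam_far_time_le
  refine ⟨C * ENNReal.ofReal 9 + C', ENNReal.add_ne_top.2
    ⟨ENNReal.mul_ne_top hC ENNReal.ofReal_ne_top, hC'⟩, fun s hs ↦ ?_⟩
  have hδ : 0 < 3 / (1 + s) := by positivity
  -- For three collisions the bound in `δ` has no decay in the distance. It is used up to distance
  -- of order `s`, giving `s δ ^ 2`; beyond, the tail of `b⁻²` gives `1 / (6 + s)`.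
  refine le_trans (lam_le_of_relPos
    (T := pathSet 3 (3 / (1 + s)) ∩ {q | ‖q.2‖ - 2 ∈ Icc 6 (6 + s)} ∪
      pathSet (0 + 3) (3 / (1 + s)) ∩ {q | ‖q.2‖ - 2 ∈ Ici (6 + s)}) ?_) ?_
  · rintro p hp ⟨-, ha, hh, hN⟩
    obtain ⟨k, hk, -, hpath⟩ := exists_pathSet_of_exitAngleLT hp hs ha
    obtain rfl : 3 = k := by exact_mod_cast hN.symm.trans hk
    have := abs_le.1 (norm_relPos_sub_le hp)
    rcases le_total (‖(relPos p).2‖ - 2) (6 + s) with h | h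
    · exact .inl ⟨hpath, by linarith, h⟩
    · exact .inr ⟨hpath, h⟩
  · rw [preimage_union, inter_union_distrib_left, add_mul]
    refine (measure_union_le _ _).trans (add_le_add ?_ ?_)
    · refine (hle 3 _ _ le_rfl hδ measurableSet_Icc fun x hx ↦ hx.1).2.trans ?_
      rw [mul_assoc, ← ENNReal.ofReal_mul (by norm_num)]
      gcongr
      simp only [tsub_self, pow_zero, inv_one, mul_one, setLIntegral_const, Real.volume_Icc]
      rw [← ENNReal.ofReal_mul (by positivity)]
      refine ENNReal.ofReal_le_ofReal ?_
      rw [div_pow, div_mul_eq_mul_div, mul_one_div, div_le_div_iff₀ (by positivity) (by positivity)]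
      nlinarith
    · refine (hle' 0 _ (6 + s) hδ (by linarith)).trans ?_
      gcongr
      · rw [pow_zero, inv_one, one_pow]
      · norm_num

lemma lam_exitAngle_four_le : ∃ C : ℝ≥0∞, C ≠ ∞ ∧ ∀ s : ℝ, 0 < s →
    lam {p | p ∈ recollisionSet 1 ∧ p ∈ exitAngleLT 1 s⁻¹ ∧ 10 ≤ p.2.1 ∧
      4 ≤ numCollisions 1 p.1 p.2.1 p.2.2} ≤ C * ENNReal.ofReal (1 / (1 + s) ^ 2) := by
  obtain ⟨C, hC, hle⟩ := lam_far_angle_le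
  have hsum : Summable fun k : ℕ ↦ 9 * (1 / 36 : ℝ) ^ k :=
    (summable_geometric_of_lt_one (by norm_num) (by norm_num)).mul_left 9
  refine ⟨C * ∑' k : ℕ, ENNReal.ofReal (9 * (1 / 36 : ℝ) ^ k),
    ENNReal.mul_ne_top hC hsum.tsum_ofReal_ne_top, fun s hs ↦ ?_⟩
  refine le_trans (lam_le_tsum_relPos
    (T := fun k ↦ pathSet (k + 4) (3 / (1 + s)) ∩ {q | ‖q.2‖ - 2 ∈ Ici 6}) ?_) ?_
  · rintro p hp ⟨-, ha, hh, hN⟩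
    obtain ⟨k, hk, -, hpath⟩ := exists_pathSet_of_exitAngleLT hp hs ha
    have h4 : 4 ≤ k := by
      rw [hk] at hN
      exact_mod_cast hN
    have := abs_le.1 (norm_relPos_sub_le hp)
    exact ⟨k - 4, by rwa [Nat.sub_add_cancel h4], show 6 ≤ ‖(relPos p).2‖ - 2 by linarith⟩
  · rw [mul_assoc, ← ENNReal.tsum_mul_right, ← ENNReal.tsum_mul_left]
    refine ENNReal.tsum_le_tsum fun k ↦ (hle k _ (by positivity)).trans_eq ?_
    rw [← ENNReal.ofReal_mul (by positivity)]
    congr 2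
    field_simp
    norm_num

lemma lam_trapped_three_le : ∃ C : ℝ≥0∞, C ≠ ∞ ∧ ∀ s : ℝ, 0 < s →
    lam {p | p ∈ recollisionSet 1 ∧ p ∈ trappedLongerThan 1 s ∧
      numCollisions 1 p.1 p.2.1 p.2.2 = 3} ≤ C * ENNReal.ofReal (1 / (1 + s)) := by
  obtain ⟨C, hC, hle⟩ := lam_near_le
  obtain ⟨C', hC', hle'⟩ := lam_far_time_le
  refine ⟨C * ENNReal.ofReal 29 + C' * ENNReal.ofReal 5, ENNReal.add_ne_top.2
    ⟨ENNReal.mul_ne_top hC ENNReal.ofReal_ne_top,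
      ENNReal.mul_ne_top hC' ENNReal.ofReal_ne_top⟩, fun s hs ↦ ?_⟩
  have key (p) (hp : p ∈ properSet) (ha : p ∈ trappedLongerThan 1 s)
      (hN : numCollisions 1 p.1 p.2.1 p.2.2 = 3) :
      relPos p ∈ pathSet 3 2 ∧ s < 2 * (‖(relPos p).2‖ + 2) := by
    obtain ⟨k, hkN, h3, hpath, hlt⟩ :=
      exists_pathSet_of_trappedLongerThan hp hs ha (n := 3) (by lia) hN.ge
    rw [hN] at hkN
    obtain rfl : k = 3 := le_antisymm (by exact_mod_cast hkN) h3
    exact ⟨hpath, by simpa using hlt⟩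
  rw [add_mul, mul_assoc, mul_assoc, ← ENNReal.ofReal_mul (by norm_num),
    ← ENNReal.ofReal_mul (by norm_num)]
  refine lam_le_near_add_far ?_ ?_
  -- Three collisions at distance at most `12` are over by time `2 * (12 + 2) = 28`.
  · rcases lt_or_ge s 28 with h28 | h28
    · refine le_trans (lam_le_of_relPos (T := pathSet 3 2 ∩ {q | ‖q.2‖ ≤ 12}) ?_) ?_
      · rintro p hp ⟨⟨-, ha, hN⟩, hz⟩
        exact ⟨(key p hp ha hN).1, hz⟩
      refine (hle 3 2 (by lia) (by norm_num)).trans ?_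
      gcongr
      rw [mul_one_div, div_le_div_iff₀ (by positivity) (by positivity)]
      push_cast
      linarith
    · refine le_trans (lam_le_of_relPos (T := ∅) ?_) ?_
      · rintro p hp ⟨⟨-, ha, hN⟩, hz⟩
        have := (key p hp ha hN).2
        rw [mem_ofPred_eq] at hz
        linarith
      · simp
  · refine le_trans (lam_le_of_relPos
      (T := pathSet (0 + 3) 2 ∩ {q | ‖q.2‖ - 2 ∈ Ici (max 6 (s / 4))}) ?_) ?_
    · rintro p hp ⟨⟨-, ha, hN⟩, hz⟩
      refine ⟨(key p hp ha hN).1, ?_⟩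
      have := (key p hp ha hN).2
      rw [mem_ofPred_eq] at hz
      exact show max 6 (s / 4) ≤ ‖(relPos p).2‖ - 2 from max_le (by linarith) (by linarith)
    · refine (hle' 0 2 _ (by norm_num) (le_max_left _ _)).trans ?_
      gcongr
      rw [pow_zero, inv_one, one_pow, mul_one_div,
        div_le_div_iff₀ (by positivity) (by positivity)]
      linarith [le_max_left 6 (s / 4), le_max_right 6 (s / 4)]

lemma lam_trapped_four_le : ∃ C : ℝ≥0∞, C ≠ ∞ ∧ ∀ s : ℝ, 0 < s →
    lam {p | p ∈ recollisionSet 1 ∧ p ∈ trappedLongerThan 1 s ∧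
      4 ≤ numCollisions 1 p.1 p.2.1 p.2.2} ≤ C * ENNReal.ofReal (1 / (1 + s ^ 2)) := by
  obtain ⟨C, hC, hle⟩ := lam_near_le
  obtain ⟨C', hC', hle'⟩ := lam_far_time_le
  have hsum : Summable fun k : ℕ ↦ 5 * ((k + 4 : ℝ) ^ 2 * (1 / 36) ^ k) := by
    have h36 : ‖(1 / 36 : ℝ)‖ < 1 := by norm_num
    refine (((summable_pow_mul_geometric_of_norm_lt_one 2 h36).add
      ((summable_pow_mul_geometric_of_norm_lt_one 1 h36).mul_left 8)).add
      ((summable_pow_mul_geometric_of_norm_lt_one 0 h36).mul_left 16)).mul_left 5 |>.congr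
      fun k ↦ ?_
    ring
  refine ⟨C * ENNReal.ofReal 394 + C' * ∑' k : ℕ,
    ENNReal.ofReal (5 * ((k + 4 : ℝ) ^ 2 * (1 / 36) ^ k)), ENNReal.add_ne_top.2
    ⟨ENNReal.mul_ne_top hC ENNReal.ofReal_ne_top,
      ENNReal.mul_ne_top hC' hsum.tsum_ofReal_ne_top⟩, fun s hs ↦ ?_⟩
  have key (p) (hp : p ∈ properSet) (ha : p ∈ trappedLongerThan 1 s)
      (hN : 4 ≤ numCollisions 1 p.1 p.2.1 p.2.2) : ∃ k, 4 ≤ k ∧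
      relPos p ∈ pathSet k 2 ∧ s < k * (‖(relPos p).2‖ + 2) := by
    obtain ⟨k, -, h4, hpath, hlt⟩ :=
      exists_pathSet_of_trappedLongerThan hp hs ha (n := 4) (by lia) hN
    refine ⟨k, h4, hpath, hlt.trans_le ?_⟩
    gcongr
    lia
  rw [add_mul, mul_assoc, mul_assoc]
  refine lam_le_near_add_far ?_ ?_
  -- At distance at most `12` a flight lasts at most `14`, so trapping beyond `s` requires `K`
  -- collisions. Truncating all paths to exactly `K` collisions avoids a sum and gives `2 / K ^ 2`;
  -- the constant `394` is `2 * 14 ^ 2 + 2`.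
  · set K := max 4 ⌈s / 14⌉₊ with hK
    have hK4 : 4 ≤ K := le_max_left _ _
    have hKs : s / 14 ≤ K := (Nat.le_ceil _).trans (by exact_mod_cast le_max_right _ _)
    refine le_trans (lam_le_of_relPos (T := pathSet K 2 ∩ {q | ‖q.2‖ ≤ 12}) ?_) ?_
    · rintro p hp ⟨⟨-, ha, hN⟩, hz⟩
      refine ⟨?_, hz⟩
      obtain ⟨k, h4, ⟨ν, w, hpath, -⟩, hlt⟩ := key p hp ha hN
      have hKk : K ≤ k := by
        refine max_le h4 (Nat.ceil_le.2 ?_)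
        rw [div_le_iff₀ (by norm_num)]
        refine hlt.le.trans ?_
        rw [mem_ofPred_eq] at hz
        gcongr
        linarith
      refine ⟨ν, w, hpath.take hKk, (norm_add_le _ _).trans ?_⟩
      rw [norm_e]
      linarith [hpath.vel_le (K - 1)]
    · refine (hle K 2 (by lia) (by norm_num)).trans ?_
      rw [← ENNReal.ofReal_mul (by norm_num)]
      gcongr
      have hK4' : (4 : ℝ) ≤ K := by exact_mod_cast hK4
      rw [mul_one_div, div_le_div_iff₀ (by positivity) (by positivity)]
      nlinarith
  -- With `k + 4` collisions and `D ≥ 8`, one has `s < (k + 4) (D + 2) ≤ 2 (k + 4) (D - 2)`. The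
  -- factor `(k + 4) ^ 2` lost in this way is absorbed by the geometric decay `36⁻ᵏ`.
  · refine le_trans (lam_le_tsum_relPos (T := fun k ↦ pathSet (k + 1 + 3) 2 ∩
      {q | ‖q.2‖ - 2 ∈ Ici (max 6 (s / (2 * (k + 4))))}) ?_) ?_
    · rintro p hp ⟨⟨-, ha, hN⟩, hz⟩
      obtain ⟨k, h4, hpath, hlt⟩ := key p hp ha hN
      obtain ⟨i, rfl⟩ := Nat.exists_eq_add_of_le' h4
      rw [mem_ofPred_eq] at hz
      refine ⟨i, hpath, show max 6 (s / (2 * (i + 4))) ≤ ‖(relPos p).2‖ - 2 from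
        max_le (by linarith) ?_⟩
      push_cast at hlt
      rw [div_le_iff₀ (by positivity)]
      refine hlt.le.trans ?_
      nlinarith [(Nat.cast_nonneg i : (0 : ℝ) ≤ i)]
    · rw [← ENNReal.tsum_mul_right, ← ENNReal.tsum_mul_left]
      refine ENNReal.tsum_le_tsum fun k ↦
        (hle' (k + 1) _ _ (by norm_num) (le_max_left _ _)).trans ?_
      rw [← ENNReal.ofReal_mul (by positivity)]
      gcongr
      have hρ := le_max_left 6 (s / (2 * (k + 4 : ℝ)))
      have hs1 := le_max_right 6 (s / (2 * (k + 4 : ℝ)))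
      set ρ := max 6 (s / (2 * (k + 4 : ℝ)))
      rw [div_le_iff₀ (by positivity)] at hs1
      have h36 : ((ρ ^ k)⁻¹) ^ 2 ≤ (1 / 36) ^ k := by
        calc ((ρ ^ k)⁻¹) ^ 2 ≤ (((6 : ℝ) ^ k)⁻¹) ^ 2 := by gcongr
          _ = (1 / 36) ^ k := by
            rw [← inv_pow, ← pow_mul, mul_comm, pow_mul]
            norm_num
      have hkk : (0 : ℝ) ≤ k := k.cast_nonneg
      have hs2 : 1 + s ^ 2 ≤ 5 * (k + 4 : ℝ) ^ 2 * ρ ^ 2 := by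
        have h1 : s ^ 2 ≤ (ρ * (2 * (k + 4 : ℝ))) ^ 2 := by gcongr
        have h2 : 1 ≤ (k + 4 : ℝ) * ρ := by nlinarith
        nlinarith [one_le_pow₀ h2 (n := 2)]
      calc (ρ ^ (k + 1))⁻¹ ^ 2 / ρ ≤ (ρ ^ (k + 1))⁻¹ ^ 2 :=
            div_le_self (by positivity) (by linarith)
        _ = (ρ ^ k)⁻¹ ^ 2 * (1 / ρ ^ 2) := by
            field_simp
            ring
        _ ≤ (1 / 36) ^ k * (5 * (k + 4 : ℝ) ^ 2 / (1 + s ^ 2)) := by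
            refine mul_le_mul h36 ?_ (by positivity) (by positivity)
            rw [div_le_div_iff₀ (by positivity) (by positivity)]
            linarith
        _ = 5 * ((k + 4 : ℝ) ^ 2 * (1 / 36) ^ k) * (1 / (1 + s ^ 2)) := by ring

end Recollision

theorem lemma2p4 :
    ∃ C : ℝ, 0 < C ∧ ∀ s : ℝ, 0 < s →
      Recollision.lam {p | p ∈ Recollision.recollisionSet 1 ∧ p ∈ Recollision.exitAngleLT 1 s⁻¹ ∧
          p.2.1 ≤ 10} ≤ ENNReal.ofReal (C / (1 + s)) ∧
      Recollision.lam {p | p ∈ Recollision.recollisionSet 1 ∧ p ∈ Recollision.exitAngleLT 1 s⁻¹ ∧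
          10 ≤ p.2.1 ∧ Recollision.numCollisions 1 p.1 p.2.1 p.2.2 = 3} ≤
        ENNReal.ofReal (C / (1 + s)) ∧
      Recollision.lam {p | p ∈ Recollision.recollisionSet 1 ∧ p ∈ Recollision.exitAngleLT 1 s⁻¹ ∧
          10 ≤ p.2.1 ∧ 4 ≤ Recollision.numCollisions 1 p.1 p.2.1 p.2.2} ≤
        ENNReal.ofReal (C / (1 + s) ^ 2) ∧
      Recollision.lam {p | p ∈ Recollision.recollisionSet 1 ∧
          p ∈ Recollision.trappedLongerThan 1 s ∧
          Recollision.numCollisions 1 p.1 p.2.1 p.2.2 = 3} ≤ ENNReal.ofReal (C / (1 + s)) ∧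
      Recollision.lam {p | p ∈ Recollision.recollisionSet 1 ∧
          p ∈ Recollision.trappedLongerThan 1 s ∧
          4 ≤ Recollision.numCollisions 1 p.1 p.2.1 p.2.2} ≤ ENNReal.ofReal (C / (1 + s ^ 2)) := by
  obtain ⟨C₁, hC₁, h₁⟩ := Recollision.lam_exitAngle_near_le
  obtain ⟨C₂, hC₂, h₂⟩ := Recollision.lam_exitAngle_three_le
  obtain ⟨C₃, hC₃, h₃⟩ := Recollision.lam_exitAngle_four_le
  obtain ⟨C₄, hC₄, h₄⟩ := Recollision.lam_trapped_three_le
  obtain ⟨C₅, hC₅, h₅⟩ := Recollision.lam_trapped_four_le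
  have hC : C₁ + C₂ + C₃ + C₄ + C₅ ≠ ∞ := by simp [hC₁, hC₂, hC₃, hC₄, hC₅]
  have key {a : ℝ≥0∞} (x : ℝ) (ha : a ≤ C₁ + C₂ + C₃ + C₄ + C₅) :
      a * ENNReal.ofReal (1 / x) ≤
        ENNReal.ofReal (((C₁ + C₂ + C₃ + C₄ + C₅).toReal + 1) / x) := by
    rw [div_eq_mul_one_div (_ + 1) x, ENNReal.ofReal_mul (by positivity)]
    gcongr
    refine ha.trans ?_
    rw [ENNReal.ofReal_add ENNReal.toReal_nonneg zero_le_one, ENNReal.ofReal_toReal hC]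
    exact le_self_add
  refine ⟨(C₁ + C₂ + C₃ + C₄ + C₅).toReal + 1, by positivity, fun s hs ↦
    ⟨(h₁ s hs).trans (key _ ?_), (h₂ s hs).trans (key _ ?_), (h₃ s hs).trans (key _ ?_),
      (h₄ s hs).trans (key _ ?_), (h₅ s hs).trans (key _ ?_)⟩⟩
  · simp only [add_assoc, le_self_add]
  · calc C₂ ≤ C₁ + C₂ := le_add_self
      _ ≤ _ := by simp only [add_assoc, le_self_add, add_le_add, le_refl]
  · calc C₃ ≤ C₁ + C₂ + C₃ := le_add_self
      _ ≤ _ := by rw [add_assoc _ C₄]; exact le_self_add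
  · calc C₄ ≤ C₁ + C₂ + C₃ + C₄ := le_add_self
      _ ≤ _ := le_self_add
  · exact le_add_self
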